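/- Let $n,k\ge 1$ and $N\ge 0$ be integers and $L=\lfloor N/n\rfloor$. Let $\mathbb C[X,A]$ be the polynomial ring in the entries of an $N\times N$ matrix $X=(X^i_j)$ and an $n\times N$ matrix $A=(A^a_i)$, and let $$\mathcal H_N=\{f\in\mathbb C[X,A] : f(hXh^{-1},Ah^{-1})=\det(h)^{-k}f(X,A)\ \text{ for all } h\in \mathrm{GL}_N(\mathbb C)\}.$$ Equip $\mathbb C[X,A]$, and hence $\mathcal H_N$, with the Hermitian inner product for which the monomials are orthogonal and $\langle x^m|x^m\rangle=m!:=\prod_v m_v!$ for every exponent vector $m$ (the one for which each coordinate $x_v$ is adjoint to $\partial/\partial x_v$ and $\langle 1|1\rangle=1$). Let $Y^i_j=\partial/\partial X^j_i$, $B^i_a=\partial/\partial A^a_i$, and let $(XY)^i_j=\sum_l X^i_lY^l_j$ be regarded as an $N\times N$ matrix of operators. For $1\le a,b\le n$ let $${}^{L}\widetilde T^a_b(u)=\Big[\delta^a_b+\sum_{s\ge0}u^{-s-1}\sum_{i,j=1}^N A^a_i\big((XY-(k+n)L)^s\big)^i_jB^j_b\Big]\prod_{j=1}^{L}\frac{u+(n+k)j}{u+k+(n+k)j},$$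 that is, $\big[\delta^a_b+A^a(u+(k+n)L-XY)^{-1}B_b\big]\prod_{j=1}^L\frac{u+(n+k)j}{u+k+(n+k)j}$ expanded at $u=\infty$; it is a power series in $u^{-1}$ whose coefficients are operators on $\mathcal H_N$. On $\mathcal H_{N+n}$ the same formula is used with $N+n$ and $L+1$ in place of $N$ and $L$, and gives ${}^{L+1}\widetilde T^a_b(u)$. Split $\mathbb C^{N+n}=\mathbb C^N\oplus\mathbb C^n$, let $\eta$ be an $n\times n$ matrix of further variables, and for $f\in\mathcal H_{N+n}$ let $f(X\oplus 0,(A,\eta))\in\mathbb C[X,A,\eta]$ be its restriction to pairs consisting of a block diagonal matrix $X\oplus 0$ and a framing $(A,\eta)$. Then there is a unique linear map $p_N:\mathcal H_{N+n}\to\mathcal H_N$ with $$f(X\oplus 0,(A,\eta))=\det(X)^k\det(\eta)^k\,(p_Nf)(X,A)\qquad\text{for all } f\in\mathcal H_{N+n};$$ there is a unique linear map $\sigma_N:\mathcal H_N\to\mathcal H_{N+n}$ with $p_N\circ\sigma_N=\mathrm{id}$ and image in $\ker(p_N)^\perp$; and for all $1\le a,b\le n$ (coefficientwise in $u^{-1}$)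 $$p_N\circ {}^{L+1}\widetilde T^a_b(u)={}^{L}\widetilde T^a_b(u)\circ p_N,\qquad \sigma_N\circ {}^{L}\widetilde T^a_b(u)={}^{L+1}\widetilde T^a_b(u)\circ\sigma_N .$$ -/

import Mathlib

open MvPolynomial

noncomputable section

namespace MatrixModel

/-- Index set of the coordinates on `End(ℂ^N) × Hom(ℂ^n, ℂ^N)`: `Sum.inl (i, j)` is `X^i_j`
and `Sum.inr (a, i)` is `A^a_i`. -/
abbrev Coord (N n : ℕ) : Type := (Fin N × Fin N) ⊕ (Fin n × Fin N)

/-- The polynomial ring `ℂ[X, A]`. -/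
abbrev Poly (N n : ℕ) : Type := MvPolynomial (Coord N n) ℂ

/-- Linear operators on `ℂ[X, A]`; multiplication is composition. -/
abbrev Op (N n : ℕ) : Type := Module.End ℂ (Poly N n)

/-- The matrix of coordinate functions `X^i_j`. -/
def coordX (N n : ℕ) : Matrix (Fin N) (Fin N) (Poly N n) :=
  Matrix.of fun i j => X (Sum.inl (i, j))

/-- The matrix of coordinate functions `A^a_i`. -/
def coordA (N n : ℕ) : Matrix (Fin n) (Fin N) (Poly N n) :=
  Matrix.of fun a i => X (Sum.inr (a, i))

/-- The substitution `f(X, A) ↦ f(h X h⁻¹, A h⁻¹)`. -/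
def gaugeAct {N n : ℕ} (h : GL (Fin N) ℂ) : Poly N n →ₐ[ℂ] Poly N n :=
  let P : Matrix (Fin N) (Fin N) (Poly N n) := (h : Matrix (Fin N) (Fin N) ℂ).map C
  let Q : Matrix (Fin N) (Fin N) (Poly N n) :=
    ((h⁻¹ : GL (Fin N) ℂ) : Matrix (Fin N) (Fin N) ℂ).map C
  aeval (Sum.elim
    (fun ij => (P * coordX N n * Q : Matrix (Fin N) (Fin N) (Poly N n)) ij.1 ij.2)
    (fun ai => (coordA N n * Q : Matrix (Fin n) (Fin N) (Poly N n)) ai.1 ai.2))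

/-- The Hilbert space `ℂ[X, A]^{GL_N, -k}` of polynomials on which `GL_N` acts through
`det ^ (-k)`. -/
def hilb (N n k : ℕ) : Submodule ℂ (Poly N n) where
  carrier := {f | ∀ h : GL (Fin N) ℂ,
    gaugeAct h f = ((h : Matrix (Fin N) (Fin N) ℂ).det ^ k)⁻¹ • f}
  add_mem' := by
    intro f g hf hg h
    rw [map_add, hf h, hg h, smul_add]
  zero_mem' := by
    intro h
    simp
  smul_mem' := by
    intro c f hf h
    rw [map_smul, hf h, smul_comm]

/-- `X^i_j` acting by multiplication. -/
def opX (N n : ℕ) : Matrix (Fin N) (Fin N) (Op N n) :=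
  Matrix.of fun i j => LinearMap.mulLeft ℂ (X (Sum.inl (i, j)))

/-- `Y^i_j = ∂/∂X^j_i`. -/
def opY (N n : ℕ) : Matrix (Fin N) (Fin N) (Op N n) :=
  Matrix.of fun i j => (pderiv (Sum.inl (j, i)) : Derivation ℂ (Poly N n) (Poly N n)).toLinearMap

/-- `A^a_i` acting by multiplication. -/
def opA (N n : ℕ) : Matrix (Fin n) (Fin N) (Op N n) :=
  Matrix.of fun a i => LinearMap.mulLeft ℂ (X (Sum.inr (a, i)))

/-- `B^i_a = ∂/∂A^a_i`. -/
def opB (N n : ℕ) : Matrix (Fin N) (Fin n) (Op N n) :=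
  Matrix.of fun i a => (pderiv (Sum.inr (a, i)) : Derivation ℂ (Poly N n) (Poly N n)).toLinearMap

/-- The operators `A^a (X Y - c)^s B_b`, the coefficients of
`A^a (u + c - X Y)⁻¹ B_b = ∑_s A^a (X Y - c)^s B_b u^{-s-1}`. -/
def mode (N n : ℕ) (c : ℂ) (s : ℕ) : Matrix (Fin n) (Fin n) (Op N n) :=
  opA N n * (opX N n * opY N n - c • (1 : Matrix (Fin N) (Fin N) (Op N n))) ^ s * opB N n

section Invariance

variable {N n : ℕ}

/-- Entrywise intertwining of two matrices of operators by one operator. -/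
def Rel {α β : Type} (G : Op N n) (M M' : Matrix α β (Op N n)) : Prop :=
  ∀ i j, G * M i j = M' i j * G

lemma Rel.mul {α β γ : Type} [Fintype β] {G : Op N n} {M M' : Matrix α β (Op N n)}
    {P P' : Matrix β γ (Op N n)} (h : Rel G M M') (h' : Rel G P P') :
    Rel G (M * P) (M' * P') := by
  intro i j
  rw [Matrix.mul_apply, Matrix.mul_apply, Finset.mul_sum, Finset.sum_mul]
  refine Finset.sum_congr rfl fun l _ => ?_
  rw [← mul_assoc, h, mul_assoc, h', mul_assoc]

lemma Rel.sub {α β : Type} {G : Op N n} {M M' P P' : Matrix α β (Op N n)}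
    (h : Rel G M M') (h' : Rel G P P') : Rel G (M - P) (M' - P') := by
  intro i j
  rw [Matrix.sub_apply, Matrix.sub_apply, mul_sub, sub_mul, h, h']

lemma Rel.smul_one {α : Type} [DecidableEq α] (G : Op N n) (c : ℂ) :
    Rel G (c • (1 : Matrix α α (Op N n))) (c • 1) := by
  intro i j
  by_cases h : i = j <;> simp [h]

lemma Rel.pow {α : Type} [Fintype α] [DecidableEq α] {G : Op N n} {M M' : Matrix α α (Op N n)}
    (h : Rel G M M') (s : ℕ) : Rel G (M ^ s) (M' ^ s) := by
  induction s with
  | zero =>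
    intro i j
    by_cases h : i = j <;> simp [h]
  | succ s ih =>
    rw [pow_succ, pow_succ]
    exact ih.mul h

/-- Complex matrices as matrices of scalar operators. -/
def scal (N n : ℕ) : Matrix (Fin N) (Fin N) ℂ →+* Matrix (Fin N) (Fin N) (Op N n) :=
  (algebraMap ℂ (Op N n)).mapMatrix

lemma pderiv_aeval {σ : Type} [Fintype σ] (F : σ → MvPolynomial σ ℂ) (v : σ)
    (f : MvPolynomial σ ℂ) :
    pderiv v (aeval F f) = ∑ w, pderiv v (F w) * aeval F (pderiv w f) := by
  classical
  induction f using MvPolynomial.induction_on with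
  | C a => simp
  | add p q hp hq => simp only [map_add, hp, hq, mul_add, Finset.sum_add_distrib]
  | mul_X p w hp =>
    simp only [map_mul, aeval_X, Derivation.leibniz, smul_eq_mul, hp, map_add, mul_add,
      Finset.sum_add_distrib, pderiv_X, Finset.mul_sum]
    congr 1
    · rw [Finset.sum_eq_single w]
      · simp [mul_comm]
      · intro b _ hb
        simp [Pi.single_eq_of_ne hb.symm]
      · simp
    · exact Finset.sum_congr rfl fun _ _ => by ring

lemma gaugeAct_X (h : GL (Fin N) ℂ) (i j : Fin N) :
    gaugeAct h (X (Sum.inl (i, j)) : Poly N n) =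
      ∑ q, ∑ p, C (h.1 i p * h⁻¹.1 q j) * X (Sum.inl (p, q)) := by
  simp only [gaugeAct, aeval_X, Sum.elim_inl, Matrix.mul_apply, Matrix.map_apply, coordX,
    Matrix.of_apply, Finset.sum_mul, C_mul]
  exact Finset.sum_congr rfl fun _ _ => Finset.sum_congr rfl fun _ _ => by ring

lemma gaugeAct_A (h : GL (Fin N) ℂ) (a : Fin n) (i : Fin N) :
    gaugeAct h (X (Sum.inr (a, i)) : Poly N n) =
      ∑ q, C (h⁻¹.1 q i) * X (Sum.inr (a, q)) := by
  simp only [gaugeAct, aeval_X, Sum.elim_inr, Matrix.mul_apply, Matrix.map_apply, coordA,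
    Matrix.of_apply]
  exact Finset.sum_congr rfl fun _ _ => by ring

lemma scal_apply (M : Matrix (Fin N) (Fin N) ℂ) (i j : Fin N) :
    scal N n M i j = algebraMap ℂ (Op N n) (M i j) := rfl

lemma rel_opX (h : GL (Fin N) ℂ) :
    Rel (gaugeAct h).toLinearMap (opX N n) (scal N n h.1 * opX N n * scal N n h⁻¹.1) := by
  intro i j
  refine LinearMap.ext fun f => ?_
  have h1 : ((gaugeAct h).toLinearMap * opX N n i j : Op N n) f =
      gaugeAct h (X (Sum.inl (i, j)) * f) := rfl
  rw [h1, map_mul, gaugeAct_X]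
  simp [Matrix.mul_apply, scal_apply, opX, Finset.sum_mul, Finset.mul_sum, Algebra.algebraMap_eq_smul_one,
    MvPolynomial.smul_eq_C_mul, mul_assoc, mul_left_comm]

lemma rel_opA (h : GL (Fin N) ℂ) :
    Rel (gaugeAct h).toLinearMap (opA N n) (opA N n * scal N n h⁻¹.1) := by
  intro a i
  refine LinearMap.ext fun f => ?_
  have h1 : ((gaugeAct h).toLinearMap * opA N n a i : Op N n) f =
      gaugeAct h (X (Sum.inr (a, i)) * f) := rfl
  rw [h1, map_mul, gaugeAct_A]
  simp [Matrix.mul_apply, scal_apply, opA, Finset.sum_mul, Algebra.algebraMap_eq_smul_one,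
    MvPolynomial.smul_eq_C_mul, mul_assoc, mul_left_comm]

lemma pderiv_gaugeAct (h : GL (Fin N) ℂ) (v : Coord N n) (f : Poly N n) :
    pderiv v (gaugeAct h f) =
      ∑ w, pderiv v (gaugeAct h (X w)) * gaugeAct h (pderiv w f) := by
  simp only [gaugeAct, pderiv_aeval, aeval_X]

lemma opY_gaugeAct (h : GL (Fin N) ℂ) (i j : Fin N) (f : Poly N n) :
    pderiv (Sum.inl (i, j)) (gaugeAct h f) =
      ∑ p, ∑ q, (h.1 p i * h⁻¹.1 j q) • gaugeAct h (pderiv (Sum.inl (p, q)) f) := by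
  classical
  rw [pderiv_gaugeAct, Fintype.sum_sum_type, Fintype.sum_prod_type, Fintype.sum_prod_type]
  have h1 : ∀ p q, pderiv (Sum.inl (i, j)) (gaugeAct h (X (Sum.inl (p, q)) : Poly N n)) =
      C (h.1 p i * h⁻¹.1 j q) := by
    intro p q
    rw [gaugeAct_X, map_sum, Finset.sum_eq_single j, map_sum, Finset.sum_eq_single i]
    · simp [Derivation.leibniz]
    · intro b _ hb
      simp [Derivation.leibniz, pderiv_X, hb]
    · simp
    · intro b _ hb
      rw [map_sum]
      refine Finset.sum_eq_zero fun c _ => ?_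
      simp [Derivation.leibniz, pderiv_X, hb]
    · simp
  have h2 : ∀ a q, pderiv (Sum.inl (i, j)) (gaugeAct h (X (Sum.inr (a, q)) : Poly N n)) = 0 := by
    intro a q
    rw [gaugeAct_A, map_sum]
    exact Finset.sum_eq_zero fun c _ => by simp [Derivation.leibniz, pderiv_X]
  simp only [h1, h2, zero_mul, Finset.sum_const_zero, add_zero, smul_eq_C_mul]

lemma opB_gaugeAct (h : GL (Fin N) ℂ) (a : Fin n) (i : Fin N) (f : Poly N n) :
    pderiv (Sum.inr (a, i)) (gaugeAct h f) =
      ∑ q, h⁻¹.1 i q • gaugeAct h (pderiv (Sum.inr (a, q)) f) := by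
  classical
  rw [pderiv_gaugeAct, Fintype.sum_sum_type, Fintype.sum_prod_type, Fintype.sum_prod_type]
  have h1 : ∀ p q, pderiv (Sum.inr (a, i)) (gaugeAct h (X (Sum.inl (p, q)) : Poly N n)) = 0 := by
    intro p q
    rw [gaugeAct_X, map_sum]
    refine Finset.sum_eq_zero fun b _ => ?_
    rw [map_sum]
    exact Finset.sum_eq_zero fun c _ => by simp [Derivation.leibniz, pderiv_X]
  have h2 : ∀ b q, pderiv (Sum.inr (a, i)) (gaugeAct h (X (Sum.inr (b, q)) : Poly N n)) =
      if b = a then C (h⁻¹.1 i q) else 0 := by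
    intro b q
    rw [gaugeAct_A, map_sum]
    split_ifs with hb
    · subst hb
      rw [Finset.sum_eq_single i]
      · simp [Derivation.leibniz]
      · intro c _ hc
        simp [Derivation.leibniz, pderiv_X, hc]
      · simp
    · exact Finset.sum_eq_zero fun c _ => by
        simp [Derivation.leibniz, pderiv_X, hb]
  simp only [h1, h2, zero_mul, Finset.sum_const_zero, zero_add, smul_eq_C_mul]
  rw [Finset.sum_eq_single a]
  · simp
  · intro b _ hb
    simp [hb]
  · simp

lemma scal_inv_mul (h : GL (Fin N) ℂ) : scal N n h⁻¹.1 * scal N n h.1 = 1 := by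
  rw [← map_mul, ← Units.val_mul, inv_mul_cancel, Units.val_one, map_one]

lemma scal_mul_inv (h : GL (Fin N) ℂ) : scal N n h.1 * scal N n h⁻¹.1 = 1 := by
  rw [← map_mul, ← Units.val_mul, mul_inv_cancel, Units.val_one, map_one]

/-- Right multiplication of all entries by one operator. -/
def rmul {α β : Type} (M : Matrix α β (Op N n)) (G : Op N n) : Matrix α β (Op N n) :=
  Matrix.of fun i j => M i j * G

/-- Left multiplication of all entries by one operator. -/
def lmul {α β : Type} (G : Op N n) (M : Matrix α β (Op N n)) : Matrix α β (Op N n) :=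
  Matrix.of fun i j => G * M i j

lemma mul_rmul {α β γ : Type} [Fintype β] (M : Matrix α β (Op N n)) (P : Matrix β γ (Op N n))
    (G : Op N n) : rmul (M * P) G = M * rmul P G := by
  refine Matrix.ext fun i j => ?_
  simp [rmul, Matrix.mul_apply, Finset.sum_mul, mul_assoc]

lemma rmul_mul_scal {α : Type} (M : Matrix α (Fin N) (Op N n)) (c : Matrix (Fin N) (Fin N) ℂ)
    (G : Op N n) : rmul (M * scal N n c) G = rmul M G * scal N n c := by
  refine Matrix.ext fun i j => ?_
  simp only [rmul, Matrix.mul_apply, Finset.sum_mul, mul_assoc, Matrix.of_apply, scal_apply]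
  exact Finset.sum_congr rfl fun l _ => by rw [Algebra.commutes]

lemma rel_opY (h : GL (Fin N) ℂ) :
    Rel (gaugeAct h).toLinearMap (opY N n) (scal N n h.1 * opY N n * scal N n h⁻¹.1) := by
  have key : rmul (opY N n) (gaugeAct h).toLinearMap =
      scal N n h⁻¹.1 * lmul (gaugeAct h).toLinearMap (opY N n) * scal N n h.1 := by
    refine Matrix.ext fun i j => ?_
    refine LinearMap.ext fun f => ?_
    have h1 : rmul (opY N n) (gaugeAct h).toLinearMap i j f =
        pderiv (Sum.inl (j, i)) (gaugeAct h f) := rfl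
    rw [h1, opY_gaugeAct]
    simp [Matrix.mul_apply, scal_apply, lmul, opY, Finset.smul_sum,
      Algebra.algebraMap_eq_smul_one, mul_smul]
  have main : lmul (gaugeAct h).toLinearMap (opY N n) =
      rmul (scal N n h.1 * opY N n * scal N n h⁻¹.1) (gaugeAct h).toLinearMap := by
    rw [rmul_mul_scal, mul_rmul, key, ← mul_assoc, ← mul_assoc, scal_mul_inv, one_mul,
      mul_assoc, scal_mul_inv, mul_one]
  intro i j
  exact congrFun (congrFun main i) j

lemma rel_opB (h : GL (Fin N) ℂ) :
    Rel (gaugeAct h).toLinearMap (opB N n) (scal N n h.1 * opB N n) := by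
  have key : rmul (opB N n) (gaugeAct h).toLinearMap =
      scal N n h⁻¹.1 * lmul (gaugeAct h).toLinearMap (opB N n) := by
    refine Matrix.ext fun i a => ?_
    refine LinearMap.ext fun f => ?_
    have h1 : rmul (opB N n) (gaugeAct h).toLinearMap i a f =
        pderiv (Sum.inr (a, i)) (gaugeAct h f) := rfl
    rw [h1, opB_gaugeAct]
    simp [Matrix.mul_apply, scal_apply, lmul, opB, Algebra.algebraMap_eq_smul_one]
  have main : lmul (gaugeAct h).toLinearMap (opB N n) =
      rmul (scal N n h.1 * opB N n) (gaugeAct h).toLinearMap := by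
    rw [mul_rmul, key, ← Matrix.mul_assoc, scal_mul_inv, Matrix.one_mul]
  intro i j
  exact congrFun (congrFun main i) j

lemma conj_pow_aux (h : GL (Fin N) ℂ) (M : Matrix (Fin N) (Fin N) (Op N n)) (s : ℕ) :
    (scal N n h.1 * M * scal N n h⁻¹.1) ^ s = scal N n h.1 * M ^ s * scal N n h⁻¹.1 := by
  induction s with
  | zero => rw [pow_zero, pow_zero, mul_one, scal_mul_inv]
  | succ s ih =>
    rw [pow_succ, ih, pow_succ]
    calc _ = scal N n h.1 * M ^ s * (scal N n h⁻¹.1 * scal N n h.1) * M * scal N n h⁻¹.1 := by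
          simp only [mul_assoc]
      _ = _ := by rw [scal_inv_mul, mul_one]; simp only [mul_assoc]

lemma mode_comm (h : GL (Fin N) ℂ) (c : ℂ) (s : ℕ) (a b : Fin n) :
    (gaugeAct h).toLinearMap * mode N n c s a b = mode N n c s a b * (gaugeAct h).toLinearMap := by
  have hXY := (((rel_opX (n := n) h).mul (rel_opY h)).sub
    (Rel.smul_one (gaugeAct h).toLinearMap c)).pow s
  have hall := ((rel_opA (n := n) h).mul hXY).mul (rel_opB h)
  have e : scal N n h.1 * opX N n * scal N n h⁻¹.1 * (scal N n h.1 * opY N n * scal N n h⁻¹.1) -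
      c • (1 : Matrix (Fin N) (Fin N) (Op N n)) =
      scal N n h.1 * (opX N n * opY N n - c • (1 : Matrix (Fin N) (Fin N) (Op N n))) *
        scal N n h⁻¹.1 := by
    rw [mul_sub, sub_mul, mul_smul_comm, smul_mul_assoc, mul_one, scal_mul_inv]
    congr 1
    calc _ = scal N n h.1 * opX N n * (scal N n h⁻¹.1 * scal N n h.1) * opY N n *
          scal N n h⁻¹.1 := by simp only [mul_assoc]
      _ = _ := by rw [scal_inv_mul, mul_one]; simp only [mul_assoc]
  rw [e, conj_pow_aux] at hall
  have e2 : opA N n * scal N n h⁻¹.1 *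
      (scal N n h.1 * (opX N n * opY N n - c • (1 : Matrix (Fin N) (Fin N) (Op N n))) ^ s *
        scal N n h⁻¹.1) * (scal N n h.1 * opB N n) = mode N n c s := by
    have e3 : opA N n * scal N n h⁻¹.1 *
      (scal N n h.1 * (opX N n * opY N n - c • (1 : Matrix (Fin N) (Fin N) (Op N n))) ^ s *
        scal N n h⁻¹.1) * (scal N n h.1 * opB N n) =
      opA N n * ((scal N n h⁻¹.1 * scal N n h.1) *
        (opX N n * opY N n - c • (1 : Matrix (Fin N) (Fin N) (Op N n))) ^ s *
        (scal N n h⁻¹.1 * scal N n h.1)) * opB N n := by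
      simp only [Matrix.mul_assoc]
    rw [e3, scal_inv_mul, one_mul, mul_one, mode]
  rw [e2] at hall
  exact hall a b

end Invariance

/-- The operators `A^a (X Y - c)^s B_b` commute with the gauge group, so they preserve the
Hilbert space. -/
lemma mode_mem {N n k : ℕ} (c : ℂ) (s : ℕ) (a b : Fin n) :
    ∀ f ∈ hilb N n k, mode N n c s a b f ∈ hilb N n k := by
  intro f hf h
  have h1 : gaugeAct h (mode N n c s a b f) = mode N n c s a b (gaugeAct h f) :=
    LinearMap.congr_fun (mode_comm h c s a b) f
  rw [h1, hf h, map_smul]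

/-- `A^a (X Y - c)^s B_b` as an operator on the Hilbert space. -/
def hilbMode (N n k : ℕ) (c : ℂ) (s : ℕ) (a b : Fin n) : Module.End ℂ (hilb N n k) :=
  (mode N n c s a b).restrict (mode_mem c s a b)

/-- The series `δ^a_b + A^a (u + (k + n) L - X Y)⁻¹ B_b` with `L = ⌊N / n⌋`, expanded at
`u = ∞`; the power series variable stands for `u⁻¹`. -/
def shiftedT (N n k : ℕ) (a b : Fin n) : PowerSeries (Module.End ℂ (hilb N n k)) :=
  PowerSeries.C (if a = b then 1 else 0) +
    PowerSeries.X * PowerSeries.mk fun s =>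
      hilbMode N n k (((k + n) * (N / n) : ℕ) : ℂ) s a b

/-- The expansion at `u = ∞` of `∏_{j=1}^{L} (u + (n + k) j) / (u + k + (n + k) j)`; the power
series variable stands for `u⁻¹`. -/
def normFactor (n k L : ℕ) : PowerSeries ℂ :=
  ∏ j ∈ Finset.Icc 1 L,
    (1 + PowerSeries.C (((n + k) * j : ℕ) : ℂ) * PowerSeries.X) *
      (1 + PowerSeries.C ((k + (n + k) * j : ℕ) : ℂ) * PowerSeries.X)⁻¹

/-- The series `T̃^a_b(u)` of operators on the Hilbert space, in the variable `u⁻¹`. -/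
def tildeT (N n k : ℕ) (a b : Fin n) : PowerSeries (Module.End ℂ (hilb N n k)) :=
  shiftedT N n k a b *
    PowerSeries.map (algebraMap ℂ (Module.End ℂ (hilb N n k))) (normFactor n k (N / n))

/-- The Hermitian inner product `⟨w | v⟩` of the harmonic oscillator Fock space: the monomials
`x^m` are orthogonal, with `⟨x^m | x^m⟩ = m!`; it is antilinear in `w`. -/
def fockInner {N n : ℕ} (w v : Poly N n) : ℂ :=
  ∑ m ∈ v.support, starRingEnd ℂ (w.coeff m) * v.coeff m *
    ((m.prod fun _ e => e.factorial : ℕ) : ℂ)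

/-- Polynomials in `X ∈ End(ℂ^N)`, `A ∈ Hom(ℂ^N, ℂ^n)` and `η ∈ Hom(ℂ^n, ℂ^n)`;
`Sum.inr (a, l)` is `η^a_{N+l}`. -/
abbrev AuxPoly (N n : ℕ) : Type := MvPolynomial (Coord N n ⊕ (Fin n × Fin n)) ℂ

/-- The inclusion `ℂ[X, A] → ℂ[X, A, η]`. -/
def auxIncl (N n : ℕ) : Poly N n →ₐ[ℂ] AuxPoly N n := rename Sum.inl

/-- Restriction of functions along `(X, A, η) ↦ (X ⊕ 0, (A, η))`, where
`ℂ^{N+n} = ℂ^N ⊕ ℂ^n`. -/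
def auxRestrict (N n : ℕ) : Poly (N + n) n →ₐ[ℂ] AuxPoly N n :=
  aeval (Sum.elim
    (fun ij => Fin.addCases
      (fun i => Fin.addCases (fun j => X (Sum.inl (Sum.inl (i, j)))) (fun _ => 0) ij.2)
      (fun _ => 0) ij.1)
    (fun ai => Fin.addCases
      (fun i => X (Sum.inl (Sum.inr (ai.1, i)))) (fun l => X (Sum.inr (ai.1, l))) ai.2))

/-- `det X` in `ℂ[X, A, η]`. -/
def detX (N n : ℕ) : AuxPoly N n :=
  (Matrix.of fun i j : Fin N => (X (Sum.inl (Sum.inl (i, j))) : AuxPoly N n)).det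

/-- `det η` in `ℂ[X, A, η]`. -/
def detEta (N n : ℕ) : AuxPoly N n :=
  (Matrix.of fun a l : Fin n => (X (Sum.inr (a, l)) : AuxPoly N n)).det

/-- `p` is `det(X)^{-k} det(η)^{-k}` times the restriction map. -/
def IsTransitionMap (N n k : ℕ) (p : hilb (N + n) n k →ₗ[ℂ] hilb N n k) : Prop :=
  ∀ f : hilb (N + n) n k,
    auxRestrict N n f = detX N n ^ k * detEta N n ^ k * auxIncl N n (p f)

/-- `σ` is the inverse of `p` restricted to the orthogonal complement of `ker p`. -/
def IsHermitianSection {N n k : ℕ} (p : hilb (N + n) n k →ₗ[ℂ] hilb N n k)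
    (σ : hilb N n k →ₗ[ℂ] hilb (N + n) n k) : Prop :=
  p ∘ₗ σ = LinearMap.id ∧
    ∀ (v : hilb N n k) (w : hilb (N + n) n k), p w = 0 → fockInner (w : Poly (N + n) n) (σ v) = 0

end MatrixModel

end

noncomputable section

namespace MatrixModel

/-! Semi-invariance is equivalent to f(HX, A) det(H)^k = f(XH, AH), an identity without inverses.
Being polynomial, it extends from invertible complex H to arbitrary H over any commutative ℂ-algebra
(`hilb_identity`), so H may be singular, a block matrix, or X itself.

Existence of p. Taking H = 1 ⊕ η splits det(η)^k off the restriction and leaves the slice s(X, A) =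
f(X ⊕ 0, (A, 1)). A block triangular H gives f([X w; 0 0], (A, η)) det(X)^k = det[X w; A η]^k s(X,
A). The polynomial det X is irreducible and, for suitable constant w and η, does not divide the
bordered determinant, so det(X)^k divides s (`det_coordX_pow_dvd_slice`).

Surjectivity of p. By Schur–Weyl duality (`exists_perm_expansion`) semi-invariants are spanned by
contractions of copies of X, A and k Levi-Civita symbols (`exists_contraction_expansion`). Such a
contraction lifts to size N + n on replacing A by AX and ε_K by the determinant with rows e_K
followed by the rows of A. The lift of g restricts to det(η)^k g(X, AX), which is det(η)^k det(X)^k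
g(X, A).

Intertwining. The vector (XY - c')^s B_b f is restricted to the slice. Derivatives transverse to the
slice are removed by infinitesimal covariance (`rowDer_modeVec`), at the price of a shift by n;
det(X)^k shifts XY by k, and det(η)^k produces the source terms. With c' = c + k + n, the series δ +
A(u + c' - XY)⁻¹B becomes (u + c' + k)/(u + c') times the one for N and c, and the last factor of
the normalising product is the inverse of this scalar.

Section. The Fock adjoint of the (a, b) mode is the (b, a) mode, and all modes preserve ker p, hence
also its orthogonal complement. The grading by degree reduces orthogonal projection to finite
dimension. Then σT and Tσ take values in ker(p)^⊥ and have the same image under p. -/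

/-- Evaluation of a polynomial in `(X, A)` at a pair of matrices over a commutative algebra. -/
def evalAt {M n : ℕ} {R : Type} [CommRing R] [Algebra ℂ R] (X₀ : Matrix (Fin M) (Fin M) R)
    (A₀ : Matrix (Fin n) (Fin M) R) : Poly M n →ₐ[ℂ] R :=
  aeval (Sum.elim (fun ij => X₀ ij.1 ij.2) (fun ai => A₀ ai.1 ai.2))

/-! ### Gauge covariance as a polynomial identity without inverses. -/

section EvalAt

variable {M n k : ℕ} {R : Type} [CommRing R] [Algebra ℂ R] {R' : Type} [CommRing R']
  [Algebra ℂ R']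

@[simp] lemma evalAt_X (X₀ : Matrix (Fin M) (Fin M) R) (A₀ : Matrix (Fin n) (Fin M) R)
    (i j : Fin M) : evalAt X₀ A₀ (X (Sum.inl (i, j))) = X₀ i j := by simp [evalAt]

@[simp] lemma evalAt_A (X₀ : Matrix (Fin M) (Fin M) R) (A₀ : Matrix (Fin n) (Fin M) R)
    (a : Fin n) (i : Fin M) : evalAt X₀ A₀ (X (Sum.inr (a, i))) = A₀ a i := by simp [evalAt]

lemma evalAt_coord (f : Poly M n) : evalAt (coordX M n) (coordA M n) f = f := by
  have : evalAt (coordX M n) (coordA M n) = AlgHom.id ℂ (Poly M n) := by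
    ext v
    rcases v with ⟨i, j⟩ | ⟨a, i⟩ <;> simp [coordX, coordA]
  rw [this, AlgHom.id_apply]

lemma map_evalAt (φ : R →ₐ[ℂ] R') (X₀ : Matrix (Fin M) (Fin M) R)
    (A₀ : Matrix (Fin n) (Fin M) R) (f : Poly M n) :
    φ (evalAt X₀ A₀ f) = evalAt (X₀.map φ) (A₀.map φ) f := by
  have : φ.comp (evalAt X₀ A₀) = evalAt (X₀.map φ) (A₀.map φ) := by
    ext v
    rcases v with ⟨i, j⟩ | ⟨a, i⟩ <;> simp
  rw [← this, AlgHom.comp_apply]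

lemma gaugeAct_eq_evalAt (h : GL (Fin M) ℂ) (f : Poly M n) :
    gaugeAct h f = evalAt
      (h.1.map (algebraMap ℂ (Poly M n)) * coordX M n * h⁻¹.1.map (algebraMap ℂ (Poly M n)))
      (coordA M n * h⁻¹.1.map (algebraMap ℂ (Poly M n))) f := rfl

lemma coordX_map_evalAt (X₀ : Matrix (Fin M) (Fin M) R) (A₀ : Matrix (Fin n) (Fin M) R) :
    (coordX M n).map (evalAt X₀ A₀) = X₀ := by
  ext i j; simp [coordX]

lemma coordA_map_evalAt (X₀ : Matrix (Fin M) (Fin M) R) (A₀ : Matrix (Fin n) (Fin M) R) :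
    (coordA M n).map (evalAt X₀ A₀) = A₀ := by
  ext i j; simp [coordA]

lemma map_algebraMap_map {m₁ m₂ : Type*} (φ : R →ₐ[ℂ] R') (h : Matrix m₁ m₂ ℂ) :
    (h.map (algebraMap ℂ R)).map φ = h.map (algebraMap ℂ R') := by
  ext i j
  simp

lemma map_mul_algHom {m₁ m₂ m₃ : Type*} [Fintype m₂] (φ : R →ₐ[ℂ] R') (P : Matrix m₁ m₂ R)
    (Q : Matrix m₂ m₃ R) : (P * Q).map φ = P.map φ * Q.map φ := by
  ext i j; simp [Matrix.mul_apply]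

lemma evalAt_gaugeAct (h : GL (Fin M) ℂ) (X₀ : Matrix (Fin M) (Fin M) R)
    (A₀ : Matrix (Fin n) (Fin M) R) (f : Poly M n) :
    evalAt X₀ A₀ (gaugeAct h f) =
      evalAt (h.1.map (algebraMap ℂ R) * X₀ * h⁻¹.1.map (algebraMap ℂ R))
        (A₀ * h⁻¹.1.map (algebraMap ℂ R)) f := by
  rw [gaugeAct_eq_evalAt, map_evalAt]
  simp only [map_mul_algHom, coordX_map_evalAt, coordA_map_evalAt, map_algebraMap_map]

lemma det_ne_zero_of_eval {σ : Type*} {m : Type*} [Fintype m] [DecidableEq m]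
    (φ : m × m → σ) (hφ : Function.Injective φ) :
    (Matrix.of fun i j : m => (X (φ (i, j)) : MvPolynomial σ ℂ)).det ≠ 0 := by
  classical
  intro h
  have := congrArg (aeval (fun v => if ∃ i, v = φ (i, i) then (1 : ℂ) else 0)) h
  rw [AlgHom.map_det, map_zero] at this
  have e : (aeval (fun v => if ∃ i, v = φ (i, i) then (1 : ℂ) else 0)).mapMatrix
      (Matrix.of fun i j : m => (X (φ (i, j)) : MvPolynomial σ ℂ)) = 1 := by
    ext i j
    simp only [AlgHom.mapMatrix_apply, Matrix.map_apply, Matrix.of_apply, aeval_X, hφ.eq_iff,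
      Prod.mk.injEq, Matrix.one_apply]
    congr 1
    simp only [eq_iff_iff]
    constructor
    · rintro ⟨l, rfl, rfl⟩; rfl
    · rintro rfl; exact ⟨i, rfl, rfl⟩
  rw [e, Matrix.det_one] at this
  exact one_ne_zero this

/-- A family of polynomials on which the gauge group acts by `det⁻ᵏ` times a polynomial
representation satisfies the corresponding identity for all matrices over all algebras. -/
lemma covariant_identity {ι : Type*} [Fintype ι] (v : ι → Poly M n)
    (D : ι → ι → MvPolynomial (Fin M × Fin M) ℂ)
    (hv : ∀ (h : GL (Fin M) ℂ) (i : ι), gaugeAct h (v i) =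
      ((h : Matrix (Fin M) (Fin M) ℂ).det ^ k)⁻¹ •
        ∑ l, (aeval (fun p : Fin M × Fin M => h.1 p.1 p.2) (D i l) : ℂ) • v l)
    (H X₀ : Matrix (Fin M) (Fin M) R) (A₀ : Matrix (Fin n) (Fin M) R) (i : ι) :
    evalAt (H * X₀) A₀ (v i) * H.det ^ k =
      ∑ l, aeval (fun p : Fin M × Fin M => H p.1 p.2) (D i l) *
        evalAt (X₀ * H) (A₀ * H) (v l) := by
  let σ := (Fin M × Fin M) ⊕ Coord M n
  let HU : Matrix (Fin M) (Fin M) (MvPolynomial σ ℂ) := Matrix.of fun i j => X (Sum.inl (i, j))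
  let XU : Matrix (Fin M) (Fin M) (MvPolynomial σ ℂ) :=
    Matrix.of fun i j => X (Sum.inr (Sum.inl (i, j)))
  let AU : Matrix (Fin n) (Fin M) (MvPolynomial σ ℂ) :=
    Matrix.of fun i j => X (Sum.inr (Sum.inr (i, j)))
  have spec : ∀ {T : Type} [CommRing T] [Algebra ℂ T] (φ : MvPolynomial σ ℂ →ₐ[ℂ] T),
      φ (evalAt (HU * XU) AU (v i) * HU.det ^ k -
        ∑ l, aeval (fun p : Fin M × Fin M => HU p.1 p.2) (D i l) *
          evalAt (XU * HU) (AU * HU) (v l)) =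
      evalAt (HU.map φ * XU.map φ) (AU.map φ) (v i) * (HU.map φ).det ^ k -
        ∑ l, aeval (fun p : Fin M × Fin M => (HU.map φ) p.1 p.2) (D i l) *
          evalAt (XU.map φ * HU.map φ) (AU.map φ * HU.map φ) (v l) := by
    intro T _ _ φ
    have h1 : ∀ l, φ (aeval (fun p : Fin M × Fin M => HU p.1 p.2) (D i l)) =
        aeval (fun p : Fin M × Fin M => (HU.map φ) p.1 p.2) (D i l) := by
      intro l
      rw [← AlgHom.comp_apply, comp_aeval]
      rfl
    simp only [map_sub, map_mul, map_sum, map_pow, map_evalAt, map_mul_algHom, h1, AlgHom.map_det,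
      AlgHom.mapMatrix_apply]
  have key : evalAt (HU * XU) AU (v i) * HU.det ^ k -
        ∑ l, aeval (fun p : Fin M × Fin M => HU p.1 p.2) (D i l) *
          evalAt (XU * HU) (AU * HU) (v l) = 0 := by
    -- The factor det H kills the singular points, so vanishing has to be tested only where H is
    -- invertible; there `hv` is evaluated at (XH, AH), which cancels every inverse.
    have hdet : HU.det ≠ 0 := det_ne_zero_of_eval (fun p => (Sum.inl p : σ)) Sum.inl_injective
    refine (mul_eq_zero.mp (?_ : HU.det * _ = 0)).resolve_left hdet
    refine MvPolynomial.funext fun x => ?_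
    have hx := spec (aeval x : MvPolynomial σ ℂ →ₐ[ℂ] ℂ)
    simp only [← MvPolynomial.coe_aeval_eq_eval, RingHom.coe_coe, map_zero] at hx ⊢
    rw [map_mul, hx, AlgHom.map_det, AlgHom.mapMatrix_apply]
    set h := HU.map (aeval x : MvPolynomial σ ℂ →ₐ[ℂ] ℂ)
    by_cases hd : h.det = 0
    · rw [hd, zero_mul]
    refine mul_eq_zero_of_right _ (sub_eq_zero.mpr ?_)
    let g : GL (Fin M) ℂ := Matrix.GeneralLinearGroup.mkOfDetNeZero h hd
    have hg : g.1 = h := rfl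
    have hgi : h * g⁻¹.1 = 1 := by rw [← hg, ← Units.val_mul, mul_inv_cancel, Units.val_one]
    have e := congrArg (evalAt (XU.map (aeval x : MvPolynomial σ ℂ →ₐ[ℂ] ℂ) * h)
      (AU.map (aeval x : MvPolynomial σ ℂ →ₐ[ℂ] ℂ) * h)) (hv g i)
    rw [evalAt_gaugeAct] at e
    have hid : ∀ P : Matrix (Fin M) (Fin M) ℂ, P.map (algebraMap ℂ ℂ) = P := fun P => by
      ext; rfl
    rw [hid, hid, hg, ← Matrix.mul_assoc, Matrix.mul_assoc _ h, hgi, Matrix.mul_one,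
      Matrix.mul_assoc _ h, hgi, Matrix.mul_one] at e
    rw [e]
    have hd' : h.det ^ k ≠ 0 := pow_ne_zero _ hd
    simp only [map_smul, map_sum, smul_eq_mul]
    rw [mul_comm, mul_inv_cancel_left₀ hd']
  let ψ : MvPolynomial σ ℂ →ₐ[ℂ] R := aeval (Sum.elim (fun p => H p.1 p.2)
    (Sum.elim (fun ij => X₀ ij.1 ij.2) (fun ai => A₀ ai.1 ai.2)))
  have := spec ψ
  rw [key, map_zero] at this
  have e1 : HU.map ψ = H := by ext i j; simp [HU, ψ]
  have e2 : XU.map ψ = X₀ := by ext i j; simp [XU, ψ]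
  have e3 : AU.map ψ = A₀ := by ext i j; simp [AU, ψ]
  rw [e1, e2, e3] at this
  exact (sub_eq_zero.mp this.symm)

/-- The trivial-representation case of `covariant_identity`. Nearly all structural facts below are
instances with a well-chosen, often block, matrix H. -/
lemma hilb_identity {f : Poly M n} (hf : f ∈ hilb M n k) (H X₀ : Matrix (Fin M) (Fin M) R)
    (A₀ : Matrix (Fin n) (Fin M) R) :
    evalAt (H * X₀) A₀ f * H.det ^ k = evalAt (X₀ * H) (A₀ * H) f := by
  have := covariant_identity (k := k) (fun _ : Unit => f) (fun _ _ => 1)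
    (fun h _ => by simpa using hf h) H X₀ A₀ ()
  simpa using this

/-- Evaluating the identity at (Xh⁻¹, Ah⁻¹) for a constant h recovers the gauge action. The identity
is demanded only for nonzero determinant, so that a proof of it may cancel det h. -/
lemma mem_hilb_of_identity {f : Poly M n}
    (hf : ∀ h : Matrix (Fin M) (Fin M) (Poly M n), h.det ≠ 0 →
      evalAt (h * coordX M n) (coordA M n) f * h.det ^ k =
        evalAt (coordX M n * h) (coordA M n * h) f) : f ∈ hilb M n k := by
  intro h
  set P := h.1.map (algebraMap ℂ (Poly M n)) with hP
  set Q := h⁻¹.1.map (algebraMap ℂ (Poly M n)) with hQ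
  have hi : Q * P = 1 := by
    rw [hP, hQ, ← Matrix.map_mul, ← Units.val_mul, inv_mul_cancel, Units.val_one]
    exact Matrix.map_one _ (map_zero _) (map_one _)
  have hd : P.det = algebraMap ℂ (Poly M n) h.1.det := by
    rw [RingHom.map_det]; rfl
  have hne : (h : Matrix (Fin M) (Fin M) ℂ).det ^ k ≠ 0 :=
    pow_ne_zero _ ((Matrix.isUnit_iff_isUnit_det _).mp h.isUnit).ne_zero
  have hP0 : P.det ≠ 0 := by
    rw [hd]
    exact (map_ne_zero_iff _ (algebraMap ℂ (Poly M n)).injective).mpr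
      ((Matrix.isUnit_iff_isUnit_det _).mp h.isUnit).ne_zero
  have e := congrArg (evalAt (coordX M n * Q) (coordA M n * Q)) (hf P hP0)
  rw [map_mul, map_evalAt, map_evalAt, map_pow, AlgHom.map_det, AlgHom.mapMatrix_apply] at e
  simp only [map_mul_algHom, coordX_map_evalAt, coordA_map_evalAt] at e
  rw [hP, map_algebraMap_map, ← hP, Matrix.mul_assoc (coordX M n), hi, Matrix.mul_one,
    Matrix.mul_assoc (coordA M n), hi,
    Matrix.mul_one, evalAt_coord, ← Matrix.mul_assoc, ← gaugeAct_eq_evalAt] at e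
  conv_rhs => rw [← e]
  rw [hd, ← map_pow, Algebra.smul_def, mul_left_comm, ← map_mul, inv_mul_cancel₀ hne, map_one,
    mul_one]

end EvalAt

/-! ### Irreducibility of the generic determinant. -/

/-- The determinant of a matrix of distinct variables is irreducible. -/
lemma irreducible_det_X {σ : Type} (m : ℕ) (φ : Fin (m + 1) × Fin (m + 1) → σ)
    (hφ : Function.Injective φ) :
    Irreducible (Matrix.of fun i j : Fin (m + 1) => (X (φ (i, j)) : MvPolynomial σ ℂ)).det := by
  classical
  induction m with
  | zero =>
    rw [Matrix.det_fin_one]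
    exact X_prime.irreducible
  | succ m ih =>
    obtain ⟨Z, hZ⟩ : ∃ Z, Z = Matrix.of fun i j : Fin (m + 1 + 1) =>
      (X (φ (i, j)) : MvPolynomial σ ℂ) := ⟨_, rfl⟩
    rw [← hZ]
    have hZa : ∀ i j, Z i j = X (φ (i, j)) := fun i j => by rw [hZ, Matrix.of_apply]
    obtain ⟨d, hd⟩ : ∃ d, d = (Z.submatrix Fin.succ Fin.succ).det := ⟨_, rfl⟩
    obtain ⟨r, hr⟩ : ∃ r, r = ∑ j : Fin (m + 1), (-1) ^ (j.succ : ℕ) * Z 0 j.succ *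
      (Z.submatrix Fin.succ j.succ.succAbove).det := ⟨_, rfl⟩
    -- The determinant is linear in x₀₀ with leading coefficient the complementary minor d,
    -- irreducible by induction; it remains to see that d and r have no common factor.
    have hdet : Z.det = d * X (φ (0, 0)) + r := by
      rw [Matrix.det_succ_row_zero, Fin.sum_univ_succ]
      rw [hr, hd, Fin.val_zero, pow_zero, one_mul, hZa, mul_comm, Fin.succAbove_zero]
    have hdirr : Irreducible d := by
      have := ih (fun p => φ (p.1.succ, p.2.succ)) (fun p q h => by
        have := hφ h
        simp only [Prod.mk.injEq, Fin.succ_inj] at this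
        exact Prod.ext this.1 this.2)
      rw [hd, hZ]
      exact this
    have hvars : ∀ (c : Fin (m + 1) → Fin (m + 1 + 1)),
        φ (0, 0) ∉ (Z.submatrix Fin.succ c).det.vars := by
      intro c hc
      have hs : ∀ i j, (Z.submatrix Fin.succ c) i j ∈ supported ℂ {v | v ≠ φ (0, 0)} := by
        intro i j
        rw [Matrix.submatrix_apply, hZa]
        refine (X_mem_supported).mpr ?_
        simp only [Set.mem_ofPred_eq, ne_eq, hφ.eq_iff, Prod.mk.injEq, Fin.succ_ne_zero, false_and,
          not_false_eq_true]
      have : (Z.submatrix Fin.succ c).det ∈ supported ℂ {v | v ≠ φ (0, 0)} := by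
        rw [Matrix.det_apply]
        refine Subalgebra.sum_mem _ fun τ _ => ?_
        exact Subalgebra.zsmul_mem _ (Subalgebra.prod_mem _ fun i _ => hs _ _) _
      exact (mem_supported.mp this hc) rfl
    rw [hdet]
    refine irreducible_mul_X_add d r _ hdirr.ne_zero (hd ▸ hvars _) ?_ ?_
    · intro hc
      have : r ∈ supported ℂ {v | v ≠ φ (0, 0)} := by
        rw [hr]
        refine Subalgebra.sum_mem _ fun j _ => Subalgebra.mul_mem _ (Subalgebra.mul_mem _ ?_ ?_) ?_
        · exact Subalgebra.pow_mem _ (Subalgebra.neg_mem _ (Subalgebra.one_mem _)) _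
        · rw [hZa]
          refine (X_mem_supported).mpr ?_
          simp only [Set.mem_ofPred_eq, ne_eq, hφ.eq_iff, Prod.mk.injEq, Fin.succ_ne_zero, and_false,
            not_false_eq_true]
        · exact mem_supported.mpr fun v hv h => hvars _ (h ▸ hv)
      exact (mem_supported.mp this hc) rfl
    · refine (hdirr.isRelPrime_iff_not_dvd).mpr ?_
      rintro ⟨q, hq⟩
      -- At the permutation matrix of the transposition (0 1) the minor d vanishes while the
      -- determinant is -1, so d cannot divide r.
      let τ : Equiv.Perm (Fin (m + 1 + 1)) := Equiv.swap 0 1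
      let x : σ → ℂ := fun v => if ∃ i, v = φ (i, τ i) then 1 else 0
      have hx : ∀ i j, x (φ (i, j)) = if τ i = j then 1 else 0 := by
        intro i j
        simp only [x, hφ.eq_iff, Prod.mk.injEq]
        congr 1
        simp only [eq_iff_iff]
        constructor
        · rintro ⟨l, rfl, rfl⟩; rfl
        · rintro rfl; exact ⟨i, rfl, rfl⟩
      have e1 : aeval x Z.det = (Equiv.Perm.sign τ : ℂ) := by
        rw [AlgHom.map_det, ← Matrix.det_permutation]
        congr 1
        ext i j
        simp only [AlgHom.mapMatrix_apply, Matrix.map_apply, hZa, aeval_X, hx,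
          Equiv.Perm.permMatrix, PEquiv.toMatrix_apply, Equiv.toPEquiv_apply, Option.mem_def,
          Option.some.injEq]
      have e2 : aeval x d = 0 := by
        rw [hd, AlgHom.map_det]
        refine Matrix.det_eq_zero_of_row_eq_zero 0 fun j => ?_
        simp only [AlgHom.mapMatrix_apply, Matrix.map_apply, Matrix.submatrix_apply,
          hZa, aeval_X, hx]
        rw [if_neg]
        simp [τ, Fin.succ_ne_zero, eq_comm]
      have e3 := congrArg (aeval x) hdet
      rw [e1, map_add, map_mul, e2, hq, map_mul, e2] at e3
      simp [τ] at e3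

/-! ### Block data on ℂ^N ⊕ ℂ^n. -/

section Blocks

variable {N n : ℕ}

/-- A block matrix on `ℂ^{N+n} = ℂ^N ⊕ ℂ^n`. -/
def blk {R : Type} (P : Matrix (Fin N) (Fin N) R) (Q : Matrix (Fin N) (Fin n) R)
    (S : Matrix (Fin n) (Fin N) R) (T : Matrix (Fin n) (Fin n) R) :
    Matrix (Fin (N + n)) (Fin (N + n)) R :=
  (Matrix.fromBlocks P Q S T).submatrix finSumFinEquiv.symm finSumFinEquiv.symm

/-- The framing `(A, η)` on `ℂ^{N+n} = ℂ^N ⊕ ℂ^n`. -/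
def cols {R : Type} (A : Matrix (Fin n) (Fin N) R) (η : Matrix (Fin n) (Fin n) R) :
    Matrix (Fin n) (Fin (N + n)) R :=
  (Matrix.fromCols A η).submatrix id finSumFinEquiv.symm

lemma blk_map {R R' : Type} (φ : R → R') (P : Matrix (Fin N) (Fin N) R) (Q : Matrix (Fin N) (Fin n) R)
    (S : Matrix (Fin n) (Fin N) R) (T : Matrix (Fin n) (Fin n) R) :
    (blk P Q S T).map φ = blk (P.map φ) (Q.map φ) (S.map φ) (T.map φ) := by
  rw [blk, blk, ← Matrix.fromBlocks_map, Matrix.submatrix_map]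

lemma cols_map {R R' : Type} (φ : R → R') (A : Matrix (Fin n) (Fin N) R) (η : Matrix (Fin n) (Fin n) R) :
    (cols A η).map φ = cols (A.map φ) (η.map φ) := by
  rw [cols, cols, ← Matrix.submatrix_map]
  congr 1
  ext i (j | j) <;> simp

variable {R : Type} [CommRing R]

lemma blk_mul (P P' : Matrix (Fin N) (Fin N) R) (Q Q' : Matrix (Fin N) (Fin n) R)
    (S S' : Matrix (Fin n) (Fin N) R) (T T' : Matrix (Fin n) (Fin n) R) :
    blk P Q S T * blk P' Q' S' T' =
      blk (P * P' + Q * S') (P * Q' + Q * T') (S * P' + T * S') (S * Q' + T * T') := by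
  rw [blk, blk, Matrix.submatrix_mul_equiv, Matrix.fromBlocks_multiply, blk]

lemma cols_mul (P : Matrix (Fin N) (Fin N) R) (Q : Matrix (Fin N) (Fin n) R)
    (S : Matrix (Fin n) (Fin N) R) (T : Matrix (Fin n) (Fin n) R)
    (A : Matrix (Fin n) (Fin N) R) (η : Matrix (Fin n) (Fin n) R) :
    cols A η * blk P Q S T = cols (A * P + η * S) (A * Q + η * T) := by
  rw [blk, cols, Matrix.submatrix_mul_equiv, Matrix.fromCols_mul_fromBlocks, cols]

lemma det_blk (P : Matrix (Fin N) (Fin N) R) (Q : Matrix (Fin N) (Fin n) R)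
    (S : Matrix (Fin n) (Fin N) R) (T : Matrix (Fin n) (Fin n) R) :
    (blk P Q S T).det = (Matrix.fromBlocks P Q S T).det := by
  rw [blk, Matrix.det_submatrix_equiv_self]

end Blocks

/-- The coordinate matrix `X` in `ℂ[X, A, η]`. -/
def auxX (N n : ℕ) : Matrix (Fin N) (Fin N) (AuxPoly N n) :=
  Matrix.of fun i j => X (Sum.inl (Sum.inl (i, j)))

/-- The coordinate matrix `A` in `ℂ[X, A, η]`. -/
def auxA (N n : ℕ) : Matrix (Fin n) (Fin N) (AuxPoly N n) :=
  Matrix.of fun a i => X (Sum.inl (Sum.inr (a, i)))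

/-- The coordinate matrix `η` in `ℂ[X, A, η]`. -/
def auxEta (N n : ℕ) : Matrix (Fin n) (Fin n) (AuxPoly N n) :=
  Matrix.of fun a l => X (Sum.inr (a, l))

/-! ### The slice and the existence of the transition map. -/

section Transition

variable {N n k : ℕ}

lemma detX_eq : detX N n = (auxX N n).det := rfl

lemma detEta_eq : detEta N n = (auxEta N n).det := rfl

lemma coordX_map_auxIncl : (coordX N n).map (auxIncl N n) = auxX N n := by
  ext i j
  simp [coordX, auxX, auxIncl]

lemma coordA_map_auxIncl : (coordA N n).map (auxIncl N n) = auxA N n := by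
  ext i j
  simp [coordA, auxA, auxIncl]

lemma auxIncl_eq_evalAt (f : Poly N n) : auxIncl N n f = evalAt (auxX N n) (auxA N n) f := by
  rw [← coordX_map_auxIncl, ← coordA_map_auxIncl, ← map_evalAt, evalAt_coord]

lemma auxIncl_injective : Function.Injective (auxIncl N n) :=
  rename_injective _ Sum.inl_injective

lemma detX_eq_auxIncl : detX N n = auxIncl N n (coordX N n).det := by
  rw [AlgHom.map_det, AlgHom.mapMatrix_apply, coordX_map_auxIncl, detX_eq]

lemma auxRestrict_eq_evalAt (f : Poly (N + n) n) :
    auxRestrict N n f = evalAt (blk (auxX N n) 0 0 0) (cols (auxA N n) (auxEta N n)) f := by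
  rw [auxRestrict, evalAt]
  congr 2
  ext v : 1
  rcases v with ⟨i, j⟩ | ⟨a, i⟩
  · refine Fin.addCases (fun i => ?_) (fun i => ?_) i <;>
    refine Fin.addCases (fun j => ?_) (fun j => ?_) j <;>
    simp [blk, auxX]
  · refine Fin.addCases (fun i => ?_) (fun i => ?_) i <;> simp [cols, auxA, auxEta]

lemma det_coordX_ne_zero : (coordX N n).det ≠ 0 :=
  det_ne_zero_of_eval (fun p => (Sum.inl p : Coord N n)) Sum.inl_injective

lemma detX_ne_zero : detX N n ≠ 0 :=
  det_ne_zero_of_eval (fun p => (Sum.inl (Sum.inl p) : Coord N n ⊕ (Fin n × Fin n)))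
    (Sum.inl_injective.comp Sum.inl_injective)

lemma detEta_ne_zero : detEta N n ≠ 0 :=
  det_ne_zero_of_eval (fun p => (Sum.inr p : Coord N n ⊕ (Fin n × Fin n))) Sum.inr_injective

/-- The slice `f(X ⊕ 0, (A, 1))`. -/
def slice (f : Poly (N + n) n) : Poly N n :=
  evalAt (blk (coordX N n) 0 0 0) (cols (coordA N n) 1) f

/-- The gauge matrix 1 ⊕ η fixes X ⊕ 0 under multiplication on either side and carries the framing
(A, 1) to (A, η). -/
lemma auxRestrict_eq_slice {f : Poly (N + n) n} (hf : f ∈ hilb (N + n) n k) :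
    auxRestrict N n f = detEta N n ^ k * auxIncl N n (slice f) := by
  have h := hilb_identity hf (blk 1 0 0 (auxEta N n)) (blk (auxX N n) 0 0 0) (cols (auxA N n) 1)
  simp only [blk_mul, cols_mul, det_blk, Matrix.det_fromBlocks_zero₂₁, Matrix.det_one, one_mul,
    mul_zero, Matrix.mul_zero, Matrix.zero_mul, Matrix.mul_one, add_zero, zero_add] at h
  rw [auxRestrict_eq_evalAt, ← h, slice, map_evalAt, blk_map, cols_map, coordX_map_auxIncl,
    coordA_map_auxIncl, mul_comm, detEta_eq]
  simp [Matrix.map_zero]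

/-- The subgroup of matrices H ⊕ 1 preserves the slice. -/
lemma slice_semiinvariant {f : Poly (N + n) n} (hf : f ∈ hilb (N + n) n k) {R : Type} [CommRing R]
    [Algebra ℂ R] (H X₀ : Matrix (Fin N) (Fin N) R) (A₀ : Matrix (Fin n) (Fin N) R) :
    evalAt (H * X₀) A₀ (slice f) * H.det ^ k = evalAt (X₀ * H) (A₀ * H) (slice f) := by
  have h := hilb_identity hf (blk H 0 0 1) (blk X₀ 0 0 0) (cols A₀ 1)
  simp only [blk_mul, cols_mul, det_blk, Matrix.det_fromBlocks_zero₂₁, Matrix.det_one, mul_one,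
    mul_zero, Matrix.mul_zero, Matrix.zero_mul, Matrix.mul_one, add_zero, zero_add] at h
  simpa only [slice, map_evalAt, blk_map, cols_map, coordX_map_evalAt, coordA_map_evalAt,
    Matrix.map_zero _ (map_zero _), Matrix.map_one _ (map_zero _) (map_one _)] using h

end Transition

section Transition

variable {N n k : ℕ}

/-- With α = AX⁻¹ and the Schur complement β = η - AX⁻¹w, the matrix [X w; 0 1] carries the framing
(α, β) to (A, η), 1 ⊕ β carries (α, 1) to (α, β), and X carries α to A. Composing the three
covariances gives det(β)^k, and det X · det β is the bordered determinant. -/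
lemma evalAt_blk_eq_slice {f : Poly (N + n) n} (hf : f ∈ hilb (N + n) n k) {K : Type} [Field K]
    [Algebra ℂ K] (X₀ : Matrix (Fin N) (Fin N) K) (A₀ : Matrix (Fin n) (Fin N) K)
    (w : Matrix (Fin N) (Fin n) K) (η : Matrix (Fin n) (Fin n) K) (hX : X₀.det ≠ 0) :
    evalAt (blk X₀ w 0 0) (cols A₀ η) f * X₀.det ^ k =
      (Matrix.fromBlocks X₀ w A₀ η).det ^ k * evalAt X₀ A₀ (slice f) := by
  let _ := X₀.invertibleOfIsUnitDet (isUnit_iff_ne_zero.mpr hX)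
  set α := A₀ * ⅟X₀ with hα
  set β := η - A₀ * ⅟X₀ * w with hβ
  have hαX : α * X₀ = A₀ := by rw [hα, Matrix.mul_assoc, invOf_mul_self, Matrix.mul_one]
  have h1 := hilb_identity hf (blk X₀ w 0 1) (blk 1 0 0 0) (cols α β)
  have h2 := hilb_identity hf (blk 1 0 0 β) (blk X₀ 0 0 0) (cols α 1)
  have h3 := slice_semiinvariant hf X₀ 1 α
  simp only [blk_mul, cols_mul, det_blk, Matrix.det_fromBlocks_zero₂₁, Matrix.det_one, one_mul,
    mul_one, mul_zero, Matrix.mul_zero, Matrix.zero_mul, Matrix.mul_one, Matrix.one_mul, add_zero,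
    zero_add, hαX] at h1 h2 h3
  have h4 : evalAt (blk X₀ 0 0 0) (cols α 1) f = evalAt X₀ α (slice f) := by
    simp only [slice, map_evalAt, blk_map, cols_map, coordX_map_evalAt, coordA_map_evalAt,
      Matrix.map_zero _ (map_zero _), Matrix.map_one _ (map_zero _) (map_one _)]
  have h5 : α * w + β = η := by rw [hβ, add_sub_cancel]
  rw [h5] at h1
  rw [Matrix.det_fromBlocks₁₁, ← h1, ← h2, h4, ← h3, hβ]
  ring

lemma evalAt_blk_eq_slice_generic {f : Poly (N + n) n} (hf : f ∈ hilb (N + n) n k)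
    (w : Matrix (Fin N) (Fin n) (Poly N n)) (η : Matrix (Fin n) (Fin n) (Poly N n)) :
    evalAt (blk (coordX N n) w 0 0) (cols (coordA N n) η) f * (coordX N n).det ^ k =
      (Matrix.fromBlocks (coordX N n) w (coordA N n) η).det ^ k * slice f := by
  let K := FractionRing (Poly N n)
  let φ : Poly N n →ₐ[ℂ] K := IsScalarTower.toAlgHom ℂ (Poly N n) K
  have hφ : Function.Injective φ := IsFractionRing.injective (Poly N n) K
  apply hφ
  have hX : ((coordX N n).map φ).det ≠ 0 := by
    rw [← AlgHom.mapMatrix_apply, ← AlgHom.map_det]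
    exact (map_ne_zero_iff _ hφ).mpr det_coordX_ne_zero
  have h := evalAt_blk_eq_slice hf ((coordX N n).map φ) ((coordA N n).map φ) (w.map φ) (η.map φ) hX
  rw [← map_evalAt, evalAt_coord] at h
  rw [map_mul, map_mul, map_pow, map_pow, AlgHom.map_det, AlgHom.map_det, AlgHom.mapMatrix_apply,
    AlgHom.mapMatrix_apply, Matrix.fromBlocks_map, map_evalAt, blk_map, cols_map,
    Matrix.map_zero _ (map_zero _), Matrix.map_zero _ (map_zero _), h]

/-- In `evalAt_blk_eq_slice_generic` the prime det X divides the product to order k, so it suffices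
to choose w and η for which it does not divide the bordered determinant. For N = 0 there is nothing
to prove; n > 0 supplies the extra basis vector used in the choice. -/
lemma det_coordX_pow_dvd_slice (hn : 0 < n) {f : Poly (N + n) n} (hf : f ∈ hilb (N + n) n k) :
    (coordX N n).det ^ k ∣ slice f := by
  obtain _ | N := N
  · simp [Matrix.det_isEmpty]
  obtain _ | n := n
  · exact absurd hn (lt_irrefl _)
  have hirr : Irreducible (coordX (N + 1) (n + 1)).det :=
    irreducible_det_X N (fun p => (Sum.inl p : Coord (N + 1) (n + 1))) Sum.inl_injective
  -- The blocks of the permutation matrix exchanging one vector of ℂ^N with one of ℂ^n: at this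
  -- point the upper left block is singular but the whole matrix is invertible.
  let τ : Equiv.Perm (Fin (N + 1) ⊕ Fin (n + 1)) := Equiv.swap (Sum.inl 0) (Sum.inr 0)
  let P : Matrix (Fin (N + 1) ⊕ Fin (n + 1)) (Fin (N + 1) ⊕ Fin (n + 1)) ℂ := τ.permMatrix ℂ
  have h := evalAt_blk_eq_slice_generic hf (P.toBlocks₁₂.map (algebraMap ℂ _))
    (P.toBlocks₂₂.map (algebraMap ℂ _))
  refine hirr.prime.pow_dvd_of_dvd_mul_left (a := (Matrix.fromBlocks (coordX (N + 1) (n + 1))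
    (P.toBlocks₁₂.map (algebraMap ℂ _)) (coordA (N + 1) (n + 1))
    (P.toBlocks₂₂.map (algebraMap ℂ _))).det ^ k) k ?_ ⟨_, by rw [← h, mul_comm]⟩
  intro hdvd
  obtain ⟨q, hq⟩ := hirr.prime.dvd_of_dvd_pow hdvd
  have e := congrArg (evalAt P.toBlocks₁₁ P.toBlocks₂₁) hq
  rw [map_mul, AlgHom.map_det, AlgHom.map_det, AlgHom.mapMatrix_apply, AlgHom.mapMatrix_apply,
    Matrix.fromBlocks_map, coordX_map_evalAt, coordA_map_evalAt, map_algebraMap_map,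
    map_algebraMap_map] at e
  have hid : ∀ {m₁ m₂ : Type} (P : Matrix m₁ m₂ ℂ), P.map (algebraMap ℂ ℂ) = P := fun P => by
    ext; rfl
  rw [hid, hid, Matrix.fromBlocks_toBlocks, Matrix.det_permutation] at e
  have e0 : P.toBlocks₁₁.det = 0 := by
    refine Matrix.det_eq_zero_of_row_eq_zero 0 fun j => ?_
    simp [P, τ, Matrix.toBlocks₁₁, Equiv.Perm.permMatrix, PEquiv.toMatrix_apply,
      Equiv.toPEquiv_apply]
  rw [e0, zero_mul] at e
  simp [τ] at e

/-- The quotient of the slice by det(X)^k inherits semi-invariance because det(hX) = det(Xh) can be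
cancelled. -/
lemma exists_transition (hn : 0 < n) {f : Poly (N + n) n} (hf : f ∈ hilb (N + n) n k) :
    ∃ g ∈ hilb N n k, auxRestrict N n f = detX N n ^ k * detEta N n ^ k * auxIncl N n g := by
  obtain ⟨g, hg⟩ := det_coordX_pow_dvd_slice hn hf
  refine ⟨g, mem_hilb_of_identity fun h hdet => ?_, ?_⟩
  · have e := slice_semiinvariant hf h (coordX N n) (coordA N n)
    rw [hg, map_mul, map_mul, map_pow, map_pow, AlgHom.map_det, AlgHom.map_det,
      AlgHom.mapMatrix_apply, AlgHom.mapMatrix_apply, coordX_map_evalAt, coordX_map_evalAt,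
      Matrix.det_mul, Matrix.det_mul, mul_comm (coordX N n).det, mul_assoc] at e
    exact mul_left_cancel₀ (pow_ne_zero _ (mul_ne_zero hdet det_coordX_ne_zero)) e
  · rw [auxRestrict_eq_slice hf, hg, map_mul, map_pow, ← detX_eq_auxIncl]
    ring

/-- Multiplication by `det(X)^k det(η)^k`, from `ℂ[X, A]` to `ℂ[X, A, η]`. -/
def detMul (N n k : ℕ) : Poly N n →ₗ[ℂ] AuxPoly N n :=
  LinearMap.mulLeft ℂ (detX N n ^ k * detEta N n ^ k) ∘ₗ (auxIncl N n).toLinearMap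

lemma detMul_injective : Function.Injective (detMul N n k) := by
  intro x y h
  exact auxIncl_injective (mul_left_cancel₀ (mul_ne_zero (pow_ne_zero _ detX_ne_zero)
    (pow_ne_zero _ detEta_ne_zero)) h)

lemma existsUnique_transition (hn : 0 < n) :
    ∃! p : hilb (N + n) n k →ₗ[ℂ] hilb N n k, IsTransitionMap N n k p := by
  let ℓ : hilb N n k →ₗ[ℂ] AuxPoly N n := detMul N n k ∘ₗ (hilb N n k).subtype
  have hℓ : Function.Injective ℓ := detMul_injective.comp Subtype.val_injective
  let r : hilb (N + n) n k →ₗ[ℂ] AuxPoly N n :=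
    (auxRestrict N n).toLinearMap ∘ₗ (hilb (N + n) n k).subtype
  have hr : ∀ f, r f ∈ LinearMap.range ℓ := by
    intro f
    obtain ⟨g, hg, e⟩ := exists_transition hn f.2
    exact ⟨⟨g, hg⟩, e.symm⟩
  refine ⟨(LinearEquiv.ofInjective ℓ hℓ).symm.toLinearMap ∘ₗ r.codRestrict _ hr, ?_, ?_⟩
  · intro f
    have : ℓ ((LinearEquiv.ofInjective ℓ hℓ).symm (r.codRestrict _ hr f)) = r f :=
      congrArg Subtype.val ((LinearEquiv.ofInjective ℓ hℓ).apply_symm_apply (r.codRestrict _ hr f))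
    exact this.symm
  · intro p hp
    refine LinearMap.ext fun f => hℓ ?_
    have : ℓ ((LinearEquiv.ofInjective ℓ hℓ).symm (r.codRestrict _ hr f)) = r f :=
      congrArg Subtype.val ((LinearEquiv.ofInjective ℓ hℓ).apply_symm_apply (r.codRestrict _ hr f))
    exact (hp f).symm.trans this.symm

lemma IsTransitionMap.detMul_apply {p : hilb (N + n) n k →ₗ[ℂ] hilb N n k}
    (hp : IsTransitionMap N n k p) (f : hilb (N + n) n k) :
    detMul N n k (p f) = auxRestrict N n f := (hp f).symm

lemma IsTransitionMap.apply_eq_zero_iff {p : hilb (N + n) n k →ₗ[ℂ] hilb N n k}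
    (hp : IsTransitionMap N n k p) (f : hilb (N + n) n k) :
    p f = 0 ↔ auxRestrict N n f = 0 := by
  rw [← hp.detMul_apply, map_eq_zero_iff _ detMul_injective, Submodule.coe_eq_zero]

end Transition

/-! ### The commutant of GL_N on tensor powers. -/

section Multilinear

variable {R : Type*} [CommSemiring R]

lemma prod_sum_eq_sum_pi {T m : Type*} [Fintype T] [DecidableEq T] [Fintype m]
    (F : T → m → R) : ∏ t, ∑ q, F t q = ∑ q : T → m, ∏ t, F t (q t) := by
  rw [Finset.prod_univ_sum, Fintype.piFinset_univ]

end Multilinear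

/-- Two families with the same multiplicities differ by a permutation. -/
lemma exists_perm_of_card_fiber_eq {T σ : Type*} [Fintype T] [DecidableEq σ] (u u' : T → σ)
    (h : ∀ v, (∑ t, if u t = v then 1 else 0) = ∑ t, if u' t = v then 1 else 0) :
    ∃ π : Equiv.Perm T, u' = u ∘ π := by
  have e : ∀ v, Nonempty ({t // u' t = v} ≃ {t // u t = v}) := by
    intro v
    have := h v
    simp only [Finset.sum_boole, Nat.cast_id] at this
    refine Fintype.card_eq.mp ?_
    rw [Fintype.card_subtype, Fintype.card_subtype, this]
  replace e := fun v => (e v).some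
  refine ⟨(Equiv.sigmaFiberEquiv u').symm.trans
    ((Equiv.sigmaCongrRight fun v => e v).trans (Equiv.sigmaFiberEquiv u)), ?_⟩
  ext t
  exact ((e (u' t)) ⟨t, rfl⟩).2.symm

/-- Any multiplicities with the right total are those of some family. -/
lemma exists_card_fiber_eq {T σ : Type*} [Fintype T] [Fintype σ] [DecidableEq σ] (m : σ → ℕ)
    (h : ∑ v, m v = Fintype.card T) :
    ∃ u : T → σ, ∀ v, (∑ t, if u t = v then 1 else 0) = m v := by
  have : Fintype.card (Σ v, Fin (m v)) = Fintype.card T := by simp [h]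
  obtain ⟨e⟩ := Fintype.card_eq.mp this
  refine ⟨fun t => (e.symm t).1, fun v => ?_⟩
  rw [← Equiv.sum_comp e]
  simp only [Equiv.symm_apply_apply, Fintype.sum_sigma]
  rw [Finset.sum_eq_single v] <;> simp +contextual

section Commutant

variable {S : Type} [Fintype S] {N : ℕ}

/-- A polynomial functional that vanishes on all `h ⊗ ⋯ ⊗ h` vanishes on all symmetric kernels. -/
lemma sum_mul_eq_zero_of_forall_GL (φ K : (S → Fin N) → (S → Fin N) → ℂ)
    [DecidableEq S]
    (hφ : ∀ h : GL (Fin N) ℂ, ∑ J, ∑ J', φ J J' * ∏ t, h.1 (J t) (J' t) = 0)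
    (hK : ∀ (π : Equiv.Perm S) J J', K (J ∘ π) (J' ∘ π) = K J J') :
    ∑ J, ∑ J', φ J J' * K J J' = 0 := by
  classical
  let μ : (S → Fin N) × (S → Fin N) → (Fin N × Fin N →₀ ℕ) := fun u =>
    ∑ t, Finsupp.single (u.1 t, u.2 t) 1
  let p : MvPolynomial (Fin N × Fin N) ℂ := ∑ J, ∑ J', φ J J' • monomial (μ (J, J')) 1
  have hmono : ∀ J J' (x : Fin N × Fin N → ℂ),
      eval x (monomial (μ (J, J')) 1) = ∏ t, x (J t, J' t) := by
    intro J J' x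
    rw [monomial_sum_one, map_prod]
    refine Finset.prod_congr rfl fun t _ => ?_
    exact eval_X _
  have hp : p = 0 := by
    have hdet := det_ne_zero_of_eval (σ := Fin N × Fin N) (m := Fin N) id Function.injective_id
    refine (mul_eq_zero.mp (?_ : _ * p = 0)).resolve_left hdet
    refine MvPolynomial.funext fun x => ?_
    rw [map_mul, map_zero, RingHom.map_det]
    set h := (eval x).mapMatrix (Matrix.of fun i j : Fin N => (X (id (i, j)) : MvPolynomial _ ℂ))
      with hh
    by_cases hd : h.det = 0
    · rw [hd, zero_mul]
    refine mul_eq_zero_of_right _ ?_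
    rw [← hφ (Matrix.GeneralLinearGroup.mkOfDetNeZero h hd)]
    simp only [p, map_sum, smul_eval, hmono]
    refine Finset.sum_congr rfl fun J _ => Finset.sum_congr rfl fun J' _ => ?_
    congr 1
    refine Finset.prod_congr rfl fun t _ => ?_
    change x (J t, J' t) = h (J t) (J' t)
    simp [hh]
  -- A symmetric kernel depends only on the exponent vector of its index pair, so it descends to a
  -- function on monomials and hence to a linear functional on polynomials. Exponents not of the
  -- form μ u receive the irrelevant value 0.
  let κ : (Fin N × Fin N →₀ ℕ) → ℂ := fun m =>
    if hm : ∃ u, μ u = m then K hm.choose.1 hm.choose.2 else 0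
  have hκ : ∀ J J', κ (μ (J, J')) = K J J' := by
    intro J J'
    have hm : ∃ u, μ u = μ (J, J') := ⟨_, rfl⟩
    simp only [κ, dif_pos hm]
    have hs := hm.choose_spec
    obtain ⟨π, hπ⟩ := exists_perm_of_card_fiber_eq
      (fun t => (hm.choose.1 t, hm.choose.2 t)) (fun t => (J t, J' t)) (fun v => by
        have := DFunLike.congr_fun hs v
        simpa [μ, Finsupp.finsetSum_apply, Finsupp.single_apply] using this)
    have h1 : J = hm.choose.1 ∘ π := funext fun t => congrArg Prod.fst (congrFun hπ t)
    have h2 : J' = hm.choose.2 ∘ π := funext fun t => congrArg Prod.snd (congrFun hπ t)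
    exact (hK π _ _).symm.trans (congrArg₂ K h1.symm h2.symm)
  let ℓ : MvPolynomial (Fin N × Fin N) ℂ →ₗ[ℂ] ℂ := (basisMonomials (Fin N × Fin N) ℂ).constr ℂ κ
  have hℓ : ∀ m, ℓ (monomial m 1) = κ m := by
    intro m
    have := (basisMonomials (Fin N × Fin N) ℂ).constr_basis ℂ κ m
    rwa [coe_basisMonomials] at this
  have := congrArg ℓ hp
  simpa only [p, map_sum, map_smul, hℓ, hκ, map_zero, smul_eq_mul] using this

/-- A matrix entry of the commutator with G is a linear functional of the kernel that vanishes on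
every h ⊗ ⋯ ⊗ h; apply `sum_mul_eq_zero_of_forall_GL`. -/
lemma commute_of_commute_GL [DecidableEq S] (G K : (S → Fin N) → (S → Fin N) → ℂ)
    (hG : ∀ (h : GL (Fin N) ℂ) J I, ∑ L, (∏ t, h.1 (J t) (L t)) * G L I =
      ∑ L, G J L * ∏ t, h.1 (L t) (I t))
    (hK : ∀ (π : Equiv.Perm S) J J', K (J ∘ π) (J' ∘ π) = K J J') (J I : S → Fin N) :
    ∑ L, K J L * G L I = ∑ L, G J L * K L I := by
  classical
  have h := sum_mul_eq_zero_of_forall_GL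
    (fun L L' => (if L = J then G L' I else 0) - (if L' = I then G J L else 0)) K ?_ hK
  · simp only [sub_mul, Finset.sum_sub_distrib, ite_mul, zero_mul, Finset.sum_ite_irrel,
      Finset.sum_const_zero, Finset.sum_ite_eq', Finset.mem_univ, if_true] at h
    rw [sub_eq_zero] at h
    rw [← h]
    exact Finset.sum_congr rfl fun L _ => mul_comm _ _
  · intro g
    simp only [sub_mul, Finset.sum_sub_distrib, ite_mul, zero_mul, Finset.sum_ite_irrel,
      Finset.sum_const_zero, Finset.sum_ite_eq', Finset.mem_univ, if_true]
    rw [← hG g J I, sub_eq_zero]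
    exact Finset.sum_congr rfl fun L _ => mul_comm _ _

/-- The commutant of `GL_N` in `End((ℂ^N)^{⊗ S})` is spanned by permutations of the factors. -/
lemma exists_perm_expansion [DecidableEq S] (G : (S → Fin N) → (S → Fin N) → ℂ)
    (hG : ∀ (h : GL (Fin N) ℂ) J I, ∑ L, (∏ t, h.1 (J t) (L t)) * G L I =
      ∑ L, G J L * ∏ t, h.1 (L t) (I t)) :
    ∃ c : Equiv.Perm S → ℂ, ∀ J I, G J I = ∑ σ, c σ * if I = J ∘ σ then 1 else 0 := by
  classical
  let P : Equiv.Perm S → ((S → Fin N) → (S → Fin N) → ℂ) := fun σ J I => if I = J ∘ σ then 1 else 0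
  let W : Submodule ℂ ((S → Fin N) → (S → Fin N) → ℂ) := Submodule.span ℂ (Set.range P)
  let Λ : Equiv.Perm S → ((S → Fin N) → (S → Fin N) → ℂ) →ₗ[ℂ] ((S → Fin N) → (S → Fin N) → ℂ) := fun τ => LinearMap.funLeft ℂ _ (fun J => J ∘ τ)
  have hΛ : ∀ τ T J, Λ τ T J = T (J ∘ τ) := fun τ T J => rfl
  have hΛmul : ∀ τ τ' T, Λ τ (Λ τ' T) = Λ (τ * τ') T := fun τ τ' T => rfl
  have hΛone : ∀ T, Λ 1 T = T := fun T => rfl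
  have hΛW : ∀ τ, ∀ T ∈ W, Λ τ T ∈ W := by
    intro τ T hT
    induction hT using Submodule.span_induction with
    | mem x hx =>
      obtain ⟨σ, rfl⟩ := hx
      exact Submodule.subset_span ⟨τ * σ, rfl⟩
    | zero => rw [map_zero]; exact W.zero_mem
    | add x y _ _ hx hy => rw [map_add]; exact W.add_mem hx hy
    | smul c x _ hx => rw [map_smul]; exact W.smul_mem c hx
  obtain ⟨π₀, hπ₀⟩ := W.subtype.exists_leftInverse_of_injective W.ker_subtype
  have hπ₀' : ∀ T ∈ W, (π₀ T : ((S → Fin N) → (S → Fin N) → ℂ)) = T := fun T hT =>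
    congrArg Subtype.val (LinearMap.congr_fun hπ₀ ⟨T, hT⟩)
  -- Maschke averaging: an arbitrary linear projection onto the span W of the permutation operators
  -- is made equivariant for left multiplication by permutations.
  let π : ((S → Fin N) → (S → Fin N) → ℂ) →ₗ[ℂ] ((S → Fin N) → (S → Fin N) → ℂ) := (Fintype.card (Equiv.Perm S) : ℂ)⁻¹ •
    ∑ τ, Λ τ ∘ₗ W.subtype ∘ₗ π₀ ∘ₗ Λ τ⁻¹
  have hπ : ∀ T, π T = (Fintype.card (Equiv.Perm S) : ℂ)⁻¹ • ∑ τ, Λ τ (π₀ (Λ τ⁻¹ T)) := by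
    intro T
    simp [π]
  have hcard : (Fintype.card (Equiv.Perm S) : ℂ) ≠ 0 := Nat.cast_ne_zero.mpr Fintype.card_ne_zero
  have hπW : ∀ T, π T ∈ W := by
    intro T
    rw [hπ]
    exact W.smul_mem _ (W.sum_mem fun τ _ => hΛW _ _ (π₀ _).2)
  have hπid : ∀ T ∈ W, π T = T := by
    intro T hT
    rw [hπ]
    have : ∀ τ, Λ τ (π₀ (Λ τ⁻¹ T)) = T := by
      intro τ
      rw [hπ₀' _ (hΛW _ _ hT), hΛmul, mul_inv_cancel, hΛone]
    simp only [this, Finset.sum_const, Finset.card_univ, ← Nat.cast_smul_eq_nsmul ℂ, smul_smul,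
      inv_mul_cancel₀ hcard, one_smul]
  have hπΛ : ∀ ρ T, π (Λ ρ T) = Λ ρ (π T) := by
    intro ρ T
    rw [hπ, hπ, map_smul, map_sum]
    congr 1
    rw [← Equiv.sum_comp (Equiv.mulLeft ρ)]
    refine Finset.sum_congr rfl fun τ _ => ?_
    rw [Equiv.coe_mulLeft, hΛmul, hΛmul, mul_inv_rev, inv_mul_cancel_right]
  let e : (S → Fin N) → (S → Fin N) → ((S → Fin N) → (S → Fin N) → ℂ) := fun J' I' => Pi.single J' (Pi.single I' 1)
  have hdecomp : ∀ T : ((S → Fin N) → (S → Fin N) → ℂ), T = ∑ J', ∑ I', T J' I' • e J' I' := by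
    intro T
    ext J I
    simp [e, Finset.sum_apply, Pi.single_apply, ite_apply]
  -- For fixed columns I and I', the action of π from column I' to column I is a symmetric kernel by
  -- equivariance, so it commutes with G.
  have hK : ∀ I I' (ρ : Equiv.Perm S) J J',
      π (e (J' ∘ ρ) I') (J ∘ ρ) I = π (e J' I') J I := by
    intro I I' ρ J J'
    have : e J' I' = Λ ρ (e (J' ∘ ρ) I') := by
      ext L I
      have hinj : (L ∘ ρ = J' ∘ ρ) ↔ L = J' :=
        ⟨fun h => ρ.surjective.injective_comp_right h, fun h => by rw [h]⟩
      simp [e, hΛ, Pi.single_apply, hinj]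
    rw [this, hπΛ, hΛ]
  have hcomm := fun I I' => commute_of_commute_GL G (fun J J' => π (e J' I') J I) hG
    (fun ρ J J' => hK I I' ρ J J')
  -- Summing these commutation relations over I' gives G π(1) = π(G); since 1 lies in W, the left
  -- side is G.
  have hGW : G = π G := by
    have h1 : P 1 = ∑ I', e I' I' := by
      ext J I
      simp [P, e, Finset.sum_apply, Pi.single_apply, ite_apply]
    ext J I
    have h2 : ∑ L, G J L * (π (P 1)) L I = G J I := by
      rw [hπid _ (Submodule.subset_span ⟨1, rfl⟩)]
      simp [P]
    rw [← h2, h1]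
    conv_rhs => rw [hdecomp G]
    simp only [map_sum, map_smul, Finset.sum_apply, Pi.smul_apply, smul_eq_mul, Finset.mul_sum]
    rw [Finset.sum_comm]
    conv_rhs => rw [Finset.sum_comm]
    refine Finset.sum_congr rfl fun I' _ => ?_
    rw [← hcomm I I' J I']
    exact Finset.sum_congr rfl fun L _ => mul_comm _ _
  have hmem : G ∈ W := hGW ▸ hπW G
  obtain ⟨c, hc⟩ := (Submodule.mem_span_range_iff_exists_fun ℂ).mp hmem
  refine ⟨c, fun J I => ?_⟩
  rw [← hc]
  simp [P, Finset.sum_apply]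

end Commutant

/-! ### Levi-Civita symbols and their extension by framing rows. -/

section RowDet

variable {N : ℕ} {ρ m : Type} [Fintype ρ] [DecidableEq ρ] [DecidableEq m]
  {R : Type} [CommRing R] {R' : Type} [CommRing R']

/-- The determinant with rows the basis covectors `e_{K 1}, …, e_{K N}` followed by the rows of
`A`. -/
def rowDet (e : Fin N ⊕ ρ ≃ m) (A : Matrix ρ m R) (K : Fin N → m) : R :=
  ((Matrix.fromRows (Matrix.of fun i l => if K i = l then (1 : R) else 0) A).submatrix id e).det

lemma map_rowDet (φ : R →+* R') (e : Fin N ⊕ ρ ≃ m) (A : Matrix ρ m R) (K : Fin N → m) :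
    φ (rowDet e A K) = rowDet e (A.map φ) K := by
  rw [rowDet, rowDet, RingHom.map_det]
  congr 1
  ext (i | i) j
  · simp [apply_ite φ]
  · simp

variable [Fintype m]

/-- Multilinearity of the determinant in its first N rows. -/
lemma sum_prod_mul_rowDet (e : Fin N ⊕ ρ ≃ m) (A : Matrix ρ m R) (c : Matrix (Fin N) m R) :
    ((Matrix.fromRows c A).submatrix id e).det =
      ∑ K : Fin N → m, (∏ i, c i (K i)) * rowDet e A K := by
  have hc : ∀ i l, c i l = ∑ q, c i q * if q = l then 1 else 0 := by simp
  have expand : ∀ c : Matrix (Fin N) m R, ((Matrix.fromRows c A).submatrix id e).det =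
      ∑ τ : Equiv.Perm (Fin N ⊕ ρ), (Equiv.Perm.sign τ : R) *
        ((∏ i, c i (e (τ (Sum.inl i)))) * ∏ a, A a (e (τ (Sum.inr a)))) := by
    intro c
    rw [← Matrix.det_transpose, Matrix.det_apply']
    simp [Fintype.prod_sum_type]
  rw [expand]
  simp only [rowDet, expand, Finset.mul_sum]
  rw [Finset.sum_comm]
  refine Finset.sum_congr rfl fun τ _ => ?_
  rw [Finset.prod_congr rfl fun i _ => hc i (e (τ (Sum.inl i))), prod_sum_eq_sum_pi,
    Finset.sum_mul, Finset.mul_sum]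
  refine Finset.sum_congr rfl fun K _ => ?_
  simp only [Matrix.of_apply, Finset.prod_mul_distrib]
  ring

/-- Multiplying the defining matrix by h on the right turns its row e_K into row K of h; then expand
these rows. This is the covariance that makes `rowDet` an (N + n)-dimensional substitute for the
Levi-Civita symbol. -/
lemma det_mul_rowDet (e : Fin N ⊕ ρ ≃ m) (A : Matrix ρ m R) (h : Matrix m m R) (K : Fin N → m) :
    rowDet e A K * h.det = ∑ K' : Fin N → m, (∏ i, h (K i) (K' i)) * rowDet e (A * h) K' := by
  have := sum_prod_mul_rowDet e (A * h) (h.submatrix K id)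
  simp only [Matrix.submatrix_apply, id] at this
  rw [← this, rowDet,
    ← Matrix.det_submatrix_equiv_self e h, ← Matrix.det_mul, Matrix.submatrix_mul_equiv]
  congr 2
  ext (i | i) j <;> simp [Matrix.mul_apply]

/-- The Levi-Civita symbol. -/
def levi (R : Type) [CommRing R] (K : Fin N → Fin N) : R :=
  rowDet (Equiv.sumEmpty (Fin N) Empty) (0 : Matrix Empty (Fin N) R) K

lemma levi_eq_det (K : Fin N → Fin N) :
    levi R K = (Matrix.of fun i l => if K i = l then (1 : R) else 0).det := by
  rw [← Matrix.det_submatrix_equiv_self (Equiv.sumEmpty (Fin N) Empty), levi, rowDet]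
  congr 1
  ext (i | i) j
  · simp
  · exact i.elim

lemma map_levi (φ : R →+* R') (K : Fin N → Fin N) : φ (levi R K) = levi R' K := by
  rw [levi, map_rowDet, levi, Matrix.map_zero _ (map_zero _)]

lemma levi_mul_det (h : Matrix (Fin N) (Fin N) R) (K : Fin N → Fin N) :
    levi R K * h.det = ∑ K' : Fin N → Fin N, (∏ i, h (K i) (K' i)) * levi R K' := by
  rw [levi, det_mul_rowDet, Matrix.zero_mul]
  rfl

/-- The sum is the image of an integer sum of squares in which the identity contributes 1. -/
lemma sum_levi_sq_ne_zero : ∑ K : Fin N → Fin N, levi ℂ K * levi ℂ K ≠ 0 := by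
  have h : ∑ K : Fin N → Fin N, levi ℂ K * levi ℂ K =
      ((∑ K : Fin N → Fin N, levi ℤ K * levi ℤ K : ℤ) : ℂ) := by
    push_cast
    refine Finset.sum_congr rfl fun K _ => ?_
    rw [← map_levi (Int.castRingHom ℂ) K]
    rfl
  rw [h, Int.cast_ne_zero]
  refine ne_of_gt (Finset.sum_pos' (fun K _ => mul_self_nonneg _) ⟨id, Finset.mem_univ _, ?_⟩)
  have : levi ℤ (id : Fin N → Fin N) = 1 := by
    rw [levi_eq_det]
    exact Matrix.det_one
  rw [this]
  norm_num

/-- On indices from ℂ^N the matrix is block triangular. This is the source of det(η)^k in the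
restriction of a lift. -/
lemma rowDet_cols {N n : ℕ} (A : Matrix (Fin n) (Fin N) R) (η : Matrix (Fin n) (Fin n) R)
    (K : Fin N → Fin N) :
    rowDet finSumFinEquiv (cols A η) (fun i => Fin.castAdd n (K i)) = levi R K * η.det := by
  rw [levi_eq_det, ← Matrix.det_fromBlocks_zero₁₂ _ A, rowDet]
  congr 1
  ext (i | i) (j | j)
  · simp
  · simp only [Matrix.fromRows_apply_inl, Matrix.submatrix_apply, Matrix.of_apply, id,
      finSumFinEquiv_apply_right, Matrix.fromBlocks_apply₁₂, Matrix.zero_apply]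
    rw [if_neg]
    intro h
    have := congrArg Fin.val h
    simp only [Fin.val_castAdd, Fin.val_natAdd] at this
    have := (K i).2
    omega
  · simp [cols]
  · simp [cols]

end RowDet

/-! ### Contractions along permutations and their lifts to size N + n. -/

/-- The index set of the tensor factors: `d` matrices and `k` blocks of `N` covectors. -/
abbrev Slot (d k N : ℕ) : Type := Fin d ⊕ (Fin k × Fin N)

section Contraction

variable {d k N n : ℕ} {m : Type} [Fintype m] {R : Type} [CommRing R]
  {R' : Type} [CommRing R']

lemma sum_slot {M : Type*} [AddCommMonoid M]
    (F : (Fin d → m) → (Fin k → Fin N → m) → M) :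
    ∑ i, ∑ K, F i K = ∑ I : Slot d k N → m,
      F (fun t => I (Sum.inl t)) (fun r i => I (Sum.inr (r, i))) := by
  rw [← Fintype.sum_prod_type']
  exact (Equiv.sum_comp ((Equiv.sumArrowEquivProdArrow (Fin d) (Fin k × Fin N) m).trans
    ((Equiv.refl _).prodCongr (Equiv.curry (Fin k) (Fin N) m)))
    (fun x : (Fin d → m) × (Fin k → Fin N → m) => F x.1 x.2)).symm

/-- The contraction of `X ⊗ ⋯ ⊗ X`, of covectors `α^{a_t}` and of `k` copies of a form `ε` along a
permutation of the tensor factors. -/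
def contraction (σ : Equiv.Perm (Slot d k N)) (a : Fin k × Fin N → Fin n) (X₀ : Matrix m m R)
    (α : Matrix (Fin n) m R) (ε : (Fin N → m) → R) : R :=
  ∑ J : Slot d k N → m, (∏ t, X₀ (J (σ (Sum.inl t))) (J (Sum.inl t))) *
    (∏ t, α (a t) (J (Sum.inr t))) * ∏ r, ε (fun i => J (σ (Sum.inr (r, i))))

lemma map_contraction (φ : R →+* R') (σ : Equiv.Perm (Slot d k N)) (a : Fin k × Fin N → Fin n)
    (X₀ : Matrix m m R) (α : Matrix (Fin n) m R) (ε : (Fin N → m) → R) :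
    φ (contraction σ a X₀ α ε) = contraction σ a (X₀.map φ) (α.map φ) (fun K => φ (ε K)) := by
  simp [contraction, map_sum, map_mul, map_prod]

/-- On the left every upper index J (σ t), belonging to an X or to a form, emits one factor of h.
After relabelling J by σ these are exactly the factors standing to the right of each X and each
covector. -/
lemma contraction_mul (σ : Equiv.Perm (Slot d k N)) (a : Fin k × Fin N → Fin n)
    (h X₀ : Matrix m m R) (α : Matrix (Fin n) m R) (ε ε' : (Fin N → m) → R)
    (hε : ∀ K, ε' K = ∑ K' : Fin N → m, (∏ i, h (K i) (K' i)) * ε K') :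
    contraction σ a (h * X₀) α ε' = contraction σ a (X₀ * h) (α * h) ε := by
  have lhs : contraction σ a (h * X₀) α ε' = ∑ J : Slot d k N → m, ∑ I : Slot d k N → m,
      (∏ t, h (J (σ t)) (I t)) * ((∏ t, X₀ (I (Sum.inl t)) (J (Sum.inl t))) *
        (∏ t, α (a t) (J (Sum.inr t))) * ∏ r, ε (fun i => I (Sum.inr (r, i)))) := by
    refine Finset.sum_congr rfl fun J _ => ?_
    simp only [Matrix.mul_apply, hε]
    rw [prod_sum_eq_sum_pi, prod_sum_eq_sum_pi, Finset.sum_mul, Finset.sum_mul]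
    simp only [Finset.mul_sum]
    rw [sum_slot (N := N)]
    refine Finset.sum_congr rfl fun I _ => ?_
    simp only [Finset.prod_mul_distrib, Fintype.prod_sum_type, Fintype.prod_prod_type]
    ring
  have rhs : contraction σ a (X₀ * h) (α * h) ε = ∑ I : Slot d k N → m, ∑ J : Slot d k N → m,
      (∏ t, h (J (σ t)) (I t)) * ((∏ t, X₀ (I (Sum.inl t)) (J (Sum.inl t))) *
        (∏ t, α (a t) (J (Sum.inr t))) * ∏ r, ε (fun i => I (Sum.inr (r, i)))) := by
    rw [contraction, ← Equiv.sum_comp (σ.symm.arrowCongr (Equiv.refl m)).symm]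
    refine Finset.sum_congr rfl fun I _ => ?_
    have hI : ∀ t, ((σ.symm.arrowCongr (Equiv.refl m)).symm I) t = I (σ.symm t) := fun t => rfl
    simp only [hI, Equiv.symm_apply_apply, Matrix.mul_apply]
    have key := prod_sum_eq_sum_pi (R := R) (fun (t : Slot d k N) q =>
      Sum.elim (fun t => X₀ (I (Sum.inl t))) (fun t => α (a t)) t q * h q (I (σ.symm t)))
    rw [Fintype.prod_sum_type] at key
    simp only [Sum.elim_inl, Sum.elim_inr] at key
    rw [key, Finset.sum_mul]
    refine Finset.sum_congr rfl fun J _ => ?_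
    rw [Finset.prod_mul_distrib, Fintype.prod_sum_type (fun t => Sum.elim (fun t => X₀ (I (Sum.inl t))) (fun t => α (a t)) t (J t)),
      ← Equiv.prod_comp σ (fun t => h (J t) (I (σ.symm t)))]
    simp only [Sum.elim_inl, Sum.elim_inr, Equiv.symm_apply_apply]
    ring
  rw [lhs, rhs, Finset.sum_comm]

/-- Every slot index J t is a lower index of some X or some covector, and both vanish on the last n
coordinates, so only indices from ℂ^N contribute. -/
lemma contraction_blk (σ : Equiv.Perm (Slot d k N)) (a : Fin k × Fin N → Fin n)
    (X₀ : Matrix (Fin N) (Fin N) R) (α : Matrix (Fin n) (Fin N) R)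
    (ε : (Fin N → Fin (N + n)) → R) :
    contraction σ a (blk X₀ 0 0 0) (cols α 0) ε =
      contraction σ a X₀ α (fun K => ε (fun i => Fin.castAdd n (K i))) := by
  symm
  refine Fintype.sum_of_injective (fun J t => Fin.castAdd n (J t)) ?_ _ _ ?_ ?_
  · intro J J' h
    ext t
    simpa using congrArg Fin.val (congrFun h t)
  · intro J hJ
    have hex : ∃ t l, J t = Fin.natAdd N l := by
      by_contra! hne
      have : ∀ t, ∃ l, J t = Fin.castAdd n l := fun t =>
        Fin.addCases (motive := fun x => (∀ l, x ≠ Fin.natAdd N l) → ∃ l, x = Fin.castAdd n l)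
          (fun l _ => ⟨l, rfl⟩) (fun l h => absurd rfl (h l)) (J t) (hne t)
      choose J' hJ' using this
      exact hJ ⟨J', funext fun t => (hJ' t).symm⟩
    obtain ⟨t | t, l, hl⟩ := hex
    · rw [Finset.prod_eq_zero (Finset.mem_univ t), zero_mul, zero_mul]
      rw [hl, blk]
      rcases h : finSumFinEquiv.symm (J (σ (Sum.inl t))) with x | x <;> simp [h]
    · rw [Finset.prod_eq_zero (i := t) (s := Finset.univ) (f := fun t => cols α 0 (a t) _)
        (Finset.mem_univ t), mul_zero, zero_mul]
      rw [hl, cols]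
      simp
  · intro J
    simp [blk, cols]

/-- The polynomial on `(N + n)`-dimensional data attached to a permutation of tensor factors. -/
def liftPoly (σ : Equiv.Perm (Slot d k N)) (a : Fin k × Fin N → Fin n) : Poly (N + n) n :=
  contraction σ a (coordX (N + n) n) (coordA (N + n) n * coordX (N + n) n)
    (rowDet finSumFinEquiv (coordA (N + n) n))

lemma evalAt_liftPoly [Algebra ℂ R] (σ : Equiv.Perm (Slot d k N)) (a : Fin k × Fin N → Fin n)
    (X₀ : Matrix (Fin (N + n)) (Fin (N + n)) R) (A₀ : Matrix (Fin n) (Fin (N + n)) R) :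
    evalAt X₀ A₀ (liftPoly σ a) = contraction σ a X₀ (A₀ * X₀) (rowDet finSumFinEquiv A₀) := by
  have := map_contraction (evalAt X₀ A₀).toRingHom σ a (coordX (N + n) n)
    (coordA (N + n) n * coordX (N + n) n) (rowDet finSumFinEquiv (coordA (N + n) n))
  simp only [map_rowDet] at this
  refine this.trans ?_
  change contraction σ a ((coordX (N + n) n).map (evalAt X₀ A₀))
    ((coordA (N + n) n * coordX (N + n) n).map (evalAt X₀ A₀))
    (rowDet finSumFinEquiv ((coordA (N + n) n).map (evalAt X₀ A₀))) = _
  rw [map_mul_algHom, coordX_map_evalAt, coordA_map_evalAt]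

lemma contraction_smul (σ : Equiv.Perm (Slot d k N)) (a : Fin k × Fin N → Fin n)
    (X₀ : Matrix m m R) (α : Matrix (Fin n) m R) (ε : (Fin N → m) → R) (c : R) :
    contraction σ a X₀ α (fun K => ε K * c) = contraction σ a X₀ α ε * c ^ k := by
  simp [contraction, Finset.prod_mul_distrib, Finset.sum_mul, mul_assoc]

lemma liftPoly_mem (σ : Equiv.Perm (Slot d k N)) (a : Fin k × Fin N → Fin n) :
    liftPoly σ a ∈ hilb (N + n) n k := by
  refine mem_hilb_of_identity fun h _ => ?_
  rw [evalAt_liftPoly, evalAt_liftPoly, ← contraction_smul,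
    contraction_mul σ a h _ _ (rowDet finSumFinEquiv (coordA (N + n) n * h)) _
      (fun K => det_mul_rowDet _ _ h K)]
  simp only [Matrix.mul_assoc]

/-- The covectors in `liftPoly` are AX rather than A because (A, η)(X ⊕ 0) = (AX, 0) has no last n
components, as `contraction_blk` requires. -/
lemma auxRestrict_liftPoly (σ : Equiv.Perm (Slot d k N)) (a : Fin k × Fin N → Fin n) :
    auxRestrict N n (liftPoly σ a) =
      contraction σ a (auxX N n) (auxA N n * auxX N n) (levi (AuxPoly N n)) * detEta N n ^ k := by
  rw [auxRestrict_eq_evalAt, evalAt_liftPoly, cols_mul]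
  simp only [Matrix.mul_zero, add_zero]
  rw [contraction_blk]
  simp only [rowDet_cols]
  rw [contraction_smul, detEta_eq]

end Contraction

/-! ### Symmetric coefficient systems of polynomials of given bidegree. -/

section Symmetric

variable {d k N n : ℕ}

/-- Labels of the products `∏ X^{i_t}_{J_t} ∏ A^{a_t}_{J_t}`. -/
abbrev Label (d k N n : ℕ) : Type :=
  (Fin d → Fin N) × (Slot d k N → Fin N) × (Fin k × Fin N → Fin n)

/-- The product `∏ X^{i_t}_{J_t} ∏ A^{a_t}_{J_t}`. -/
def labelProd {m R : Type} [CommRing R] (X₀ : Matrix m m R) (A₀ : Matrix (Fin n) m R)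
    (i : Fin d → m) (J : Slot d k N → m) (a : Fin k × Fin N → Fin n) : R :=
  (∏ t, X₀ (i t) (J (Sum.inl t))) * ∏ t, A₀ (a t) (J (Sum.inr t))

/-- The exponent vector of a product of coordinates. -/
def labelExp (u : Label d k N n) : Coord N n →₀ ℕ :=
  (∑ t, Finsupp.single (Sum.inl (u.1 t, u.2.1 (Sum.inl t))) 1) +
    ∑ t, Finsupp.single (Sum.inr (u.2.2 t, u.2.1 (Sum.inr t))) 1

lemma labelExp_inl (u : Label d k N n) (v : Fin N × Fin N) :
    labelExp u (Sum.inl v) = ∑ t, if (u.1 t, u.2.1 (Sum.inl t)) = v then 1 else 0 := by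
  simp [labelExp, Finsupp.single_apply]

lemma labelExp_inr (u : Label d k N n) (v : Fin n × Fin N) :
    labelExp u (Sum.inr v) = ∑ t, if (u.2.2 t, u.2.1 (Sum.inr t)) = v then 1 else 0 := by
  simp [labelExp, Finsupp.single_apply]

lemma evalAt_monomial_labelExp {R : Type} [CommRing R] [Algebra ℂ R]
    (X₀ : Matrix (Fin N) (Fin N) R) (A₀ : Matrix (Fin n) (Fin N) R) (u : Label d k N n) :
    evalAt X₀ A₀ (monomial (labelExp u) 1) = labelProd X₀ A₀ u.1 u.2.1 u.2.2 := by
  have h : (monomial (labelExp u) (1 : ℂ)) =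
      (∏ t, X (Sum.inl (u.1 t, u.2.1 (Sum.inl t)))) *
        ∏ t, X (Sum.inr (u.2.2 t, u.2.1 (Sum.inr t))) := by
    rw [labelExp, ← mul_one (1 : ℂ), ← monomial_mul, monomial_sum_one, monomial_sum_one]
    rfl
  rw [h]
  simp [labelProd]

lemma exists_label (m : Coord N n →₀ ℕ) (hX : ∑ v, m (Sum.inl v) = d)
    (hA : ∑ v, m (Sum.inr v) = k * N) : ∃ u : Label d k N n, labelExp u = m := by
  obtain ⟨x, hx⟩ := exists_card_fiber_eq (T := Fin d) (fun v => m (Sum.inl v)) (by simpa using hX)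
  obtain ⟨y, hy⟩ := exists_card_fiber_eq (T := Fin k × Fin N) (fun v => m (Sum.inr v))
    (by simpa using hA)
  refine ⟨⟨fun t => (x t).1, Sum.elim (fun t => (x t).2) (fun t => (y t).2), fun t => (y t).1⟩, ?_⟩
  ext (v | v)
  · rw [labelExp_inl]
    exact hx v
  · rw [labelExp_inr]
    exact hy v

/-- Invariance of a coefficient system under relabelling of the factors. -/
def IsSymm (δ : Label d k N n → ℂ) : Prop :=
  ∀ (π : Equiv.Perm (Fin d)) (ρ : Equiv.Perm (Fin k × Fin N)) (u : Label d k N n),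
    δ (u.1 ∘ π, u.2.1 ∘ Sum.map π ρ, u.2.2 ∘ ρ) = δ u

lemma isSymm_of_labelExp {δ : Label d k N n → ℂ}
    (h : ∀ u u', labelExp u = labelExp u' → δ u = δ u') : IsSymm δ := by
  intro π ρ u
  refine h _ _ ?_
  ext (v | v)
  · rw [labelExp_inl, labelExp_inl]
    exact Equiv.sum_comp π (fun t => if (u.1 t, u.2.1 (Sum.inl t)) = v then 1 else 0)
  · rw [labelExp_inr, labelExp_inr]
    exact Equiv.sum_comp ρ (fun t => if (u.2.2 t, u.2.1 (Sum.inr t)) = v then 1 else 0)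

lemma IsSymm.eq_of_labelExp_eq {δ : Label d k N n → ℂ} (hδ : IsSymm δ) {u u' : Label d k N n}
    (h : labelExp u = labelExp u') : δ u' = δ u := by
  obtain ⟨π, hπ⟩ := exists_perm_of_card_fiber_eq (fun t => (u.1 t, u.2.1 (Sum.inl t)))
    (fun t => (u'.1 t, u'.2.1 (Sum.inl t))) (fun v => by
      rw [← labelExp_inl, ← labelExp_inl, h])
  obtain ⟨ρ, hρ⟩ := exists_perm_of_card_fiber_eq (fun t => (u.2.2 t, u.2.1 (Sum.inr t)))
    (fun t => (u'.2.2 t, u'.2.1 (Sum.inr t))) (fun v => by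
      rw [← labelExp_inr, ← labelExp_inr, h])
  rw [← hδ π ρ u]
  congr 1
  refine Prod.ext (funext fun t => congrArg Prod.fst (congrFun hπ t)) (Prod.ext (funext fun t => ?_)
    (funext fun t => congrArg Prod.fst (congrFun hρ t)))
  rcases t with t | t
  · exact congrArg Prod.snd (congrFun hπ t)
  · exact congrArg Prod.snd (congrFun hρ t)

lemma IsSymm.sub {δ δ' : Label d k N n → ℂ} (h : IsSymm δ) (h' : IsSymm δ') :
    IsSymm (fun u => δ u - δ' u) := by
  intro π ρ u
  exact congrArg₂ _ (h π ρ u) (h' π ρ u)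

/-- A symmetric coefficient system is determined by its polynomial. -/
lemma IsSymm.eq_zero {δ : Label d k N n → ℂ} (hδ : IsSymm δ)
    (h : ∑ u, δ u • (monomial (labelExp u) 1 : Poly N n) = 0) (u : Label d k N n) : δ u = 0 := by
  classical
  have hc := congrArg (coeff (labelExp u)) h
  simp only [coeff_sum, coeff_smul, coeff_monomial, smul_eq_mul, mul_ite, mul_one, mul_zero,
    coeff_zero] at hc
  have : ∀ u' : Label d k N n, (if labelExp u' = labelExp u then δ u' else 0) =
      if labelExp u' = labelExp u then δ u else 0 := by
    intro u'
    split_ifs with hu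
    · exact hδ.eq_of_labelExp_eq hu.symm
    · rfl
  rw [Finset.sum_congr rfl fun u' _ => this u', ← Finset.sum_filter, Finset.sum_const,
    nsmul_eq_mul, mul_eq_zero, Nat.cast_eq_zero, Finset.card_eq_zero] at hc
  refine hc.resolve_left fun he => ?_
  have : u ∈ Finset.univ.filter fun u' : Label d k N n => labelExp u' = labelExp u := by simp
  rw [he] at this
  simp at this

lemma IsSymm.ext {δ δ' : Label d k N n → ℂ} (hδ : IsSymm δ) (hδ' : IsSymm δ')
    (h : ∑ u, δ u • (monomial (labelExp u) 1 : Poly N n) =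
      ∑ u, δ' u • (monomial (labelExp u) 1 : Poly N n)) : δ = δ' := by
  funext u
  refine sub_eq_zero.mp ((hδ.sub hδ').eq_zero ?_ u)
  simp only [sub_smul, Finset.sum_sub_distrib, h, sub_self]

/-- Every polynomial of the right bidegree has a symmetric coefficient system. -/
lemma exists_isSymm (g : Poly N n)
    (hg : ∀ m ∈ g.support, ∑ v, m (Sum.inl v) = d ∧ ∑ v, m (Sum.inr v) = k * N) :
    ∃ γ : Label d k N n → ℂ, IsSymm γ ∧ g = ∑ u, γ u • monomial (labelExp u) 1 := by
  classical
  -- The number of labels representing a given monomial; each coefficient is shared equally among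
  -- them.
  let w : (Coord N n →₀ ℕ) → ℂ := fun m =>
    ((Finset.univ.filter fun u : Label d k N n => labelExp u = m).card : ℂ)
  refine ⟨fun u => coeff (labelExp u) g / w (labelExp u),
    isSymm_of_labelExp fun u u' h => by rw [h], ?_⟩
  ext m
  simp only [coeff_sum, coeff_smul, coeff_monomial, smul_eq_mul, mul_ite, mul_one, mul_zero]
  have : ∀ u' : Label d k N n,
      (if labelExp u' = m then coeff (labelExp u') g / w (labelExp u') else 0) =
      if labelExp u' = m then coeff m g / w m else 0 := by
    intro u'
    split_ifs with hu
    · rw [hu]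
    · rfl
  rw [Finset.sum_congr rfl fun u' _ => this u', ← Finset.sum_filter, Finset.sum_const,
    nsmul_eq_mul]
  by_cases hm : coeff m g = 0
  · rw [hm, zero_div, mul_zero]
  obtain ⟨u, hu⟩ := exists_label m (hg m (mem_support_iff.mpr hm)).1 (hg m (mem_support_iff.mpr hm)).2
  have hw : w m ≠ 0 := by
    refine Nat.cast_ne_zero.mpr (Finset.card_ne_zero.mpr ⟨u, by simp [hu]⟩)
  exact (mul_div_cancel₀ _ hw).symm

lemma labelProd_mul_left {R : Type} [CommRing R] (h X₀ : Matrix (Fin N) (Fin N) R)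
    (A₀ : Matrix (Fin n) (Fin N) R) (i : Fin d → Fin N) (J : Slot d k N → Fin N)
    (a : Fin k × Fin N → Fin n) :
    labelProd (h * X₀) A₀ i J a =
      ∑ i' : Fin d → Fin N, (∏ t, h (i t) (i' t)) * labelProd X₀ A₀ i' J a := by
  simp only [labelProd, Matrix.mul_apply]
  rw [prod_sum_eq_sum_pi, Finset.sum_mul]
  refine Finset.sum_congr rfl fun i' _ => ?_
  rw [Finset.prod_mul_distrib, mul_assoc]

lemma labelProd_mul_right {R : Type} [CommRing R] (h X₀ : Matrix (Fin N) (Fin N) R)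
    (A₀ : Matrix (Fin n) (Fin N) R) (i : Fin d → Fin N) (J : Slot d k N → Fin N)
    (a : Fin k × Fin N → Fin n) :
    labelProd (X₀ * h) (A₀ * h) i J a =
      ∑ J' : Slot d k N → Fin N, (∏ t, h (J' t) (J t)) * labelProd X₀ A₀ i J' a := by
  have key := prod_sum_eq_sum_pi (R := R) (fun (t : Slot d k N) q =>
    Sum.elim (fun t => X₀ (i t)) (fun t => A₀ (a t)) t q * h q (J t))
  rw [Fintype.prod_sum_type] at key
  simp only [Sum.elim_inl, Sum.elim_inr] at key
  simp only [labelProd, Matrix.mul_apply]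
  rw [key]
  refine Finset.sum_congr rfl fun J' _ => ?_
  rw [Finset.prod_mul_distrib,
    Fintype.prod_sum_type (fun t => Sum.elim (fun t => X₀ (i t)) (fun t => A₀ (a t)) t (J' t)),
    mul_comm]
  rfl

/-- Semi-invariance of a polynomial in terms of its symmetric coefficients. -/
lemma coefficient_identity {g : Poly N n} (hg : g ∈ hilb N n k) {γ : Label d k N n → ℂ}
    (hγ : IsSymm γ) (hsum : g = ∑ u, γ u • monomial (labelExp u) 1)
    (h : Matrix (Fin N) (Fin N) ℂ) (i' : Fin d → Fin N) (J' : Slot d k N → Fin N)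
    (a : Fin k × Fin N → Fin n) :
    (∑ i, γ (i, J', a) * ∏ t, h (i t) (i' t)) * h.det ^ k =
      ∑ J, γ (i', J, a) * ∏ t, h (J' t) (J t) := by
  let γ₁ : Label d k N n → ℂ := fun u =>
    (∑ i, γ (i, u.2.1, u.2.2) * ∏ t, h (i t) (u.1 t)) * h.det ^ k
  let γ₂ : Label d k N n → ℂ := fun u => ∑ J, γ (u.1, J, u.2.2) * ∏ t, h (u.2.1 t) (J t)
  have h₁ : IsSymm γ₁ := by
    intro π ρ u
    simp only [γ₁]
    congr 1
    rw [← Equiv.sum_comp (π.symm.arrowCongr (Equiv.refl (Fin N)))]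
    refine Finset.sum_congr rfl fun i _ => ?_
    have e : (π.symm.arrowCongr (Equiv.refl (Fin N))) i = i ∘ π := rfl
    rw [e]
    congr 1
    · exact hγ π ρ (i, u.2.1, u.2.2)
    · exact Equiv.prod_comp π (fun t => h (i t) (u.1 t))
  have h₂ : IsSymm γ₂ := by
    intro π ρ u
    simp only [γ₂]
    rw [← Equiv.sum_comp ((Equiv.sumCongr π ρ).symm.arrowCongr (Equiv.refl (Fin N)))]
    refine Finset.sum_congr rfl fun J _ => ?_
    have e : ((Equiv.sumCongr π ρ).symm.arrowCongr (Equiv.refl (Fin N))) J = J ∘ Sum.map π ρ := rfl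
    rw [e]
    congr 1
    · exact hγ π ρ (u.1, J, u.2.2)
    · exact Equiv.prod_comp (Equiv.sumCongr π ρ) (fun t => h (u.2.1 t) (J t))
  have hmon : ∀ u : Label d k N n, (monomial (labelExp u) 1 : Poly N n) =
      labelProd (coordX N n) (coordA N n) u.1 u.2.1 u.2.2 := by
    intro u
    rw [← evalAt_monomial_labelExp, evalAt_coord]
  set H := h.map (algebraMap ℂ (Poly N n)) with hH
  have hdet : H.det = algebraMap ℂ (Poly N n) h.det := by
    rw [RingHom.map_det]; rfl
  have hprod : ∀ {T : Type} [Fintype T] (x y : T → Fin N) (p : Poly N n),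
      (∏ t, H (x t) (y t)) * p = (∏ t, h (x t) (y t)) • p := by
    intro T _ x y p
    rw [Algebra.smul_def, map_prod]
    rfl
  have key := hilb_identity hg H (coordX N n) (coordA N n)
  have e₁ : evalAt (H * coordX N n) (coordA N n) g * H.det ^ k =
      ∑ u, γ₁ u • (monomial (labelExp u) 1 : Poly N n) := by
    conv_lhs => rw [hsum]
    simp only [map_sum, map_smul, evalAt_monomial_labelExp, labelProd_mul_left, hprod, hdet]
    simp only [hmon, γ₁, Finset.sum_smul, Finset.smul_sum, smul_smul, Finset.sum_mul, ← map_pow]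
    conv_lhs => rw [Fintype.sum_prod_type]
    conv_rhs => rw [Fintype.sum_prod_type]
    simp only [mul_comm _ (algebraMap ℂ (Poly N n) _), ← Algebra.smul_def, smul_smul]
    rw [Finset.sum_comm]
    conv_rhs => rw [Finset.sum_comm]
    refine Finset.sum_congr rfl fun x _ => ?_
    rw [Finset.sum_comm]
    refine Finset.sum_congr rfl fun i' _ => Finset.sum_congr rfl fun i _ => ?_
    rw [mul_comm]
  have e₂ : evalAt (coordX N n * H) (coordA N n * H) g =
      ∑ u, γ₂ u • (monomial (labelExp u) 1 : Poly N n) := by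
    conv_lhs => rw [hsum]
    simp only [map_sum, map_smul, evalAt_monomial_labelExp]
    have e : ∀ u : Label d k N n,
        labelProd (coordX N n * H) (coordA N n * H) u.1 u.2.1 u.2.2 =
        ∑ J' : Slot d k N → Fin N, (∏ t, h (J' t) (u.2.1 t)) •
          labelProd (coordX N n) (coordA N n) u.1 J' u.2.2 := by
      intro u
      rw [labelProd_mul_right]
      simp only [hprod]
    simp only [e, hmon, γ₂, Fintype.sum_prod_type, Finset.sum_smul, Finset.smul_sum, smul_smul]
    refine Finset.sum_congr rfl fun i _ => ?_
    rw [Finset.sum_comm]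
    conv_rhs => rw [Finset.sum_comm]
    refine Finset.sum_congr rfl fun a _ => ?_
    rw [Finset.sum_comm]
  -- Both systems are symmetric and represent the two sides of the covariance identity, so
  -- uniqueness of symmetric coefficients identifies them.
  have heq : γ₁ = γ₂ := h₁.ext h₂ (e₁.symm.trans (key.trans e₂))
  exact congrFun heq (i', J', a)

end Symmetric

/-! ### First fundamental theorem and lifting of semi-invariants. -/

lemma homogeneousComponent_aeval {σ τ : Type} (F : σ → MvPolynomial τ ℂ)
    (hF : ∀ v, (F v).IsHomogeneous 1) (e : ℕ) (f : MvPolynomial σ ℂ) :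
    homogeneousComponent e (aeval F f) = aeval F (homogeneousComponent e f) := by
  have h : ∀ i, (aeval F (homogeneousComponent i f)).IsHomogeneous i := by
    intro i
    simpa using (homogeneousComponent_isHomogeneous i f).aeval F hF
  conv_lhs => rw [← sum_homogeneousComponent f]
  rw [map_sum, map_sum]
  have h' : ∀ i, homogeneousComponent e (aeval F (homogeneousComponent i f)) =
      if e = i then aeval F (homogeneousComponent i f) else 0 := fun i =>
    homogeneousComponent_of_mem (h i)
  simp only [h', Finset.sum_ite_eq, Finset.mem_range]
  split_ifs with he
  · rfl
  · rw [homogeneousComponent_eq_zero _ _ (by omega), map_zero]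

lemma coeff_aeval_C_mul_X {σ : Type} [Fintype σ] (c : σ → ℂ) (f : MvPolynomial σ ℂ)
    (m : σ →₀ ℕ) :
    coeff m (aeval (fun v => C (c v) * X v) f) = (∏ v, c v ^ m v) * coeff m f := by
  classical
  induction f using MvPolynomial.induction_on' with
  | monomial s a =>
    have : aeval (fun v => C (c v) * X v) (monomial s a) =
        monomial s (a * ∏ v, c v ^ s v) := by
      rw [aeval_monomial, Finsupp.prod_fintype _ _ (fun _ => pow_zero _)]
      simp only [mul_pow, Finset.prod_mul_distrib, ← map_pow, ← map_prod]
      rw [algebraMap_eq, ← mul_assoc, ← C_mul, monomial_eq, Finsupp.prod_fintype _ _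
        (fun _ => pow_zero _)]
    rw [this, coeff_monomial, coeff_monomial]
    split_ifs with h
    · rw [h, mul_comm]
    · rw [mul_zero]
  | add p q hp hq => rw [map_add, coeff_add, coeff_add, hp, hq, mul_add]

section FirstFundamental

variable {d k N n : ℕ}

lemma gaugeAct_homogeneousComponent (h : GL (Fin N) ℂ) (e : ℕ) (f : Poly N n) :
    homogeneousComponent e (gaugeAct h f) = gaugeAct h (homogeneousComponent e f) := by
  refine homogeneousComponent_aeval _ (fun v => ?_) e f
  rcases v with ⟨i, j⟩ | ⟨a, i⟩
  · have := gaugeAct_X (n := n) h i j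
    rw [gaugeAct, aeval_X] at this
    rw [this]
    exact IsHomogeneous.sum _ _ _ fun q _ => IsHomogeneous.sum _ _ _ fun p _ =>
      isHomogeneous_C_mul_X _ _
  · have := gaugeAct_A (n := n) h a i
    rw [gaugeAct, aeval_X] at this
    rw [this]
    exact IsHomogeneous.sum _ _ _ fun q _ => isHomogeneous_C_mul_X _ _

lemma homogeneousComponent_mem_hilb {f : Poly N n} (hf : f ∈ hilb N n k) (e : ℕ) :
    homogeneousComponent e f ∈ hilb N n k := by
  intro h
  rw [← gaugeAct_homogeneousComponent, hf h, map_smul]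

/-- Semi-invariants have degree `k N` in the framing variables. -/
lemma degree_framing {g : Poly N n} (hg : g ∈ hilb N n k) {m : Coord N n →₀ ℕ}
    (hm : m ∈ g.support) : ∑ v, m (Sum.inr v) = k * N := by
  -- With H = 2 the identity reads 2^{kN} g(2X, A) = g(2X, 2A); comparing the coefficient of a
  -- monomial gives its degree in A.
  have key := hilb_identity hg ((C 2 : Poly N n) • (1 : Matrix (Fin N) (Fin N) (Poly N n)))
    (coordX N n) (coordA N n)
  have e₁ : evalAt (((C 2 : Poly N n) • (1 : Matrix (Fin N) (Fin N) (Poly N n))) * coordX N n)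
      (coordA N n) = aeval (fun v => C (Sum.elim (fun _ => 2) (fun _ => 1) v : ℂ) * X v) := by
    rw [evalAt]
    congr 1
    ext1 v
    rcases v with v | v <;> simp [coordX, coordA]
  have e₂ : evalAt (coordX N n * ((C 2 : Poly N n) • (1 : Matrix (Fin N) (Fin N) (Poly N n))))
      (coordA N n * ((C 2 : Poly N n) • (1 : Matrix (Fin N) (Fin N) (Poly N n)))) =
      aeval (fun v => C (2 : ℂ) * X v) := by
    rw [evalAt]
    congr 1
    ext1 v
    rcases v with v | v <;> simp [coordX, coordA]
  rw [e₁, e₂, Matrix.det_smul, Matrix.det_one, mul_one, ← map_pow, ← map_pow, mul_comm] at key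
  have hc := congrArg (coeff m) key
  rw [coeff_C_mul, coeff_aeval_C_mul_X, coeff_aeval_C_mul_X (fun _ => 2), ← mul_assoc] at hc
  have hc' := mul_right_cancel₀ (mem_support_iff.mp hm) hc
  simp only [Fintype.prod_sum_type, Sum.elim_inl, Sum.elim_inr, one_pow, Finset.prod_const_one,
    mul_one, Finset.prod_pow_eq_pow_sum] at hc'
  rw [mul_comm, Fintype.sum_sum_type, pow_add] at hc'
  have h2 := mul_left_cancel₀ (pow_ne_zero _ (two_ne_zero (α := ℂ))) hc'
  rw [← pow_mul, Fintype.card_fin] at h2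
  have h3 : 2 ^ (N * k) = 2 ^ ∑ v, m (Sum.inr v) := by exact_mod_cast h2
  rw [← Nat.pow_right_injective (le_refl 2) h3, mul_comm]

/-- The coefficients of a semi-invariant, completed by Levi-Civita symbols, commute with `GL_N`. -/
lemma coefficient_commute {g : Poly N n} (hg : g ∈ hilb N n k) {γ : Label d k N n → ℂ}
    (hγ : IsSymm γ) (hsum : g = ∑ u, γ u • monomial (labelExp u) 1)
    (a : Fin k × Fin N → Fin n) (h : GL (Fin N) ℂ) (J I : Slot d k N → Fin N) :
    ∑ L : Slot d k N → Fin N, (∏ t, h.1 (J t) (L t)) * (γ (fun t => I (Sum.inl t), L, a) *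
        ∏ r, levi ℂ (fun i => I (Sum.inr (r, i)))) =
      ∑ L : Slot d k N → Fin N, (γ (fun t => L (Sum.inl t), J, a) *
        ∏ r, levi ℂ (fun i => L (Sum.inr (r, i)))) * ∏ t, h.1 (L t) (I t) := by
  have key := coefficient_identity hg hγ hsum h.1 (fun t => I (Sum.inl t)) J a
  have lhs : ∑ L : Slot d k N → Fin N, (∏ t, h.1 (J t) (L t)) * (γ (fun t => I (Sum.inl t), L, a) *
        ∏ r, levi ℂ (fun i => I (Sum.inr (r, i)))) =
      (∑ L, γ (fun t => I (Sum.inl t), L, a) * ∏ t, h.1 (J t) (L t)) *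
        ∏ r, levi ℂ (fun i => I (Sum.inr (r, i))) := by
    rw [Finset.sum_mul]
    exact Finset.sum_congr rfl fun L _ => by ring
  have hlevi : ∀ r : Fin k, ∑ K : Fin N → Fin N,
      (∏ i, h.1 (K i) (I (Sum.inr (r, i)))) * levi ℂ K =
        levi ℂ (fun i => I (Sum.inr (r, i))) * h.1.det := by
    intro r
    rw [← Matrix.det_transpose, levi_mul_det]
    rfl
  have rhs : ∑ L : Slot d k N → Fin N, (γ (fun t => L (Sum.inl t), J, a) *
        ∏ r, levi ℂ (fun i => L (Sum.inr (r, i)))) * ∏ t, h.1 (L t) (I t) =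
      (∑ i, γ (i, J, a) * ∏ t, h.1 (i t) (I (Sum.inl t))) * ∏ r, ∑ K : Fin N → Fin N,
        (∏ i, h.1 (K i) (I (Sum.inr (r, i)))) * levi ℂ K := by
    rw [prod_sum_eq_sum_pi, Finset.sum_mul]
    simp only [Finset.mul_sum]
    rw [sum_slot (N := N)]
    refine Finset.sum_congr rfl fun L _ => ?_
    rw [Fintype.prod_sum_type, Fintype.prod_prod_type, Finset.prod_mul_distrib]
    ring
  rw [lhs, rhs, ← key]
  simp only [hlevi, Finset.prod_mul_distrib, Finset.prod_const, Finset.card_univ, Fintype.card_fin]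
  ring

/-- The semi-invariants are spanned by contractions with permutations. -/
lemma exists_contraction_expansion {g : Poly N n} (hg : g ∈ hilb N n k)
    (hd : g.IsHomogeneous (d + k * N)) :
    ∃ c : (Fin k × Fin N → Fin n) → Equiv.Perm (Slot d k N) → ℂ,
      g = ∑ a, ∑ σ, c a σ • contraction σ a (coordX N n) (coordA N n) (levi (Poly N n)) := by
  classical
  obtain ⟨γ, hγ, hsum⟩ := exists_isSymm (d := d) (k := k) g (fun m hm => by
    have h1 := degree_framing hg hm
    have h2 := hd.degree_eq_sum_deg_support hm
    rw [← Finsupp.degree_apply, Finsupp.degree_eq_sum, Fintype.sum_sum_type] at h2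
    exact ⟨by omega, h1⟩)
  choose c hc using fun a => exists_perm_expansion
    (fun J I : Slot d k N → Fin N => γ (fun t => I (Sum.inl t), J, a) *
      ∏ r, levi ℂ (fun i => I (Sum.inr (r, i)))) (coefficient_commute hg hγ hsum a)
  -- The permutation expansion is that of γ times k Levi-Civita symbols. Contracting each symbol
  -- with a second copy replaces it by the scalar Z, which is divided out at the end.
  set Z : ℂ := ∑ K : Fin N → Fin N, levi ℂ K * levi ℂ K with hZ
  have hZk : Z ^ k ≠ 0 := pow_ne_zero _ sum_levi_sq_ne_zero
  have key : ∑ a, ∑ σ, c a σ • contraction σ a (coordX N n) (coordA N n) (levi (Poly N n)) =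
      Z ^ k • g := by
    have hlevi : ∀ K : Fin N → Fin N, levi (Poly N n) K = C (levi ℂ K) := fun K =>
      (map_levi C K).symm
    have hmon : ∀ u : Label d k N n, (monomial (labelExp u) 1 : Poly N n) =
        labelProd (coordX N n) (coordA N n) u.1 u.2.1 u.2.2 := by
      intro u
      rw [← evalAt_monomial_labelExp, evalAt_coord]
    have hcon : ∀ a σ, contraction σ a (coordX N n) (coordA N n) (levi (Poly N n)) =
        ∑ J : Slot d k N → Fin N, ∑ I : Slot d k N → Fin N, ((if I = J ∘ σ then (1 : ℂ) else 0) *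
          ∏ r, levi ℂ (fun i => I (Sum.inr (r, i)))) •
          labelProd (coordX N n) (coordA N n) (fun t => I (Sum.inl t)) J a := by
      intro a σ
      refine Finset.sum_congr rfl fun J _ => ?_
      simp only [ite_mul, one_mul, zero_mul, ite_smul, zero_smul, Finset.sum_ite_eq',
        Finset.mem_univ, if_true, hlevi, ← map_prod]
      rw [smul_eq_C_mul, mul_comm]
      rfl
    have hcollect : ∀ a, ∑ σ, c a σ • contraction σ a (coordX N n) (coordA N n)
        (levi (Poly N n)) =
        ∑ J : Slot d k N → Fin N, ∑ I : Slot d k N → Fin N, (γ (fun t => I (Sum.inl t), J, a) *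
          (∏ r, levi ℂ (fun i => I (Sum.inr (r, i))) * levi ℂ (fun i => I (Sum.inr (r, i))))) •
          labelProd (coordX N n) (coordA N n) (fun t => I (Sum.inl t)) J a := by
      intro a
      simp only [hcon, Finset.smul_sum, smul_smul]
      rw [Finset.sum_comm]
      refine Finset.sum_congr rfl fun J _ => ?_
      rw [Finset.sum_comm]
      refine Finset.sum_congr rfl fun I _ => ?_
      rw [← Finset.sum_smul, Finset.prod_mul_distrib, ← mul_assoc, hc a J I, Finset.sum_mul]
      simp only [mul_assoc]
    have hZprod : ∑ K : Fin k → Fin N → Fin N, ∏ r, levi ℂ (K r) * levi ℂ (K r) = Z ^ k := by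
      rw [← prod_sum_eq_sum_pi (fun (_ : Fin k) (K : Fin N → Fin N) => levi ℂ K * levi ℂ K),
        Finset.prod_const, Finset.card_univ, Fintype.card_fin]
    have hcollect' : ∀ a, ∑ σ, c a σ • contraction σ a (coordX N n) (coordA N n)
        (levi (Poly N n)) =
        ∑ J : Slot d k N → Fin N, ∑ i : Fin d → Fin N, (Z ^ k * γ (i, J, a)) •
          labelProd (coordX N n) (coordA N n) i J a := by
      intro a
      rw [hcollect]
      refine Finset.sum_congr rfl fun J _ => ?_
      rw [← sum_slot (N := N) (m := Fin N) (fun (i : Fin d → Fin N) (K : Fin k → Fin N → Fin N) =>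
        (γ (i, J, a) * ∏ r, levi ℂ (K r) * levi ℂ (K r)) •
          labelProd (coordX N n) (coordA N n) i J a)]
      refine Finset.sum_congr rfl fun i _ => ?_
      rw [← Finset.sum_smul, ← Finset.mul_sum, hZprod, mul_comm]
    rw [hsum]
    simp only [hcollect', hmon, Finset.smul_sum, smul_smul, Fintype.sum_prod_type]
    rw [Finset.sum_comm]
    conv_rhs => rw [Finset.sum_comm]
    refine Finset.sum_congr rfl fun J _ => ?_
    rw [Finset.sum_comm]
  refine ⟨fun a σ => (Z ^ k)⁻¹ * c a σ, ?_⟩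
  simp only [mul_smul, ← Finset.smul_sum]
  rw [key, smul_smul, inv_mul_cancel₀ hZk, one_smul]

/-- Homogeneous semi-invariants lift along the transition map. -/
lemma exists_lift_of_isHomogeneous {g : Poly N n} (hg : g ∈ hilb N n k)
    (hd : g.IsHomogeneous (d + k * N)) :
    ∃ f ∈ hilb (N + n) n k,
      auxRestrict N n f = detX N n ^ k * detEta N n ^ k * auxIncl N n g := by
  obtain ⟨c, hc⟩ := exists_contraction_expansion hg hd
  refine ⟨∑ a, ∑ σ, c a σ • liftPoly σ a, Submodule.sum_mem _ fun a _ =>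
    Submodule.sum_mem _ fun σ _ => Submodule.smul_mem _ _ (liftPoly_mem σ a), ?_⟩
  -- Covariance with H = X itself: g(X, AX) = det(X)^k g(X, A).
  have h1 := hilb_identity hg (auxX N n) 1 (auxA N n)
  rw [Matrix.mul_one, Matrix.one_mul, ← auxIncl_eq_evalAt] at h1
  have h2 : evalAt (auxX N n) (auxA N n * auxX N n) g = ∑ a, ∑ σ, c a σ •
      contraction σ a (auxX N n) (auxA N n * auxX N n) (levi (AuxPoly N n)) := by
    conv_lhs => rw [hc]
    simp only [map_sum, map_smul]
    refine Finset.sum_congr rfl fun a _ => Finset.sum_congr rfl fun σ _ => ?_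
    congr 1
    have := map_contraction (evalAt (auxX N n) (auxA N n * auxX N n)).toRingHom σ a (coordX N n)
      (coordA N n) (levi (Poly N n))
    simp only [map_levi] at this
    refine this.trans ?_
    change contraction σ a ((coordX N n).map (evalAt (auxX N n) (auxA N n * auxX N n)))
      ((coordA N n).map (evalAt (auxX N n) (auxA N n * auxX N n))) (levi (AuxPoly N n)) = _
    rw [coordX_map_evalAt, coordA_map_evalAt]
  simp only [map_sum, map_smul, auxRestrict_liftPoly, ← smul_mul_assoc, ← Finset.sum_mul]
  rw [← h2, ← h1, detX_eq]
  ring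

/-- Homogeneous components lift separately; those of degree below kN vanish by `degree_framing`. -/
lemma exists_lift {g : Poly N n} (hg : g ∈ hilb N n k) :
    ∃ f ∈ hilb (N + n) n k,
      auxRestrict N n f = detX N n ^ k * detEta N n ^ k * auxIncl N n g := by
  have h : ∀ e, ∃ f ∈ hilb (N + n) n k, auxRestrict N n f =
      detX N n ^ k * detEta N n ^ k * auxIncl N n (homogeneousComponent e g) := by
    intro e
    have he := homogeneousComponent_mem_hilb hg e
    have hh := homogeneousComponent_isHomogeneous e g
    by_cases hlt : e < k * N
    · have h0 : homogeneousComponent e g = 0 := by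
        by_contra hne
        obtain ⟨m, hm⟩ := MvPolynomial.support_nonempty.mpr hne
        have h1 := degree_framing he hm
        have h2 := hh.degree_eq_sum_deg_support hm
        rw [← Finsupp.degree_apply, Finsupp.degree_eq_sum, Fintype.sum_sum_type] at h2
        omega
      exact ⟨0, Submodule.zero_mem _, by rw [h0, map_zero, map_zero, mul_zero]⟩
    · obtain ⟨d, rfl⟩ := Nat.exists_eq_add_of_le' (not_lt.mp hlt)
      exact exists_lift_of_isHomogeneous he hh
  choose f hf hf' using h
  refine ⟨∑ e ∈ Finset.range (g.totalDegree + 1), f e, Submodule.sum_mem _ fun e _ => hf e, ?_⟩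
  rw [map_sum, Finset.sum_congr rfl fun e _ => hf' e, ← Finset.mul_sum, ← map_sum,
    sum_homogeneousComponent]

end FirstFundamental

/-! ### Chain rule, dual numbers and row derivations. -/

lemma pderiv_aeval_general {σ τ : Type} [Fintype σ] (F : σ → MvPolynomial τ ℂ) (v : τ)
    (f : MvPolynomial σ ℂ) :
    pderiv v (aeval F f) = ∑ w, pderiv v (F w) * aeval F (pderiv w f) := by
  classical
  induction f using MvPolynomial.induction_on with
  | C a => simp
  | add p q hp hq => simp only [map_add, hp, hq, mul_add, Finset.sum_add_distrib]
  | mul_X p w hp =>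
    simp only [map_mul, aeval_X, Derivation.leibniz, smul_eq_mul, hp, map_add, mul_add,
      Finset.sum_add_distrib, pderiv_X, Finset.mul_sum]
    congr 1
    · rw [Finset.sum_eq_single w]
      · simp [mul_comm]
      · intro b _ hb
        simp [Pi.single_eq_of_ne hb.symm]
      · simp
    · exact Finset.sum_congr rfl fun _ _ => by ring

lemma pderiv_aeval_of_coordinate {σ τ : Type} [Fintype σ] [DecidableEq σ]
    (F : σ → MvPolynomial τ ℂ) (v : τ) (w₀ : σ)
    (hF : ∀ w, pderiv v (F w) = if w = w₀ then 1 else 0) (f : MvPolynomial σ ℂ) :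
    pderiv v (aeval F f) = aeval F (pderiv w₀ f) := by
  rw [pderiv_aeval_general]
  simp [hF]

section DualNumber

variable {σ : Type} {R : Type} [CommRing R] [Algebra ℂ R]

lemma fst_aeval (Φ : σ → DualNumber R) (f : MvPolynomial σ ℂ) :
    (aeval Φ f).fst = aeval (fun v => (Φ v).fst) f := by
  induction f using MvPolynomial.induction_on with
  | C a => simp [TrivSqZeroExt.algebraMap_eq_inl']
  | add p q hp hq => rw [map_add, map_add, TrivSqZeroExt.fst_add, hp, hq]
  | mul_X p w hp => rw [map_mul, map_mul, TrivSqZeroExt.fst_mul, hp, aeval_X, aeval_X]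

/-- First-order Taylor expansion; it turns group covariance into infinitesimal covariance. -/
lemma snd_aeval [Fintype σ] (Φ : σ → DualNumber R) (f : MvPolynomial σ ℂ) :
    (aeval Φ f).snd = ∑ v, (Φ v).snd * aeval (fun v => (Φ v).fst) (pderiv v f) := by
  classical
  induction f using MvPolynomial.induction_on with
  | C a => simp [TrivSqZeroExt.algebraMap_eq_inl']
  | add p q hp hq =>
    simp only [map_add, TrivSqZeroExt.snd_add, hp, hq, mul_add, Finset.sum_add_distrib]
  | mul_X p w hp =>
    simp only [map_mul, aeval_X, Derivation.leibniz, smul_eq_mul, map_add, mul_add,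
      Finset.sum_add_distrib, pderiv_X, TrivSqZeroExt.snd_mul, hp, fst_aeval,
      MulOpposite.smul_eq_mul_unop, MulOpposite.unop_op, Finset.sum_mul]
    congr 1
    · rw [Finset.sum_eq_single w]
      · simp [mul_comm]
      · intro b _ hb
        simp [Pi.single_eq_of_ne hb.symm]
      · simp
    · exact Finset.sum_congr rfl fun _ _ => by ring

end DualNumber

section RowDerivation

variable {σ : Type} {N : ℕ}

/-- The derivation `∑_l x_{q l} ∂/∂x_{p l}`. -/
def rowDer {m m' : Type} [Fintype m'] (φ : m × m' → σ) (q p : m) :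
    Derivation ℂ (MvPolynomial σ ℂ) (MvPolynomial σ ℂ) :=
  ∑ l, (X (φ (q, l)) : MvPolynomial σ ℂ) • pderiv (φ (p, l))

lemma rowDer_apply {m m' : Type} [Fintype m'] (φ : m × m' → σ) (q p : m)
    (f : MvPolynomial σ ℂ) :
    rowDer φ q p f = ∑ l, X (φ (q, l)) * pderiv (φ (p, l)) f := by
  have h := congrFun (map_sum (Derivation.coeFnAddMonoidHom (R := ℂ) (A := MvPolynomial σ ℂ)
    (M := MvPolynomial σ ℂ)) (fun l => (X (φ (q, l)) : MvPolynomial σ ℂ) • pderiv (φ (p, l)))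
    Finset.univ) f
  rw [Finset.sum_apply] at h
  exact h

lemma det_one_add_single_eps {R : Type} [CommRing R] (p q : Fin N) :
    (1 + Matrix.single p q (DualNumber.eps : DualNumber R)).det =
      1 + if p = q then DualNumber.eps else 0 := by
  have h := Matrix.det_one_add_smul (DualNumber.eps : DualNumber R)
    (Matrix.single p q (1 : DualNumber R))
  rw [Matrix.smul_single, smul_eq_mul, mul_one, pow_two, DualNumber.eps_mul_eps, mul_zero,
    add_zero] at h
  rw [h]
  split_ifs with hpq
  · subst hpq; simp
  · rw [Matrix.trace_single_eq_of_ne _ _ _ hpq, zero_mul]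

/-- The derivation is the ε-part of left multiplication by 1 + ε E_{pq}, whose determinant is 1 + ε
δ_{pq}. -/
lemma rowDer_det [Fintype σ] (φ : Fin N × Fin N → σ) (hφ : Function.Injective φ) (q p : Fin N) :
    rowDer φ q p (Matrix.of fun i j => (X (φ (i, j)) : MvPolynomial σ ℂ)).det =
      if p = q then (Matrix.of fun i j => (X (φ (i, j)) : MvPolynomial σ ℂ)).det else 0 := by
  classical
  set Z := Matrix.of fun i j => (X (φ (i, j)) : MvPolynomial σ ℂ) with hZ
  let Φ : σ → DualNumber (MvPolynomial σ ℂ) := fun v => TrivSqZeroExt.inl (X v) +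
    TrivSqZeroExt.inr (∑ l, if v = φ (p, l) then X (φ (q, l)) else 0)
  have hfst : (fun v => (Φ v).fst) = X := by
    funext v
    simp [Φ]
  have h1 : aeval Φ Z.det = (1 + if p = q then DualNumber.eps else 0) *
      TrivSqZeroExt.inl Z.det := by
    have h3 : (TrivSqZeroExt.inl Z.det : DualNumber (MvPolynomial σ ℂ)) =
        (Z.map (TrivSqZeroExt.inlHom (MvPolynomial σ ℂ) (MvPolynomial σ ℂ))).det :=
      RingHom.map_det (TrivSqZeroExt.inlHom (MvPolynomial σ ℂ) (MvPolynomial σ ℂ)) Z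
    rw [h3, ← det_one_add_single_eps, ← Matrix.det_mul, AlgHom.map_det]
    congr 1
    ext i j : 1
    simp only [AlgHom.mapMatrix_apply, Matrix.map_apply, hZ, Matrix.of_apply, aeval_X, add_mul,
      one_mul, Matrix.add_apply, Φ, hφ.eq_iff, Prod.mk.injEq]
    congr 1
    by_cases hi : i = p
    · subst hi
      simp only [true_and, Finset.sum_ite_eq, Finset.mem_univ, if_true,
        Matrix.single_mul_apply_same, Matrix.map_apply, Matrix.of_apply]
      ext <;> simp
    · simp [hi, Matrix.single_mul_apply_of_ne _ _ _ _ _ hi]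
  have h2 := congrArg TrivSqZeroExt.snd h1
  rw [snd_aeval, hfst] at h2
  simp only [aeval_X_left, AlgHom.id_apply] at h2
  rw [rowDer_apply]
  have h4 : ∀ v, (Φ v).snd = ∑ l, if v = φ (p, l) then X (φ (q, l)) else 0 := by
    intro v; simp [Φ]
  simp only [h4, Finset.sum_mul, ite_mul, zero_mul] at h2
  rw [Finset.sum_comm] at h2
  simp only [Finset.sum_ite_eq', Finset.mem_univ, if_true] at h2
  rw [h2]
  split_ifs <;> simp

end RowDerivation

/-! ### The vectors (XY - c)^s B_b f and their covariance. -/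

section ModeVector

variable {M n k : ℕ}

/-- The operator `y ↦ (X Y - c) y` on vectors of polynomials. -/
def rowOp (M n : ℕ) (c : ℂ) : (Fin M → Poly M n) →ₗ[ℂ] (Fin M → Poly M n) :=
  LinearMap.pi fun i => ∑ j, (rowDer Sum.inl i j).toLinearMap ∘ₗ LinearMap.proj j -
    c • LinearMap.proj i

lemma rowOp_apply (c : ℂ) (y : Fin M → Poly M n) (i : Fin M) :
    rowOp M n c y i = ∑ j, rowDer Sum.inl i j (y j) - c • y i := by
  simp [rowOp]

/-- The vector `(X Y - c)^s B_b f`. -/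
def modeVec (c : ℂ) (b : Fin n) (f : Poly M n) (s : ℕ) (i : Fin M) : Poly M n :=
  ((opX M n * opY M n - c • (1 : Matrix (Fin M) (Fin M) (Op M n))) ^ s * opB M n) i b f

lemma modeVec_zero (c : ℂ) (b : Fin n) (f : Poly M n) (i : Fin M) :
    modeVec c b f 0 i = pderiv (Sum.inr (b, i)) f := by
  rw [modeVec, pow_zero, Matrix.one_mul]
  rfl

lemma modeVec_succ (c : ℂ) (b : Fin n) (f : Poly M n) (s : ℕ) :
    modeVec c b f (s + 1) = rowOp M n c (modeVec c b f s) := by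
  funext i
  rw [modeVec, pow_succ', Matrix.mul_assoc, Matrix.mul_apply, rowOp_apply, LinearMap.sum_apply]
  have h : ∀ j, (opX M n * opY M n - c • (1 : Matrix (Fin M) (Fin M) (Op M n))) i j =
      (rowDer Sum.inl i j).toLinearMap - if i = j then c • LinearMap.id else 0 := by
    intro j
    rw [Matrix.sub_apply, Matrix.smul_apply, Matrix.one_apply]
    congr 1
    · refine LinearMap.ext fun g => ?_
      rw [Matrix.mul_apply, LinearMap.sum_apply]
      exact (rowDer_apply _ _ _ _).symm
    · split_ifs
      · rfl
      · rw [smul_zero]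
  simp only [h]
  have h' : ∀ j, (((rowDer Sum.inl i j).toLinearMap - if i = j then c • LinearMap.id else 0 :
      Op M n) * ((opX M n * opY M n - c • (1 : Matrix (Fin M) (Fin M) (Op M n))) ^ s *
        opB M n) j b) f =
      rowDer Sum.inl i j (modeVec c b f s j) - if i = j then c • modeVec c b f s j else 0 := by
    intro j
    rw [Module.End.mul_apply, LinearMap.sub_apply]
    congr 1
    split_ifs <;> rfl
  rw [Finset.sum_congr rfl fun j _ => h' j, Finset.sum_sub_distrib]
  simp

lemma mode_apply (c : ℂ) (s : ℕ) (a b : Fin n) (f : Poly M n) :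
    mode M n c s a b f = ∑ i, X (Sum.inr (a, i)) * modeVec c b f s i := by
  rw [mode, Matrix.mul_assoc, Matrix.mul_apply, LinearMap.sum_apply]
  rfl

/-- In (XY - c)^s B_b the conjugations telescope and leave one h on the free index: the vector
transforms by the standard representation times det(h)^{-k}. -/
lemma gaugeAct_modeVec (c : ℂ) (b : Fin n) {f : Poly M n} (hf : f ∈ hilb M n k) (s : ℕ)
    (h : GL (Fin M) ℂ) (i : Fin M) :
    gaugeAct h (modeVec c b f s i) = ((h : Matrix (Fin M) (Fin M) ℂ).det ^ k)⁻¹ •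
      ∑ l, h.1 i l • modeVec c b f s l := by
  have hXY := (((rel_opX (n := n) h).mul (rel_opY h)).sub
    (Rel.smul_one (gaugeAct h).toLinearMap c)).pow s
  have hall := hXY.mul (rel_opB h)
  have e : scal M n h.1 * opX M n * scal M n h⁻¹.1 * (scal M n h.1 * opY M n * scal M n h⁻¹.1) -
      c • (1 : Matrix (Fin M) (Fin M) (Op M n)) =
      scal M n h.1 * (opX M n * opY M n - c • (1 : Matrix (Fin M) (Fin M) (Op M n))) *
        scal M n h⁻¹.1 := by
    rw [mul_sub, sub_mul, mul_smul_comm, smul_mul_assoc, mul_one, scal_mul_inv]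
    congr 1
    calc _ = scal M n h.1 * opX M n * (scal M n h⁻¹.1 * scal M n h.1) * opY M n *
          scal M n h⁻¹.1 := by simp only [mul_assoc]
      _ = _ := by rw [scal_inv_mul, mul_one]; simp only [mul_assoc]
  have e2 : scal M n h.1 * (opX M n * opY M n - c • (1 : Matrix (Fin M) (Fin M) (Op M n))) ^ s *
      scal M n h⁻¹.1 * (scal M n h.1 * opB M n) = scal M n h.1 *
        ((opX M n * opY M n - c • (1 : Matrix (Fin M) (Fin M) (Op M n))) ^ s * opB M n) := by
    rw [Matrix.mul_assoc _ (scal M n h⁻¹.1), ← Matrix.mul_assoc (scal M n h⁻¹.1), scal_inv_mul,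
      Matrix.one_mul, Matrix.mul_assoc]
  rw [e, conj_pow_aux, e2] at hall
  have h1 := LinearMap.congr_fun (hall i b) f
  have h2 : gaugeAct h (modeVec c b f s i) = ∑ l, h.1 i l • (((opX M n * opY M n -
      c • (1 : Matrix (Fin M) (Fin M) (Op M n))) ^ s * opB M n) l b (gaugeAct h f)) := by
    refine h1.trans ?_
    rw [Matrix.mul_apply, Finset.sum_mul, LinearMap.sum_apply]
    exact Finset.sum_congr rfl fun l _ => by
      rw [scal_apply, mul_assoc, ← Algebra.smul_def]
      rfl
  rw [h2, hf h, Finset.smul_sum]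
  refine Finset.sum_congr rfl fun l _ => ?_
  rw [map_smul, smul_comm]
  rfl

/-- The infinitesimal form of the covariance of `(X Y - c)^s B_b f`. -/
lemma rowDer_modeVec (c : ℂ) (b : Fin n) {f : Poly M n} (hf : f ∈ hilb M n k) (s : ℕ)
    {p q : Fin M} (hpq : p ≠ q) :
    rowDer Sum.inl q p (modeVec c b f s p) = modeVec c b f s q +
      ((∑ l, X (Sum.inl (l, p)) * pderiv (Sum.inl (l, q)) (modeVec c b f s p)) +
        ∑ a, X (Sum.inr (a, p)) * pderiv (Sum.inr (a, q)) (modeVec c b f s p)) := by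
  classical
  let ι : Poly M n → DualNumber (Poly M n) := TrivSqZeroExt.inl
  let H : Matrix (Fin M) (Fin M) (DualNumber (Poly M n)) :=
    1 + Matrix.single p q DualNumber.eps
  let X₀ : Matrix (Fin M) (Fin M) (DualNumber (Poly M n)) := (coordX M n).map ι
  let A₀ : Matrix (Fin n) (Fin M) (DualNumber (Poly M n)) := (coordA M n).map ι
  -- Covariance in the standard representation for H = 1 + ε E_{pq}: row p of X gains ε times row q
  -- on the left, column q of X and of A gains ε times column p on the right. Since p ≠ q, det H =
  -- 1.
  have key := covariant_identity (k := k) (modeVec c b f s) (fun i l => X (i, l))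
    (fun h i => by simpa using gaugeAct_modeVec c b hf s h i) H X₀ A₀ p
  have hdet : H.det = 1 := by
    have := det_one_add_single_eps (R := Poly M n) p q
    rwa [if_neg hpq, add_zero] at this
  rw [hdet, one_pow, mul_one] at key
  simp only [aeval_X] at key
  have hH : ∀ i j, H i j = (if i = j then 1 else 0) + if i = p ∧ j = q then DualNumber.eps else 0 := by
    intro i j
    simp [H, Matrix.one_apply, Matrix.single_apply, eq_comm]
  have hHX : ∀ i j, (H * X₀) i j = TrivSqZeroExt.inl (X (Sum.inl (i, j))) +
      TrivSqZeroExt.inr (if i = p then X (Sum.inl (q, j)) else 0) := by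
    intro i j
    by_cases hi : i = p
    · subst hi
      ext <;> simp [H, X₀, ι, add_mul, coordX]
    · ext <;> simp [H, X₀, ι, add_mul, coordX, hi]
  have hXH : ∀ i j, (X₀ * H) i j = TrivSqZeroExt.inl (X (Sum.inl (i, j))) +
      TrivSqZeroExt.inr (if j = q then X (Sum.inl (i, p)) else 0) := by
    intro i j
    by_cases hj : j = q
    · subst hj
      ext <;> simp [H, X₀, ι, mul_add, coordX]
    · ext <;> simp [H, X₀, ι, mul_add, coordX, hj]
  have hAH : ∀ i j, (A₀ * H) i j = TrivSqZeroExt.inl (X (Sum.inr (i, j))) +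
      TrivSqZeroExt.inr (if j = q then X (Sum.inr (i, p)) else 0) := by
    intro i j
    by_cases hj : j = q
    · subst hj
      ext <;> simp [H, A₀, ι, Matrix.mul_add, coordA]
    · ext <;> simp [H, A₀, ι, Matrix.mul_add, coordA, hj]
  have hXid : ∀ g : Poly M n, aeval X g = g := fun g => by simp
  have hL : (evalAt (H * X₀) A₀ (modeVec c b f s p)).snd =
      rowDer Sum.inl q p (modeVec c b f s p) := by
    rw [evalAt, snd_aeval]
    have hfst : (fun v => (Sum.elim (fun ij : Fin M × Fin M => (H * X₀) ij.1 ij.2)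
        (fun ai : Fin n × Fin M => A₀ ai.1 ai.2) v).fst) = X := by
      funext v
      rcases v with ⟨i, j⟩ | ⟨a, i⟩
      · simp only [Sum.elim_inl, hHX, TrivSqZeroExt.fst_add, TrivSqZeroExt.fst_inl,
          TrivSqZeroExt.fst_inr, add_zero]
      · simp [A₀, ι, coordA]
    rw [hfst, Fintype.sum_sum_type, Fintype.sum_prod_type, rowDer_apply]
    simp only [Sum.elim_inl, Sum.elim_inr, hHX, hXid]
    rw [Finset.sum_eq_single p]
    · simp [A₀, ι]
    · intro i _ hi
      simp [hi]
    · simp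
  have hR : ∀ v : Poly M n, (evalAt (X₀ * H) (A₀ * H) v).fst = v ∧
      (evalAt (X₀ * H) (A₀ * H) v).snd =
      (∑ l, X (Sum.inl (l, p)) * pderiv (Sum.inl (l, q)) v) +
        ∑ a, X (Sum.inr (a, p)) * pderiv (Sum.inr (a, q)) v := by
    intro v
    have hfst : (fun v => (Sum.elim (fun ij : Fin M × Fin M => (X₀ * H) ij.1 ij.2)
        (fun ai : Fin n × Fin M => (A₀ * H) ai.1 ai.2) v).fst) = X := by
      funext v
      rcases v with ⟨i, j⟩ | ⟨a, i⟩
      · simp only [Sum.elim_inl, hXH, TrivSqZeroExt.fst_add, TrivSqZeroExt.fst_inl,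
          TrivSqZeroExt.fst_inr, add_zero]
      · simp only [Sum.elim_inr, hAH, TrivSqZeroExt.fst_add, TrivSqZeroExt.fst_inl,
          TrivSqZeroExt.fst_inr, add_zero]
    refine ⟨by rw [evalAt, fst_aeval, hfst, hXid], ?_⟩
    rw [evalAt, snd_aeval, hfst, Fintype.sum_sum_type, Fintype.sum_prod_type,
      Fintype.sum_prod_type]
    simp only [Sum.elim_inl, Sum.elim_inr, hXH, hAH, hXid, TrivSqZeroExt.snd_add,
      TrivSqZeroExt.snd_inl, TrivSqZeroExt.snd_inr, zero_add, ite_mul, zero_mul,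
      Finset.sum_ite_eq', Finset.mem_univ, if_true]
  have hk := congrArg TrivSqZeroExt.snd key
  rw [hL] at hk
  rw [hk, TrivSqZeroExt.snd_sum]
  simp only [hH, add_mul, TrivSqZeroExt.snd_add, Finset.sum_add_distrib, true_and, ite_mul,
    one_mul, zero_mul]
  rw [← TrivSqZeroExt.snd_sum, ← TrivSqZeroExt.snd_sum, Finset.sum_ite_eq, Finset.sum_ite_eq',
    if_pos (Finset.mem_univ _), if_pos (Finset.mem_univ _), (hR _).2, add_comm]
  congr 1
  rw [TrivSqZeroExt.snd_mul, (hR _).1]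
  simp

end ModeVector

/-! ### Differentiation along the slice. -/

section Restriction

variable {N n k : ℕ}

lemma auxRestrict_X₁₁ (i j : Fin N) :
    auxRestrict N n (X (Sum.inl (Fin.castAdd n i, Fin.castAdd n j))) =
      X (Sum.inl (Sum.inl (i, j))) := by simp [auxRestrict]

lemma auxRestrict_X₂ (i : Fin n) (j : Fin (N + n)) :
    auxRestrict N n (X (Sum.inl (Fin.natAdd N i, j))) = 0 := by simp [auxRestrict]

lemma auxRestrict_X₃ (i : Fin (N + n)) (j : Fin n) :
    auxRestrict N n (X (Sum.inl (i, Fin.natAdd N j))) = 0 := by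
  refine Fin.addCases (fun i => ?_) (fun i => ?_) i <;> simp [auxRestrict]

lemma auxRestrict_A (a : Fin n) (i : Fin N) :
    auxRestrict N n (X (Sum.inr (a, Fin.castAdd n i))) = X (Sum.inl (Sum.inr (a, i))) := by
  simp [auxRestrict]

lemma auxRestrict_eta (a l : Fin n) :
    auxRestrict N n (X (Sum.inr (a, Fin.natAdd N l))) = X (Sum.inr (a, l)) := by
  simp [auxRestrict]

lemma castAdd_ne_natAdd (i : Fin N) (l : Fin n) : Fin.castAdd n i ≠ Fin.natAdd N l := by
  intro h
  have := congrArg Fin.val h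
  simp only [Fin.val_castAdd, Fin.val_natAdd] at this
  have := i.2
  omega

lemma natAdd_ne_castAdd (i : Fin N) (l : Fin n) : Fin.natAdd N l ≠ Fin.castAdd n i :=
  (castAdd_ne_natAdd i l).symm

/-- The coordinate of `(X ⊕ 0, (A, η))`-space as a coordinate of the ambient space. -/
def ambient : Coord N n ⊕ (Fin n × Fin n) → Coord (N + n) n :=
  Sum.elim (Sum.elim (fun v => Sum.inl (Fin.castAdd n v.1, Fin.castAdd n v.2))
    (fun v => Sum.inr (v.1, Fin.castAdd n v.2))) (fun v => Sum.inr (v.1, Fin.natAdd N v.2))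

lemma pderiv_auxRestrict (v : Coord N n ⊕ (Fin n × Fin n)) (f : Poly (N + n) n) :
    pderiv v (auxRestrict N n f) = auxRestrict N n (pderiv (ambient v) f) := by
  classical
  refine pderiv_aeval_of_coordinate _ _ _ (fun w => ?_) f
  rcases w with ⟨i, j⟩ | ⟨a, i⟩
  · refine Fin.addCases (fun i => ?_) (fun i => ?_) i <;>
    refine Fin.addCases (fun j => ?_) (fun j => ?_) j <;>
    rcases v with (⟨i', j'⟩ | ⟨a', i'⟩) | ⟨a', l'⟩ <;>
    simp [ambient, pderiv_X, Pi.single_apply, natAdd_ne_castAdd]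
  · refine Fin.addCases (fun i => ?_) (fun i => ?_) i <;>
    rcases v with (⟨i', j'⟩ | ⟨a', i'⟩) | ⟨a', l'⟩ <;>
    simp [ambient, pderiv_X, Pi.single_apply, castAdd_ne_natAdd, natAdd_ne_castAdd]

lemma pderiv_auxIncl (v : Coord N n) (f : Poly N n) :
    pderiv (Sum.inl v) (auxIncl N n f) = auxIncl N n (pderiv v f) := by
  classical
  rw [auxIncl, rename_eq_aeval]
  exact pderiv_aeval_of_coordinate (fun w => (X (Sum.inl w) : AuxPoly N n)) _ _ (fun w => by
    simp [pderiv_X, Pi.single_apply]) f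

lemma pderiv_inr_auxIncl (v : Fin n × Fin n) (f : Poly N n) :
    pderiv (Sum.inr v) (auxIncl N n f) = 0 := by
  classical
  have : auxIncl N n f = aeval (fun w => (X (Sum.inl w) : AuxPoly N n)) f := by
    rw [auxIncl, rename_eq_aeval]
    rfl
  rw [this, pderiv_aeval_general]
  simp [pderiv_X]

lemma rowDer_auxIncl (j i : Fin N) (f : Poly N n) :
    rowDer (fun v => Sum.inl (Sum.inl v)) j i (auxIncl N n f) =
      auxIncl N n (rowDer Sum.inl j i f) := by
  rw [rowDer_apply, rowDer_apply, map_sum]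
  refine Finset.sum_congr rfl fun l _ => ?_
  rw [pderiv_auxIncl, map_mul]
  congr 1
  simp [auxIncl]

lemma rowDer_detX (j i : Fin N) :
    rowDer (fun v => Sum.inl (Sum.inl v)) j i (detX N n) = if i = j then detX N n else 0 :=
  rowDer_det _ (Sum.inl_injective.comp Sum.inl_injective) j i

lemma rowDer_detEta (a b : Fin n) :
    rowDer Sum.inr a b (detEta N n) = if b = a then detEta N n else 0 :=
  rowDer_det _ Sum.inr_injective a b

lemma pderiv_inl_detEta (v : Coord N n) : pderiv (Sum.inl v) (detEta N n) = 0 := by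
  classical
  have : detEta N n = aeval (fun w => (X (Sum.inr w) : AuxPoly N n))
      (Matrix.of fun a l : Fin n => (X (a, l) : MvPolynomial (Fin n × Fin n) ℂ)).det := by
    rw [AlgHom.map_det, detEta]
    congr 1
    ext i j
    simp
  rw [this, pderiv_aeval_general]
  simp [pderiv_X]

lemma pderiv_inr_detX (v : Fin n × Fin n) : pderiv (Sum.inr v) (detX N n) = 0 := by
  rw [detX_eq_auxIncl, pderiv_inr_auxIncl]

lemma derivation_pow_of_scale {σ : Type} (δ : Derivation ℂ (MvPolynomial σ ℂ) (MvPolynomial σ ℂ))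
    {x c : MvPolynomial σ ℂ} (h : δ x = c * x) (k : ℕ) : δ (x ^ k) = (k : ℂ) • (c * x ^ k) := by
  rw [Derivation.leibniz_pow, h]
  obtain _ | k := k
  · simp
  · rw [Nat.add_sub_cancel, pow_succ, smul_eq_mul, Nat.cast_smul_eq_nsmul]
    congr 1
    ring

/-- Conjugating XY by det(X)^k adds k to its diagonal. -/
lemma rowDer_detMul (j i : Fin N) (y : Poly N n) :
    rowDer (fun v => Sum.inl (Sum.inl v)) j i (detMul N n k y) =
      detMul N n k (rowDer Sum.inl j i y + if i = j then (k : ℂ) • y else 0) := by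
  have h1 : rowDer (fun v => Sum.inl (Sum.inl v)) j i (detX N n) =
      (if i = j then 1 else 0) * detX N n := by
    rw [rowDer_detX]
    split_ifs <;> simp
  have h2 : rowDer (fun v => Sum.inl (Sum.inl v)) j i (detEta N n) = 0 * detEta N n := by
    rw [rowDer_apply, zero_mul]
    exact Finset.sum_eq_zero fun l _ => by rw [pderiv_inl_detEta, mul_zero]
  change rowDer _ j i (detX N n ^ k * detEta N n ^ k * auxIncl N n y) =
    detX N n ^ k * detEta N n ^ k * auxIncl N n _
  rw [Derivation.leibniz, Derivation.leibniz, derivation_pow_of_scale _ h1,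
    derivation_pow_of_scale _ h2, rowDer_auxIncl, map_add]
  simp only [smul_eq_mul]
  split_ifs
  · rw [map_smul]
    simp only [Algebra.smul_def]
    ring
  · rw [map_zero]
    simp only [Algebra.smul_def]
    ring

lemma pderiv_framing_detMul (v : Fin n × Fin N) (y : Poly N n) :
    pderiv (Sum.inl (Sum.inr v)) (detMul N n k y) = detMul N n k (pderiv (Sum.inr v) y) := by
  have h1 : pderiv (Sum.inl (Sum.inr v)) (detX N n) = 0 := by
    have : detX N n = aeval (fun w => (X (Sum.inl (Sum.inl w)) : AuxPoly N n))
        (Matrix.of fun a l : Fin N => (X (a, l) : MvPolynomial (Fin N × Fin N) ℂ)).det := by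
      rw [AlgHom.map_det, detX]
      congr 1
      ext i j
      simp
    classical
    rw [this, pderiv_aeval_general]
    simp [pderiv_X]
  change pderiv _ (detX N n ^ k * detEta N n ^ k * auxIncl N n y) =
    detX N n ^ k * detEta N n ^ k * auxIncl N n _
  rw [Derivation.leibniz, Derivation.leibniz, Derivation.leibniz_pow, Derivation.leibniz_pow, h1,
    pderiv_inl_detEta, pderiv_auxIncl]
  simp

lemma rowDer_eta_detMul (a b : Fin n) (y : Poly N n) :
    rowDer Sum.inr a b (detMul N n k y) = if b = a then (k : ℂ) • detMul N n k y else 0 := by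
  have h1 : rowDer Sum.inr a b (detEta N n) = (if b = a then 1 else 0) * detEta N n := by
    rw [rowDer_detEta]
    split_ifs <;> simp
  have h2 : rowDer Sum.inr a b (detX N n) = 0 * detX N n := by
    rw [rowDer_apply, zero_mul]
    exact Finset.sum_eq_zero fun l _ => by rw [pderiv_inr_detX, mul_zero]
  have h3 : rowDer Sum.inr a b (auxIncl N n y) = 0 := by
    rw [rowDer_apply]
    exact Finset.sum_eq_zero fun l _ => by rw [pderiv_inr_auxIncl, mul_zero]
  change rowDer _ a b (detX N n ^ k * detEta N n ^ k * auxIncl N n y) =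
    if b = a then (k : ℂ) • (detX N n ^ k * detEta N n ^ k * auxIncl N n y) else 0
  rw [Derivation.leibniz, Derivation.leibniz, derivation_pow_of_scale _ h1,
    derivation_pow_of_scale _ h2, h3]
  simp only [smul_eq_mul]
  split_ifs
  · simp only [Algebra.smul_def]
    ring
  · simp

end Restriction

/-! ### Restriction of the modes to the slice. -/

section Intertwining

variable {N n k : ℕ}

/-- The last n rows of X vanish on the slice, so there XY contributes nothing to these components
and only the scalar -c survives each step. -/
lemma auxRestrict_modeVec_natAdd (c : ℂ) (b : Fin n) (f : Poly (N + n) n) (s : ℕ) (m : Fin n) :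
    auxRestrict N n (modeVec c b f s (Fin.natAdd N m)) =
      (-c) ^ s • pderiv (Sum.inr (b, m)) (auxRestrict N n f) := by
  induction s with
  | zero => rw [modeVec_zero, pow_zero, one_smul, pderiv_auxRestrict]; rfl
  | succ s ih =>
    rw [modeVec_succ, rowOp_apply, map_sub, map_sum, map_smul, ih]
    have h : ∀ j, auxRestrict N n (rowDer Sum.inl (Fin.natAdd N m) j (modeVec c b f s j)) = 0 := by
      intro j
      rw [rowDer_apply, map_sum]
      exact Finset.sum_eq_zero fun l _ => by rw [map_mul, auxRestrict_X₂, zero_mul]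
    simp only [h, Finset.sum_const_zero, zero_sub, smul_smul, pow_succ, mul_neg, neg_smul]
    rw [mul_comm]

/-- Contracting the last components with η assembles η ∂/∂η, which acts on det(η)^k by k δ. -/
lemma sum_eta_modeVec (c : ℂ) (a b : Fin n) {f : Poly (N + n) n} {g : Poly N n}
    (hg : auxRestrict N n f = detMul N n k g) (s : ℕ) :
    ∑ m, X (Sum.inr (a, m)) * auxRestrict N n (modeVec c b f s (Fin.natAdd N m)) =
      (-c) ^ s • if b = a then (k : ℂ) • detMul N n k g else 0 := by
  rw [← rowDer_eta_detMul, rowDer_apply, Finset.smul_sum, ← hg]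
  refine Finset.sum_congr rfl fun m _ => ?_
  rw [auxRestrict_modeVec_natAdd, mul_smul_comm]

lemma auxRestrict_modeVec_succ (c : ℂ) (b : Fin n) {f : Poly (N + n) n}
    (hf : f ∈ hilb (N + n) n k) {g : Poly N n} (hg : auxRestrict N n f = detMul N n k g)
    (s : ℕ) (j : Fin N) :
    auxRestrict N n (modeVec c b f (s + 1) (Fin.castAdd n j)) =
      ∑ i, rowDer (fun v => Sum.inl (Sum.inl v)) j i
        (auxRestrict N n (modeVec c b f s (Fin.castAdd n i))) +
      ((n : ℂ) - c) • auxRestrict N n (modeVec c b f s (Fin.castAdd n j)) +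
      ((-c) ^ s * k) • detMul N n k (pderiv (Sum.inr (b, j)) g) := by
  rw [modeVec_succ, rowOp_apply, map_sub, map_sum, map_smul, Fin.sum_univ_add]
  have h1 : ∀ i, auxRestrict N n (rowDer Sum.inl (Fin.castAdd n j) (Fin.castAdd n i)
      (modeVec c b f s (Fin.castAdd n i))) = rowDer (fun v => Sum.inl (Sum.inl v)) j i
        (auxRestrict N n (modeVec c b f s (Fin.castAdd n i))) := by
    intro i
    rw [rowDer_apply, rowDer_apply, map_sum, Fin.sum_univ_add]
    simp only [map_mul, auxRestrict_X₁₁, auxRestrict_X₃, zero_mul, Finset.sum_const_zero, add_zero,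
      pderiv_auxRestrict]
    rfl
  -- Here XY differentiates transversally, in row N + m of X. `rowDer_modeVec` trades this for a
  -- copy of component j, terms in column N + m of X that vanish on the slice, and tangential
  -- derivatives in A. The n values of m produce the shift by n.
  have h2 : ∀ m, auxRestrict N n (rowDer Sum.inl (Fin.castAdd n j) (Fin.natAdd N m)
      (modeVec c b f s (Fin.natAdd N m))) =
      auxRestrict N n (modeVec c b f s (Fin.castAdd n j)) +
        ∑ a, pderiv (Sum.inl (Sum.inr (a, j))) (X (Sum.inr (a, m)) *
          auxRestrict N n (modeVec c b f s (Fin.natAdd N m))) := by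
    intro m
    rw [rowDer_modeVec c b hf s (natAdd_ne_castAdd j m), map_add, map_add, map_sum, map_sum]
    simp only [map_mul, auxRestrict_X₃, zero_mul, Finset.sum_const_zero, zero_add,
      auxRestrict_eta]
    congr 1
    refine Finset.sum_congr rfl fun a _ => ?_
    rw [Derivation.leibniz, pderiv_X_of_ne (by simp), smul_zero, add_zero, pderiv_auxRestrict]
    rfl
  have h3 : ∑ m, ∑ a, pderiv (Sum.inl (Sum.inr (a, j))) (X (Sum.inr (a, m)) *
          auxRestrict N n (modeVec c b f s (Fin.natAdd N m))) =
      ((-c) ^ s * k) • detMul N n k (pderiv (Sum.inr (b, j)) g) := by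
    rw [Finset.sum_comm]
    simp only [← map_sum, sum_eta_modeVec c _ b hg]
    rw [Finset.sum_eq_single b]
    · rw [if_pos rfl, Derivation.map_smul, Derivation.map_smul, pderiv_framing_detMul, smul_smul]
    · intro a _ ha
      rw [if_neg ha.symm, smul_zero, map_zero]
    · simp
  simp only [h1, h2, Finset.sum_add_distrib, h3, Finset.sum_const, Finset.card_univ,
    Fintype.card_fin]
  rw [← Nat.cast_smul_eq_nsmul ℂ, sub_smul]
  abel

/-- The vectors `∑_{t < s} (-c')^{s-1-t} v_t`. -/
def convVec {V : Type*} [AddCommGroup V] [Module ℂ V] (c' : ℂ) (v : ℕ → V) : ℕ → V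
  | 0 => 0
  | s + 1 => -(c' • convVec c' v s) + v s

/-- Commutes w past the convolution, which shifts the summation index; the missing t = 0 term is the
one added on the left. -/
lemma convVec_shift {V : Type*} [AddCommGroup V] [Module ℂ V] (c' : ℂ) (v : ℕ → V)
    (w : V →ₗ[ℂ] V) (hv : ∀ s, v (s + 1) = w (v s)) (s : ℕ) :
    w (convVec c' v s) + (-c') ^ s • v 0 = convVec c' v (s + 1) := by
  induction s with
  | zero => simp [convVec]
  | succ s ih =>
    conv_rhs => rw [convVec, ← ih]
    conv_lhs => rw [convVec, map_add, ← hv, map_neg, map_smul, pow_succ]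
    module

/-- On the slice XY becomes XY + k + n, so subtracting c' = c + k + n leaves XY - c. The
inhomogeneous terms of `auxRestrict_modeVec_succ` accumulate into the convolution. -/
lemma auxRestrict_modeVec_castAdd {c c' : ℂ} (hc : c' = c + k + n) (b : Fin n)
    {f : Poly (N + n) n} (hf : f ∈ hilb (N + n) n k) {g : Poly N n}
    (hg : auxRestrict N n f = detMul N n k g) (s : ℕ) (j : Fin N) :
    auxRestrict N n (modeVec c' b f s (Fin.castAdd n j)) =
      detMul N n k ((modeVec c b g s + (k : ℂ) • convVec c' (modeVec c b g) s) j) := by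
  induction s generalizing j with
  | zero =>
    rw [modeVec_zero, convVec, smul_zero, add_zero, modeVec_zero, ← pderiv_framing_detMul, ← hg,
      pderiv_auxRestrict]
    rfl
  | succ s ih =>
    rw [auxRestrict_modeVec_succ c' b hf hg]
    simp only [ih, rowDer_detMul]
    set y := modeVec c b g s + (k : ℂ) • convVec c' (modeVec c b g) s with hy
    have h1 : modeVec c b g (s + 1) + (k : ℂ) • convVec c' (modeVec c b g) (s + 1) =
        rowOp N n c y + ((-c') ^ s * (k : ℂ)) • modeVec c b g 0 := by
      rw [← convVec_shift c' (modeVec c b g) (rowOp N n c) (modeVec_succ c b g), modeVec_succ, hy,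
        map_add, map_smul, smul_add, smul_smul, mul_comm (k : ℂ), add_assoc]
    rw [h1, ← map_sum, ← map_smul, ← map_smul, ← map_add, ← map_add, Pi.add_apply, Pi.smul_apply,
      modeVec_zero, rowOp_apply, Finset.sum_add_distrib, Finset.sum_ite_eq',
      if_pos (Finset.mem_univ _), hc]
    congr 2
    module

/-- The transition map on the modes. -/
lemma auxRestrict_mode {c c' : ℂ} (hc : c' = c + k + n) (a b : Fin n)
    {f : Poly (N + n) n} (hf : f ∈ hilb (N + n) n k) {g : Poly N n}
    (hg : auxRestrict N n f = detMul N n k g) (s : ℕ) :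
    auxRestrict N n (mode (N + n) n c' s a b f) =
      detMul N n k (mode N n c s a b g +
        (k : ℂ) • convVec c' (fun t => mode N n c t a b g) s +
        ((-c') ^ s * if b = a then (k : ℂ) else 0) • g) := by
  have hconv : ∀ s, convVec c' (fun t => mode N n c t a b g) s =
      ∑ i, X (Sum.inr (a, i)) * convVec c' (modeVec c b g) s i := by
    intro s
    induction s with
    | zero => simp [convVec]
    | succ s ih =>
      rw [convVec, ih, mode_apply, convVec, Finset.smul_sum, ← Finset.sum_neg_distrib,
        ← Finset.sum_add_distrib]
      refine Finset.sum_congr rfl fun i _ => ?_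
      rw [Pi.add_apply, Pi.neg_apply, Pi.smul_apply, mul_add, mul_neg, mul_smul_comm]
  rw [mode_apply, map_sum, Fin.sum_univ_add]
  simp only [map_mul, auxRestrict_A, auxRestrict_eta, sum_eta_modeVec c' a b hg]
  simp only [auxRestrict_modeVec_castAdd hc b hf hg]
  rw [map_add (detMul N n k), map_smul (detMul N n k) _ g]
  congr 1
  · rw [hconv, mode_apply, Finset.smul_sum, ← Finset.sum_add_distrib, map_sum]
    refine Finset.sum_congr rfl fun i _ => ?_
    rw [Pi.add_apply, Pi.smul_apply, ← mul_smul_comm, ← mul_add]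
    change _ * (_ * _) = _ * auxIncl N n (_ * _)
    rw [map_mul, mul_left_comm]
    congr 2
    simp [auxIncl]
  · split_ifs
    · rw [smul_smul]
    · simp

variable {p : hilb (N + n) n k →ₗ[ℂ] hilb N n k}

lemma IsTransitionMap.coe_hilbMode (hp : IsTransitionMap N n k p) {c c' : ℂ}
    (hc : c' = c + k + n) (a b : Fin n) (s : ℕ) (f : hilb (N + n) n k) :
    p (hilbMode (N + n) n k c' s a b f) = hilbMode N n k c s a b (p f) +
        (k : ℂ) • convVec c' (fun t => hilbMode N n k c t a b (p f)) s +
        ((-c') ^ s * if b = a then (k : ℂ) else 0) • p f := by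
  apply Subtype.ext
  apply detMul_injective (k := k)
  rw [hp.detMul_apply]
  have h := auxRestrict_mode hc a b f.2 (hp.detMul_apply f).symm s
  refine h.trans ?_
  have hconv : ∀ s, convVec c' (fun t => mode N n c t a b (p f)) s =
      ((convVec c' (fun t => hilbMode N n k c t a b (p f)) s : hilb N n k) : Poly N n) := by
    intro s
    induction s with
    | zero => rfl
    | succ s ih => rw [convVec, ih]; rfl
  rw [hconv]
  rfl

lemma IsTransitionMap.hilbMode_zero (hp : IsTransitionMap N n k p) {c c' : ℂ}
    (hc : c' = c + k + n) (a b : Fin n) :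
    p ∘ₗ hilbMode (N + n) n k c' 0 a b =
      hilbMode N n k c 0 a b ∘ₗ p + (if a = b then (k : ℂ) else 0) • p := by
  refine LinearMap.ext fun f => ?_
  simp only [LinearMap.comp_apply, hp.coe_hilbMode hc, convVec, smul_zero, add_zero, pow_zero,
    one_mul, LinearMap.add_apply, LinearMap.smul_apply, eq_comm]

/-- At the level of series this is multiplication by u + c', which clears the geometric convolution
and the δ term, leaving (u + c') times the upper modes against (u + c' + k) times the lower ones. -/
lemma IsTransitionMap.hilbMode_succ (hp : IsTransitionMap N n k p) {c c' : ℂ}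
    (hc : c' = c + k + n) (a b : Fin n) (s : ℕ) :
    p ∘ₗ hilbMode (N + n) n k c' (s + 1) a b + c' • (p ∘ₗ hilbMode (N + n) n k c' s a b) =
      hilbMode N n k c (s + 1) a b ∘ₗ p + (c' + k) • (hilbMode N n k c s a b ∘ₗ p) := by
  refine LinearMap.ext fun f => ?_
  simp only [LinearMap.comp_apply, hp.coe_hilbMode hc, convVec, LinearMap.add_apply,
    LinearMap.smul_apply, pow_succ]
  module

end Intertwining

/-! ### Cancellation of the scalar factor and intertwining of the normalised series. -/

section Series

variable {V : Type*} [AddCommGroup V] [Module ℂ V]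

/-- The recursion says (1 + αx) t'(x) = (1 + βx) t(x). Pairing with linear functionals reduces it to
scalar power series, where 1 + βx is invertible. -/
lemma sum_coeff_smul_eq_of_recursion {t t' : ℕ → V} {α β : ℂ} (S : PowerSeries ℂ)
    (h0 : t' 0 = t 0) (hs : ∀ i, t' (i + 1) + α • t' i = t (i + 1) + β • t i) (m : ℕ) :
    ∑ x ∈ Finset.HasAntidiagonal.antidiagonal m,
      PowerSeries.coeff x.2 (S * ((1 + PowerSeries.C α * PowerSeries.X) *
        (1 + PowerSeries.C β * PowerSeries.X)⁻¹)) • t' x.1 =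
      ∑ x ∈ Finset.HasAntidiagonal.antidiagonal m, PowerSeries.coeff x.2 S • t x.1 := by
  rw [← sub_eq_zero, ← Module.forall_dual_apply_eq_zero_iff ℂ]
  intro φ
  rw [map_sub, sub_eq_zero]
  simp only [map_sum, map_smul, smul_eq_mul]
  have key : ∀ (τ : ℕ → V) (R : PowerSeries ℂ), ∑ x ∈ Finset.HasAntidiagonal.antidiagonal m,
      PowerSeries.coeff x.2 R * φ (τ x.1) =
      PowerSeries.coeff m (PowerSeries.mk (fun i => φ (τ i)) * R) := by
    intro τ R
    rw [PowerSeries.coeff_mul]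
    exact Finset.sum_congr rfl fun x _ => by rw [PowerSeries.coeff_mk, mul_comm]
  rw [key, key]
  congr 1
  have h1 : (1 + PowerSeries.C α * PowerSeries.X) * PowerSeries.mk (fun i => φ (t' i)) =
      (1 + PowerSeries.C β * PowerSeries.X) * PowerSeries.mk (fun i => φ (t i)) := by
    ext i
    rcases i with _ | i
    · simp [h0, add_mul, mul_assoc]
    · have := congrArg φ (hs i)
      simpa [add_mul, mul_assoc, PowerSeries.coeff_succ_X_mul, PowerSeries.coeff_C_mul] using this
  have h2 : (1 + PowerSeries.C β * PowerSeries.X) *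
      (1 + PowerSeries.C β * PowerSeries.X)⁻¹ = 1 := PowerSeries.mul_inv_cancel _ (by simp)
  calc _ = ((1 + PowerSeries.C α * PowerSeries.X) * PowerSeries.mk (fun i => φ (t' i))) * S *
        (1 + PowerSeries.C β * PowerSeries.X)⁻¹ := by ring
    _ = ((1 + PowerSeries.C β * PowerSeries.X) * (1 + PowerSeries.C β * PowerSeries.X)⁻¹) *
        (PowerSeries.mk (fun i => φ (t i)) * S) := by rw [h1]; ring
    _ = _ := by rw [h2, one_mul]

end Series

section Coefficients

variable {N n k : ℕ}

lemma coeff_zero_shiftedT (a b : Fin n) :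
    PowerSeries.coeff 0 (shiftedT N n k a b) = if a = b then 1 else 0 := by
  simp [shiftedT]

lemma coeff_succ_shiftedT (a b : Fin n) (s : ℕ) :
    PowerSeries.coeff (s + 1) (shiftedT N n k a b) =
      hilbMode N n k (((k + n) * (N / n) : ℕ) : ℂ) s a b := by
  rw [shiftedT, map_add, PowerSeries.coeff_succ_X_mul, PowerSeries.coeff_mk, PowerSeries.coeff_C,
    if_neg (Nat.succ_ne_zero s), zero_add]

lemma coeff_tildeT (a b : Fin n) (m : ℕ) :
    PowerSeries.coeff m (tildeT N n k a b) = ∑ x ∈ Finset.HasAntidiagonal.antidiagonal m,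
      PowerSeries.coeff x.2 (normFactor n k (N / n)) •
        PowerSeries.coeff x.1 (shiftedT N n k a b) := by
  rw [tildeT, PowerSeries.coeff_mul]
  refine Finset.sum_congr rfl fun x _ => ?_
  rw [PowerSeries.coeff_map, Algebra.smul_def, Algebra.commutes]

lemma normFactor_succ (L : ℕ) : normFactor n k (L + 1) = normFactor n k L *
    ((1 + PowerSeries.C (((n + k) * (L + 1) : ℕ) : ℂ) * PowerSeries.X) *
      (1 + PowerSeries.C ((k + (n + k) * (L + 1) : ℕ) : ℂ) * PowerSeries.X)⁻¹) :=
  Finset.prod_Icc_succ_top (Nat.le_add_left 1 L) _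

theorem IsTransitionMap.comp_coeff_tildeT (hn : 0 < n)
    {p : hilb (N + n) n k →ₗ[ℂ] hilb N n k} (hp : IsTransitionMap N n k p) (a b : Fin n) (m : ℕ) :
    p ∘ₗ PowerSeries.coeff m (tildeT (N + n) n k a b) =
      PowerSeries.coeff m (tildeT N n k a b) ∘ₗ p := by
  have hL : (N + n) / n = N / n + 1 := Nat.add_div_right N hn
  have hc : (((k + n) * ((N + n) / n) : ℕ) : ℂ) = (((k + n) * (N / n) : ℕ) : ℂ) + k + n := by
    rw [hL]; push_cast; ring
  have h := sum_coeff_smul_eq_of_recursion (normFactor n k (N / n))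
    (t' := fun i => p ∘ₗ PowerSeries.coeff i (shiftedT (N + n) n k a b))
    (t := fun i => PowerSeries.coeff i (shiftedT N n k a b) ∘ₗ p)
    (α := (((n + k) * (N / n + 1) : ℕ) : ℂ)) (β := ((k + (n + k) * (N / n + 1) : ℕ) : ℂ))
    (by
      simp only [coeff_zero_shiftedT]
      split_ifs
      · rfl
      · simp)
    (by
      -- The constants of the last normalising factor are α = c' and β = c' + k for c' = (k + n)(L +
      -- 1).
      have e1 : (((n + k) * (N / n + 1) : ℕ) : ℂ) = (((k + n) * ((N + n) / n) : ℕ) : ℂ) := by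
        rw [hL, add_comm n k]
      have e2 : ((k + (n + k) * (N / n + 1) : ℕ) : ℂ) =
          (((k + n) * ((N + n) / n) : ℕ) : ℂ) + k := by
        rw [Nat.cast_add, e1, add_comm]
      intro i
      rw [e1, e2]
      rcases i with _ | s
      · simp only [coeff_succ_shiftedT, coeff_zero_shiftedT]
        rw [hp.hilbMode_zero hc, add_assoc]
        congr 1
        split_ifs
        · rw [add_comm (_ : ℂ) (k : ℂ), add_smul]; rfl
        · simp
      · simp only [coeff_succ_shiftedT]
        exact hp.hilbMode_succ hc a b s) m
  rw [coeff_tildeT, coeff_tildeT, hL, normFactor_succ]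
  refine LinearMap.ext fun w => ?_
  simpa only [LinearMap.comp_apply, LinearMap.sum_apply, LinearMap.smul_apply, map_sum,
    map_smul] using LinearMap.congr_fun h w

/-- Any c equals (c - k - n) + k + n, and once p w = 0 the right sides of the mode relations vanish.
-/
lemma IsTransitionMap.hilbMode_apply_eq_zero
    {p : hilb (N + n) n k →ₗ[ℂ] hilb N n k} (hp : IsTransitionMap N n k p) (c : ℂ) (s : ℕ)
    (a b : Fin n) {w : hilb (N + n) n k} (hw : p w = 0) :
    p (hilbMode (N + n) n k c s a b w) = 0 := by
  have hc : c = (c - k - n) + k + n := by ring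
  induction s with
  | zero =>
    have := LinearMap.congr_fun (hp.hilbMode_zero hc a b) w
    split_ifs at this <;> simpa [hw] using this
  | succ s ih =>
    have := LinearMap.congr_fun (hp.hilbMode_succ hc a b s) w
    simpa [hw, ih] using this

end Coefficients

/-! ### The Fock inner product and adjoints of the modes. -/

section FockSpace

variable {N n : ℕ}

lemma fockInner_eq_sum (w v : Poly N n) {s : Finset (Coord N n →₀ ℕ)} (hs : v.support ⊆ s) :
    fockInner w v = ∑ m ∈ s, starRingEnd ℂ (w.coeff m) * v.coeff m *
      ((m.prod fun _ e => e.factorial : ℕ) : ℂ) := by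
  rw [fockInner]
  refine Finset.sum_subset hs fun m _ hm => ?_
  rw [notMem_support_iff.mp hm, mul_zero, zero_mul]

lemma conj_fockInner (w v : Poly N n) : starRingEnd ℂ (fockInner v w) = fockInner w v := by
  classical
  rw [fockInner_eq_sum v w Finset.subset_union_left,
    fockInner_eq_sum w v (Finset.subset_union_right (s₁ := w.support)), map_sum]
  refine Finset.sum_congr rfl fun m _ => ?_
  rw [map_mul, map_mul, Complex.conj_conj, Complex.conj_natCast, mul_comm (coeff m v)]

lemma fockInner_add_left (w w' v : Poly N n) :
    fockInner (w + w') v = fockInner w v + fockInner w' v := by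
  simp only [fockInner, coeff_add, map_add, add_mul, Finset.sum_add_distrib]

lemma fockInner_smul_left (c : ℂ) (w v : Poly N n) :
    fockInner (c • w) v = starRingEnd ℂ c * fockInner w v := by
  simp only [fockInner, coeff_smul, smul_eq_mul, map_mul, Finset.mul_sum, mul_assoc]

lemma fockInner_self (w : Poly N n) :
    fockInner w w = ((∑ m ∈ w.support, Complex.normSq (w.coeff m) *
      ((m.prod fun _ e => e.factorial : ℕ) : ℝ) : ℝ) : ℂ) := by
  rw [fockInner, Complex.ofReal_sum]
  refine Finset.sum_congr rfl fun m _ => ?_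
  rw [mul_comm (starRingEnd ℂ _), Complex.mul_conj, Complex.ofReal_mul, Complex.ofReal_natCast]

/-- The Fock space inner product in the form expected by Mathlib's inner product spaces. -/
@[reducible]
def fockCore (N n : ℕ) : InnerProductSpace.Core ℂ (Poly N n) where
  inner := fockInner
  conj_inner_symm := conj_fockInner
  re_inner_nonneg w := by
    rw [fockInner_self]
    exact Finset.sum_nonneg fun m _ => mul_nonneg (Complex.normSq_nonneg _) (Nat.cast_nonneg _)
  add_left := fockInner_add_left
  smul_left w v c := fockInner_smul_left c w v
  definite w hw := by
    rw [fockInner_self, Complex.ofReal_eq_zero, Finset.sum_eq_zero_iff_of_nonneg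
      fun m _ => mul_nonneg (Complex.normSq_nonneg _) (Nat.cast_nonneg _)] at hw
    refine MvPolynomial.ext _ _ fun m => ?_
    by_cases hm : m ∈ w.support
    · have hfac : ((m.prod fun _ e => e.factorial : ℕ) : ℝ) ≠ 0 :=
        Nat.cast_ne_zero.mpr (Finset.prod_ne_zero_iff.mpr fun _ _ => Nat.factorial_ne_zero _)
      exact Complex.normSq_eq_zero.mp ((mul_eq_zero.mp (hw m hm)).resolve_right hfac)
    · simpa using hm

lemma eq_zero_of_fockInner_self {w : Poly N n} (hw : fockInner w w = 0) : w = 0 :=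
  (fockCore N n).definite w hw

/-- The inner product with a fixed vector in the first argument, as a linear functional. -/
def fockInnerRight (w : Poly N n) : Poly N n →ₗ[ℂ] ℂ where
  toFun := fockInner w
  map_add' u v := by
    rw [← conj_fockInner, fockInner_add_left, map_add, conj_fockInner, conj_fockInner]
  map_smul' c v := by
    rw [← conj_fockInner, fockInner_smul_left, map_mul, conj_fockInner, Complex.conj_conj]
    rfl

@[simp]
lemma fockInnerRight_apply (w v : Poly N n) : fockInnerRight w v = fockInner w v := rfl

lemma exists_mem_fockInner_sub_eq_zero (K : Submodule ℂ (Poly N n)) [FiniteDimensional ℂ K]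
    (f : Poly N n) : ∃ g ∈ K, ∀ w ∈ K, fockInner w (f - g) = 0 := by
  let _ : NormedAddCommGroup (Poly N n) := (fockCore N n).toNormedAddCommGroup
  let _ : InnerProductSpace ℂ (Poly N n) := InnerProductSpace.ofCore (fockCore N n).toCore
  exact ⟨K.starProjection f, K.starProjection_apply_mem f,
    K.sub_starProjection_mem_orthogonal f⟩

lemma fockInner_eq_of_coeff_eq {w w' v : Poly N n} (h : ∀ m ∈ v.support, w.coeff m = w'.coeff m) :
    fockInner w v = fockInner w' v := by
  rw [fockInner, fockInner]
  exact Finset.sum_congr rfl fun m hm => by rw [h m hm]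

lemma fockInner_monomial (w : Poly N n) (m : Coord N n →₀ ℕ) (c : ℂ) :
    fockInner w (monomial m c) = starRingEnd ℂ (w.coeff m) * c *
      ((m.prod fun _ e => e.factorial : ℕ) : ℂ) := by
  rw [fockInner_eq_sum w _ (support_monomial_subset), Finset.sum_singleton, coeff_monomial,
    if_pos rfl]

lemma prod_factorial_add_single {σ : Type*} [Fintype σ] (m : σ →₀ ℕ) (v : σ) :
    ((m + Finsupp.single v 1).prod fun _ e => e.factorial) =
      (m v + 1) * m.prod fun _ e => e.factorial := by
  classical
  rw [Finsupp.prod_fintype _ _ fun _ => Nat.factorial_zero,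
    Finsupp.prod_fintype _ _ fun _ => Nat.factorial_zero,
    ← Finset.mul_prod_erase Finset.univ _ (Finset.mem_univ v),
    ← Finset.mul_prod_erase Finset.univ (fun i => (m i).factorial) (Finset.mem_univ v), ← mul_assoc]
  congr 1
  · simp [Nat.factorial_succ]
  · refine Finset.prod_congr rfl fun i hi => ?_
    rw [Finsupp.add_apply, Finsupp.single_eq_of_ne (Finset.ne_of_mem_erase hi), add_zero]

/-- `Q` is adjoint to `P` for the Fock space inner product. -/
def IsAdjointOp (P Q : Op N n) : Prop := ∀ w u, fockInner (P w) u = fockInner w (Q u)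

lemma IsAdjointOp.symm {P Q : Op N n} (h : IsAdjointOp P Q) : IsAdjointOp Q P := by
  intro w u
  rw [← conj_fockInner, ← h, conj_fockInner]

/-- Checked on monomials, where it is (m + 1)! = (m + 1) m! in the variable v. -/
lemma isAdjointOp_pderiv (v : Coord N n) :
    IsAdjointOp (pderiv v : Derivation ℂ (Poly N n) (Poly N n)).toLinearMap
      (LinearMap.mulLeft ℂ (X v)) := by
  intro w u
  change fockInnerRight (pderiv v w) u = (fockInnerRight w ∘ₗ LinearMap.mulLeft ℂ (X v)) u
  congr 1
  refine MvPolynomial.linearMap_ext fun m => LinearMap.ext_ring ?_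
  have hX : (X v : Poly N n) * monomial m 1 = monomial (m + Finsupp.single v 1) 1 := by
    rw [X, monomial_mul, one_mul, add_comm]
  simp only [LinearMap.comp_apply, LinearMap.mulLeft_apply, fockInnerRight_apply, hX,
    fockInner_monomial, coeff_pderiv, prod_factorial_add_single]
  simp only [map_mul, map_add, Complex.conj_natCast, map_one]
  push_cast
  ring

/-- The entrywise adjoint of a matrix of operators is the transpose of `M'`. -/
def IsAdjointMatrix {α β : Type} (M : Matrix α β (Op N n)) (M' : Matrix β α (Op N n)) : Prop :=
  ∀ i j, IsAdjointOp (M i j) (M' j i)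

lemma IsAdjointMatrix.mul {α β γ : Type} [Fintype β] {M : Matrix α β (Op N n)}
    {M' : Matrix β α (Op N n)} {P : Matrix β γ (Op N n)} {P' : Matrix γ β (Op N n)}
    (hM : IsAdjointMatrix M M') (hP : IsAdjointMatrix P P') :
    IsAdjointMatrix (M * P) (P' * M') := by
  intro i j w u
  have hsum : ∀ x : β → Poly N n, fockInner (∑ l, x l) u = ∑ l, fockInner (x l) u := by
    intro x
    rw [← conj_fockInner, ← fockInnerRight_apply, map_sum, map_sum]
    exact Finset.sum_congr rfl fun l _ => conj_fockInner _ _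
  rw [Matrix.mul_apply, Matrix.mul_apply, LinearMap.sum_apply, LinearMap.sum_apply, hsum,
    ← fockInnerRight_apply, map_sum]
  refine Finset.sum_congr rfl fun l _ => ?_
  rw [Module.End.mul_apply, Module.End.mul_apply, hM, hP, fockInnerRight_apply]

lemma IsAdjointMatrix.sub_smul_one {α : Type} [DecidableEq α] {M M' : Matrix α α (Op N n)}
    (hM : IsAdjointMatrix M M') {c : ℂ} (hc : starRingEnd ℂ c = c) :
    IsAdjointMatrix (M - c • (1 : Matrix α α (Op N n))) (M' - c • 1) := by
  intro i j w u
  have hsub : ∀ x y : Poly N n, fockInner (x - y) u = fockInner x u - fockInner y u := by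
    intro x y
    rw [eq_sub_iff_add_eq, ← fockInner_add_left, sub_add_cancel]
  rw [Matrix.sub_apply, Matrix.sub_apply, LinearMap.sub_apply, LinearMap.sub_apply, hsub,
    ← fockInnerRight_apply w, map_sub, fockInnerRight_apply, hM i j w u]
  congr 1
  by_cases h : i = j
  · subst h
    simp only [Matrix.smul_apply, Matrix.one_apply_eq, LinearMap.smul_apply, Module.End.one_apply,
      fockInner_smul_left, hc, map_smul, fockInnerRight_apply, smul_eq_mul]
  · simp only [Matrix.smul_apply, Matrix.one_apply_ne h, Matrix.one_apply_ne (Ne.symm h), smul_zero,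
      LinearMap.zero_apply, map_zero]
    simp [fockInner]

lemma IsAdjointMatrix.pow {α : Type} [Fintype α] [DecidableEq α] {M M' : Matrix α α (Op N n)}
    (hM : IsAdjointMatrix M M') (s : ℕ) : IsAdjointMatrix (M ^ s) (M' ^ s) := by
  induction s with
  | zero =>
    intro i j w u
    by_cases h : i = j
    · simp [h]
    · simp [h, Ne.symm h, fockInner]
  | succ s ih =>
    rw [pow_succ, pow_succ']
    exact ih.mul hM

lemma isAdjointMatrix_opX : IsAdjointMatrix (opX N n) (opY N n) :=
  fun _ _ => (isAdjointOp_pderiv _).symm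

lemma isAdjointMatrix_opY : IsAdjointMatrix (opY N n) (opX N n) :=
  fun _ _ => isAdjointOp_pderiv _

lemma isAdjointMatrix_opA : IsAdjointMatrix (opA N n) (opB N n) :=
  fun _ _ => (isAdjointOp_pderiv _).symm

lemma isAdjointMatrix_opB : IsAdjointMatrix (opB N n) (opA N n) :=
  fun _ _ => isAdjointOp_pderiv _

/-- X and Y, and A and B, are mutually adjoint with transposed indices, so A(XY - c)^s B reverses
into itself for real c: the adjoint of entry (a, b) is entry (b, a). -/
lemma isAdjointMatrix_mode {c : ℂ} (hc : starRingEnd ℂ c = c) (s : ℕ) :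
    IsAdjointMatrix (mode N n c s) (mode N n c s) := by
  have h := (isAdjointMatrix_opA (N := N) (n := n)).mul
    ((((isAdjointMatrix_opX.mul isAdjointMatrix_opY).sub_smul_one hc).pow s).mul
      isAdjointMatrix_opB)
  rwa [← Matrix.mul_assoc] at h

end FockSpace

/-! ### The Hermitian section and its intertwining property. -/

section Section

variable {N n k : ℕ}

lemma auxRestrict_homogeneousComponent (e : ℕ) (f : Poly (N + n) n) :
    homogeneousComponent e (auxRestrict N n f) = auxRestrict N n (homogeneousComponent e f) := by
  refine homogeneousComponent_aeval _ (fun v => ?_) e f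
  rcases v with ⟨i, j⟩ | ⟨a, i⟩
  · refine Fin.addCases (fun i => ?_) (fun i => ?_) i
    · refine Fin.addCases (fun j => ?_) (fun j => ?_) j
      · simpa using isHomogeneous_X _ _
      · simpa using isHomogeneous_zero _ _ _
    · simpa using isHomogeneous_zero _ _ _
  · refine Fin.addCases (fun i => ?_) (fun i => ?_) i
    · simpa using isHomogeneous_X _ _
    · simpa using isHomogeneous_X _ _

/-- The kernel of the transition map as a subspace of the polynomial ring. -/
def restrictKer (N n k : ℕ) : Submodule ℂ (Poly (N + n) n) :=
  hilb (N + n) n k ⊓ LinearMap.ker (auxRestrict N n).toLinearMap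

lemma mem_restrictKer {w : Poly (N + n) n} :
    w ∈ restrictKer N n k ↔ w ∈ hilb (N + n) n k ∧ auxRestrict N n w = 0 := Iff.rfl

lemma homogeneousComponent_mem_restrictKer {w : Poly (N + n) n} (hw : w ∈ restrictKer N n k)
    (e : ℕ) : homogeneousComponent e w ∈ restrictKer N n k := by
  rw [mem_restrictKer] at hw ⊢
  refine ⟨homogeneousComponent_mem_hilb hw.1 e, ?_⟩
  rw [← auxRestrict_homogeneousComponent, hw.2, map_zero]

/-- The kernel is infinite-dimensional in general but graded, so it is enough to project onto its
finite-dimensional part of degree at most that of f. -/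
lemma exists_sub_mem_restrictKer_orthogonal (f : Poly (N + n) n) :
    ∃ g ∈ restrictKer N n k, ∀ w ∈ restrictKer N n k, fockInner w (f - g) = 0 := by
  obtain ⟨g, hg, hgw⟩ := exists_mem_fockInner_sub_eq_zero
    (restrictKer N n k ⊓ restrictTotalDegree (Coord (N + n) n) ℂ f.totalDegree) f
  refine ⟨g, hg.1, fun w hw => ?_⟩
  have hdeg : (f - g).totalDegree ≤ f.totalDegree :=
    (totalDegree_sub f g).trans (max_le le_rfl ((mem_restrictTotalDegree _ _ _).mp hg.2))
  -- The truncation of w stays in the kernel and has the same coefficients as w on the support of f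
  -- - g.
  rw [← hgw (∑ e ∈ Finset.range (f.totalDegree + 1), homogeneousComponent e w)
    ⟨Submodule.sum_mem _ fun e _ => homogeneousComponent_mem_restrictKer hw e,
      Submodule.sum_mem _ fun e he => (mem_restrictTotalDegree _ _ _).mpr
        ((homogeneousComponent_isHomogeneous e w).totalDegree_le.trans
          (Nat.lt_succ_iff.mp (Finset.mem_range.mp he)))⟩]
  refine fockInner_eq_of_coeff_eq fun m hm => ?_
  have hm' : m.degree ∈ Finset.range (f.totalDegree + 1) :=
    Finset.mem_range.mpr (Nat.lt_succ_iff.mpr ((le_totalDegree hm).trans hdeg))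
  rw [coeff_sum, Finset.sum_eq_single_of_mem _ hm', coeff_homogeneousComponent, if_pos rfl]
  intro e _ he
  rw [coeff_homogeneousComponent, if_neg he.symm]

variable {p : hilb (N + n) n k →ₗ[ℂ] hilb N n k}

lemma IsTransitionMap.surjective (hp : IsTransitionMap N n k p) : Function.Surjective p := by
  intro v
  obtain ⟨f, hf, h⟩ := exists_lift v.2
  refine ⟨⟨f, hf⟩, Subtype.ext (detMul_injective (N := N) (n := n) (k := k) ?_)⟩
  rw [hp.detMul_apply]
  exact h

lemma IsTransitionMap.exists_orthogonal_preimage (hp : IsTransitionMap N n k p) (v : hilb N n k) :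
    ∃ f : hilb (N + n) n k, p f = v ∧ ∀ w : hilb (N + n) n k, p w = 0 →
      fockInner (w : Poly (N + n) n) f = 0 := by
  obtain ⟨f, rfl⟩ := hp.surjective v
  obtain ⟨g, hg, hgw⟩ := exists_sub_mem_restrictKer_orthogonal (k := k) (f : Poly (N + n) n)
  obtain ⟨hg1, hg2⟩ := mem_restrictKer.mp hg
  lift g to hilb (N + n) n k using hg1
  refine ⟨f - g, ?_, fun w hw => ?_⟩
  · rw [map_sub, (hp.apply_eq_zero_iff g).mpr hg2, sub_zero]
  · rw [Submodule.coe_sub]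
    exact hgw w (mem_restrictKer.mpr ⟨w.2, (hp.apply_eq_zero_iff w).mp hw⟩)

/-- Elements of `ker(p)^⊥` are determined by their images under `p`. -/
lemma eq_of_apply_eq_of_orthogonal {f g : hilb (N + n) n k} (h : p f = p g)
    (hf : ∀ w : hilb (N + n) n k, p w = 0 → fockInner (w : Poly (N + n) n) f = 0)
    (hg : ∀ w : hilb (N + n) n k, p w = 0 → fockInner (w : Poly (N + n) n) g = 0) : f = g := by
  have h0 : p (f - g) = 0 := by rw [map_sub, h, sub_self]
  refine sub_eq_zero.mp (Subtype.ext (eq_zero_of_fockInner_self ?_))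
  have key : ∀ w : hilb (N + n) n k, p w = 0 →
      fockInner (w : Poly (N + n) n) (f - g : hilb (N + n) n k) = 0 := by
    intro w hw
    rw [Submodule.coe_sub, ← fockInnerRight_apply, map_sub, fockInnerRight_apply,
      fockInnerRight_apply, hf w hw, hg w hw, sub_zero]
  exact key _ h0

theorem IsTransitionMap.existsUnique_section (hp : IsTransitionMap N n k p) :
    ∃! σ : hilb N n k →ₗ[ℂ] hilb (N + n) n k, IsHermitianSection p σ := by
  choose σ hσ hσ' using hp.exists_orthogonal_preimage
  refine ⟨⟨⟨σ, fun u v => ?_⟩, fun c v => ?_⟩, ⟨LinearMap.ext hσ, hσ'⟩, fun τ hτ => ?_⟩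
  · refine eq_of_apply_eq_of_orthogonal (p := p) ?_ (hσ' _) fun w hw => ?_
    · rw [map_add, hσ, hσ, hσ]
    · change fockInnerRight (w : Poly (N + n) n) ((σ u : Poly (N + n) n) + σ v) = 0
      rw [map_add, fockInnerRight_apply, fockInnerRight_apply, hσ' u w hw, hσ' v w hw, add_zero]
  · refine eq_of_apply_eq_of_orthogonal (p := p) ?_ (hσ' _) fun w hw => ?_
    · rw [RingHom.id_apply, map_smul, hσ, hσ]
    · change fockInnerRight (w : Poly (N + n) n) (c • (σ v : Poly (N + n) n)) = 0
      rw [map_smul, fockInnerRight_apply, hσ' v w hw, smul_zero]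
  · refine LinearMap.ext fun v => ?_
    refine eq_of_apply_eq_of_orthogonal (p := p) ?_ (hτ.2 v) (hσ' v)
    exact (LinearMap.congr_fun hτ.1 v).trans (hσ v).symm

lemma coe_hilbMode_apply (M : ℕ) (c : ℂ) (s : ℕ) (a b : Fin n) (f : hilb M n k) :
    (hilbMode M n k c s a b f : Poly M n) = mode M n c s a b f := rfl

/-- The adjoint mode, with a and b exchanged, maps w back into ker p, to which f is orthogonal. -/
lemma IsTransitionMap.orthogonal_coeff_shiftedT (hp : IsTransitionMap N n k p) (a b : Fin n)
    (i : ℕ) {f : hilb (N + n) n k}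
    (hf : ∀ w : hilb (N + n) n k, p w = 0 → fockInner (w : Poly (N + n) n) f = 0)
    {w : hilb (N + n) n k} (hw : p w = 0) :
    fockInner (w : Poly (N + n) n) (PowerSeries.coeff i (shiftedT (N + n) n k a b) f) = 0 := by
  rcases i with _ | s
  · rw [coeff_zero_shiftedT]
    split_ifs
    · exact hf w hw
    · exact map_zero (fockInnerRight (w : Poly (N + n) n))
  · rw [coeff_succ_shiftedT]
    have h := isAdjointMatrix_mode (N := N + n) (n := n)
      (c := (((k + n) * ((N + n) / n) : ℕ) : ℂ)) (Complex.conj_natCast _) s b a w f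
    have h0 := hf _ (hp.hilbMode_apply_eq_zero (((k + n) * ((N + n) / n) : ℕ) : ℂ) s b a hw)
    rw [coe_hilbMode_apply] at h0 ⊢
    rw [← h, h0]

lemma IsTransitionMap.orthogonal_coeff_tildeT (hp : IsTransitionMap N n k p) (a b : Fin n)
    (m : ℕ) {f : hilb (N + n) n k}
    (hf : ∀ w : hilb (N + n) n k, p w = 0 → fockInner (w : Poly (N + n) n) f = 0)
    {w : hilb (N + n) n k} (hw : p w = 0) :
    fockInner (w : Poly (N + n) n) (PowerSeries.coeff m (tildeT (N + n) n k a b) f) = 0 := by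
  rw [coeff_tildeT, LinearMap.sum_apply, ← fockInnerRight_apply, Submodule.coe_sum, map_sum]
  refine Finset.sum_eq_zero fun x _ => ?_
  rw [LinearMap.smul_apply, Submodule.coe_smul, map_smul, fockInnerRight_apply,
    hp.orthogonal_coeff_shiftedT a b x.1 hf hw, smul_zero]

/-- Both sides lie in ker(p)^⊥, where p is injective, and p identifies them by the intertwining
relation already proved for p. -/
theorem IsTransitionMap.section_comp_coeff_tildeT (hn : 0 < n) (hp : IsTransitionMap N n k p)
    {σ : hilb N n k →ₗ[ℂ] hilb (N + n) n k} (hσ : IsHermitianSection p σ) (a b : Fin n) (m : ℕ) :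
    σ ∘ₗ PowerSeries.coeff m (tildeT N n k a b) =
      PowerSeries.coeff m (tildeT (N + n) n k a b) ∘ₗ σ := by
  refine LinearMap.ext fun v => ?_
  have hpσ : ∀ v, p (σ v) = v := LinearMap.congr_fun hσ.1
  refine eq_of_apply_eq_of_orthogonal (p := p) ?_ (hσ.2 _)
    fun w hw => hp.orthogonal_coeff_tildeT a b m (hσ.2 v) hw
  have h := LinearMap.congr_fun (hp.comp_coeff_tildeT hn a b m) (σ v)
  simp only [LinearMap.comp_apply, hpσ] at h ⊢
  exact h.symm

end Section

end MatrixModel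

end

theorem mainTheorem5 (n k N : ℕ) (hn : 0 < n) (hk : 0 < k) :
    (∃! p : MatrixModel.hilb (N + n) n k →ₗ[ℂ] MatrixModel.hilb N n k,
      MatrixModel.IsTransitionMap N n k p) ∧
    ∀ p : MatrixModel.hilb (N + n) n k →ₗ[ℂ] MatrixModel.hilb N n k,
      MatrixModel.IsTransitionMap N n k p →
      (∃! σ : MatrixModel.hilb N n k →ₗ[ℂ] MatrixModel.hilb (N + n) n k,
        MatrixModel.IsHermitianSection p σ) ∧
      (∀ (a b : Fin n) (m : ℕ),
        p ∘ₗ PowerSeries.coeff m (MatrixModel.tildeT (N + n) n k a b) =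
          PowerSeries.coeff m (MatrixModel.tildeT N n k a b) ∘ₗ p) ∧
      ∀ σ : MatrixModel.hilb N n k →ₗ[ℂ] MatrixModel.hilb (N + n) n k,
        MatrixModel.IsHermitianSection p σ →
        ∀ (a b : Fin n) (m : ℕ),
          σ ∘ₗ PowerSeries.coeff m (MatrixModel.tildeT N n k a b) =
            PowerSeries.coeff m (MatrixModel.tildeT (N + n) n k a b) ∘ₗ σ := by
  exact ⟨MatrixModel.existsUnique_transition hn, fun p hp =>
    ⟨hp.existsUnique_section, hp.comp_coeff_tildeT hn,
      fun _ hσ => hp.section_comp_coeff_tildeT hn hσ⟩⟩
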